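/- **Setting.** Let $d\ge 1$, $M>0$, let $F\in C^\infty([-M,M],\mathbb R^d)$, and put $a=F'$. For $\alpha>0$ consider the condition: there is a constant $C$ such that for all $\delta>0$ and all $(\tau,\xi)\in\mathbb R\times\mathbb R^d$ with $\tau^2+|\xi|^2=1$, $$\operatorname{meas}\{v\in[-M,M] : |\tau+a(v)\cdot\xi|\le\delta\}\le C\,\delta^{\alpha}.\qquad(*)$$ The flux $F$ is *nonlinear* on $[-M,M]$ if $(*)$ holds for some $\alpha>0$; then $\alpha_{\sup}$ denotes the supremum of all such $\alpha$. Entropy solutions of $$\partial_t u+\operatorname{div}_x F(u)=0,\qquad u(0,\cdot)=u_0,$$ on $[0,T)\times\mathbb R^d$ ($0<T\le\infty$) are understood in the sense of Kruzhkov, with data and solutions measurable and with values in $[-M,M]$ almost everywhere. For $s\ge0$, $W^{s,1}$ is the Sobolev space with the intrinsic (Slobodeckij) norm, that is, with $m=\lfloor s\rfloor$ and $\sigma=s-m$, the $L^1$ norms of the weak derivatives up to order $m$ and, if $\sigma>0$, the seminorm $\iint |D^mu(x)-D^mu(y)|\,|x-y|^{-n-\sigma}\,dx\,dy$ in $n$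 variables; the norm is $\infty$ outside the space. A family is bounded in $W^{s,1}_{loc}([0,T_0]\times\mathbb R^d)$, respectively in $C^0([0,T_0],W^{s,1}_{loc}(\mathbb R^d))$, if each point of $[0,T_0]\times\mathbb R^d$, respectively of $\mathbb R^d$, has a (relative) neighbourhood on which the $W^{s,1}$ norms of the functions, respectively of all their time slices at $t\in[0,T_0]$, are bounded uniformly over the family (in the second case the functions are also continuous from $[0,T_0]$ to $W^{s,1}_{loc}(\mathbb R^d)$); it is unbounded if there is no such uniform bound on the norms. **Theorem (Bound of the maximal smoothing effect).** Let $F\in C^\infty([-M,M],\mathbb R^d)$ be nonlinear on $[-M,M]$. Then there exist a constant $\underline u\in[-M,M]$, a time $T_0>0$ and measurable initial data $(u_0^\varepsilon)_{0<\varepsilon<1}$ with values in $[-M,M]$ and $\|u_0^\varepsilon-\underline u\|_{L^\infty(\mathbb R^d)}<\varepsilon$, such that for every $\varepsilon\in(0,1)$ there is an entropy solution $u_\varepsilon$ on $[0,T_0)\times\mathbb R^d$ with initial datum $u_0^\varepsilon$, every entropy solution with this datum on a strip $[0,T)\times\mathbb R^d$, $T_0\le T\le\infty$, coincides with $u_\varepsilon$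 almost everywhere on $(0,T_0)\times\mathbb R^d$, and (with $u_\varepsilon$ suitably defined for all $t\in[0,T_0]$): * for all $0\le s\le\alpha_{\sup}$, the family $(u_\varepsilon)_{0<\varepsilon<1}$ is uniformly bounded in $W^{s,1}_{loc}([0,T_0]\times\mathbb R^d)\cap C^0([0,T_0],W^{s,1}_{loc}(\mathbb R^d))$; * for all $s>\alpha_{\sup}$, the family $(u_\varepsilon)_{0<\varepsilon<1}$ is unbounded in $W^{s,1}_{loc}([0,T_0]\times\mathbb R^d)$ and unbounded in $C^0([0,T_0],W^{s,1}_{loc}(\mathbb R^d))$. Consequently $s_{\sup}\le\alpha_{\sup}$, where the uniform smoothing exponent $s_{\sup}$ is the supremum of all $s\ge0$ such that, for every $t>0$, the set of all values $u(t,\cdot)$ of $L^1_{loc}$-continuous (in time) entropy solutions $u$ on strips $[0,T)\times\mathbb R^d$, $t<T\le\infty$, with initial data in $L^\infty(\mathbb R^d,[-M,M])$, is bounded in $W^{s,1}_{loc}(\mathbb R^d)$. -/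

import Mathlib

open MeasureTheory Set Filter Topology
open scoped ENNReal NNReal ContDiff

noncomputable section

namespace ScalarLaw

/-! ### Fractional Sobolev norms `W^{s,1}(Ω)`, `s ≥ 0` -/

section Sobolev

variable {E : Type} [NormedAddCommGroup E] [NormedSpace ℝ E] [MeasureSpace E]

/-- `g` is the weak (distributional) derivative of `u` on the open set `Ω`. -/
def HasWeakDeriv {G : Type} [NormedAddCommGroup G] [NormedSpace ℝ G]
    (Ω : Set E) (u : E → G) (g : E → E →L[ℝ] G) : Prop :=
  LocallyIntegrableOn u Ω ∧ LocallyIntegrableOn g Ω ∧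
    ∀ φ : E → ℝ, ContDiff ℝ ∞ φ → HasCompactSupport φ → tsupport φ ⊆ Ω → ∀ v : E,
      ∫ x in Ω, (fderiv ℝ φ x v) • u x = - ∫ x in Ω, φ x • g x v

/-- The intrinsic (Gagliardo) seminorm of `W^{σ,1}(Ω)`, for `0 < σ < 1`. -/
def gagliardo {G : Type} [NormedAddCommGroup G] (Ω : Set E) (σ : ℝ) (u : E → G) : ℝ≥0∞ :=
  ∫⁻ x in Ω, ∫⁻ y in Ω, ‖u x - u y‖ₑ / ‖x - y‖ₑ ^ ((Module.finrank ℝ E : ℝ) + σ)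

/-- The norm of `W^{m+σ,1}(Ω)` for `m : ℕ` and `0 ≤ σ < 1`: the `L¹` norms of the weak derivatives
of order `≤ m` and, if `σ > 0`, the intrinsic seminorm of the derivative of order `m`. Weak
derivatives are unique almost everywhere; if one of them does not exist, the infimum is over the
empty set and the norm is `∞`. -/
def sobolevNormAux (Ω : Set E) (σ : ℝ) :
    ℕ → ∀ (G : Type) [NormedAddCommGroup G] [NormedSpace ℝ G], (E → G) → ℝ≥0∞
  | 0, _, _, _, u => (∫⁻ x in Ω, ‖u x‖ₑ) + (if 0 < σ then gagliardo Ω σ u else 0)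
  | m + 1, G, _, _, u => (∫⁻ x in Ω, ‖u x‖ₑ) +
      ⨅ (g : E → E →L[ℝ] G) (_ : HasWeakDeriv Ω u g), sobolevNormAux Ω σ m (E →L[ℝ] G) g

/-- The norm of `W^{s,1}(Ω)`, `s ≥ 0`, with value `∞` on functions outside this space. -/
def sobolevNorm (s : ℝ) (Ω : Set E) (u : E → ℝ) : ℝ≥0∞ :=
  sobolevNormAux Ω (Int.fract s) ⌊s⌋₊ ℝ u

/-- The set `𝓕` of functions is bounded in `W^{s,1}_loc` of the closure of the open set `Ω`: every
point of the closure has a neighbourhood on which the `W^{s,1}` norms are uniformly bounded. -/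
def BddSobolevLoc (s : ℝ) (Ω : Set E) (𝓕 : Set (E → ℝ)) : Prop :=
  ∀ x ∈ closure Ω, ∃ A : ℝ, 0 < A ∧ ∃ C : ℝ≥0, ∀ u ∈ 𝓕,
    sobolevNorm s (Metric.ball x A ∩ Ω) u ≤ C

/-- `t ↦ u t` is continuous on `I` with values in `W^{s,1}_loc(E)`. -/
def ContinuousSobolevLoc (s : ℝ) (I : Set ℝ) (u : ℝ → E → ℝ) : Prop :=
  ∀ t₀ ∈ I, ∀ (x : E) (A : ℝ), 0 < A →
    Tendsto (fun t => sobolevNorm s (Metric.ball x A) (u t - u t₀)) (𝓝[I] t₀) (𝓝 0)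

end Sobolev

variable {d : ℕ}

/-! ### Nonlinearity of the flux -/

/-- `a = F'` on `[-M,M]`. -/
def velocity (F : ℝ → EuclideanSpace ℝ (Fin d)) (M : ℝ) (v : ℝ) : EuclideanSpace ℝ (Fin d) :=
  derivWithin F (Icc (-M) M) v

/-- The set `{|v| ≤ M, |τ + a(v)·ξ| ≤ δ}`. -/
def singularSet (F : ℝ → EuclideanSpace ℝ (Fin d)) (M δ τ : ℝ) (ξ : EuclideanSpace ℝ (Fin d)) :
    Set ℝ :=
  {v | v ∈ Icc (-M) M ∧ |τ + inner ℝ (velocity F M v) ξ| ≤ δ}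

/-- The exponents `α > 0` such that, for some `C`, the singular sets have measure at most `C δ^α`,
uniformly on the unit sphere and for all `δ > 0`. -/
def nonlinearityExponents (F : ℝ → EuclideanSpace ℝ (Fin d)) (M : ℝ) : Set ℝ :=
  {α | 0 < α ∧ ∃ C : ℝ, ∀ δ : ℝ, 0 < δ → ∀ (τ : ℝ) (ξ : EuclideanSpace ℝ (Fin d)),
    τ ^ 2 + ‖ξ‖ ^ 2 = 1 → volume (singularSet F M δ τ ξ) ≤ ENNReal.ofReal (C * δ ^ α)}

/-- The flux is nonlinear on `[-M,M]`. -/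
def IsNonlinearFlux (F : ℝ → EuclideanSpace ℝ (Fin d)) (M : ℝ) : Prop :=
  (nonlinearityExponents F M).Nonempty

/-- The sharp nonlinearity exponent `α_sup`. For `d ≥ 1` and `M > 0` the exponents of a smooth flux
are at most `1`, so this is a true supremum for a smooth nonlinear flux. -/
def alphaSup (F : ℝ → EuclideanSpace ℝ (Fin d)) (M : ℝ) : ℝ :=
  sSup (nonlinearityExponents F M)

/-! ### Entropy solutions of `∂ₜ u + div F(u) = 0`, `u(0,·) = u₀` -/

/-- Measurable initial data with values in `[-M,M]`. -/
def IsInitialDatum (M : ℝ) (u₀ : EuclideanSpace ℝ (Fin d) → ℝ) : Prop :=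
  AEStronglyMeasurable u₀ volume ∧ ∀ᵐ x, u₀ x ∈ Icc (-M) M

/-- The open strip `]0,T[ × ℝ^d`, with `T = ⊤` allowed. -/
def strip (d : ℕ) (T : EReal) : Set (ℝ × EuclideanSpace ℝ (Fin d)) :=
  {p | 0 < p.1 ∧ (p.1 : EReal) < T}

/-- `u` is a (Kruzhkov) entropy solution on `[0,T[ × ℝ^d`, `T = ⊤` allowed, with initial datum `u₀`
and values in `[-M,M]`: for all `k` and all test functions `φ ≥ 0` on `]-∞,T[ × ℝ^d`,
`∬ |u-k| ∂ₜφ + sgn(u-k) (F(u)-F(k))·∇φ dx dt + ∫ |u₀-k| φ(0,x) dx ≥ 0`.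
Since `u` has values in `[-M,M]` it is enough to consider `k ∈ [-M,M]`: the values `k = ±M` give the
two inequalities of the weak formulation, hence the condition for `|k| > M`. -/
structure IsEntropySolution (F : ℝ → EuclideanSpace ℝ (Fin d)) (M : ℝ) (T : EReal)
    (u₀ : EuclideanSpace ℝ (Fin d) → ℝ) (u : ℝ → EuclideanSpace ℝ (Fin d) → ℝ) : Prop where
  aestronglyMeasurable :
    AEStronglyMeasurable (Function.uncurry u) (volume.restrict (strip d T))
  mem_Icc : ∀ᵐ p ∂(volume.restrict (strip d T)), Function.uncurry u p ∈ Icc (-M) M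
  entropy : ∀ k ∈ Icc (-M) M, ∀ φ : ℝ × EuclideanSpace ℝ (Fin d) → ℝ,
    ContDiff ℝ ∞ φ → HasCompactSupport φ → (∀ p, 0 ≤ φ p) →
    tsupport φ ⊆ {p | (p.1 : EReal) < T} →
    0 ≤ (∫ p in strip d T, (|u p.1 p.2 - k| * fderiv ℝ φ p (1, 0) +
          Real.sign (u p.1 p.2 - k) * fderiv ℝ φ p (0, F (u p.1 p.2) - F k))) +
        ∫ x, |u₀ x - k| * φ (0, x)

/-- `t ↦ u t` is continuous from `[0,T[` to `L¹_loc(ℝ^d)`. -/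
def ContinuousL1Loc (T : EReal) (u : ℝ → EuclideanSpace ℝ (Fin d) → ℝ) : Prop :=
  ∀ t₀ ∈ {t : ℝ | 0 ≤ t ∧ (t : EReal) < T},
    AEStronglyMeasurable (u t₀) volume ∧ ∀ (x : EuclideanSpace ℝ (Fin d)) (A : ℝ), 0 < A →
      Tendsto (fun t => ∫⁻ y in Metric.ball x A, ‖u t y - u t₀ y‖ₑ)
        (𝓝[{t : ℝ | 0 ≤ t ∧ (t : EReal) < T}] t₀) (𝓝 0)

/-- The image at time `t` of the data with values in `[-M,M]` under the entropy solution operator: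
the values at time `t` of the entropy solutions, in their `L¹_loc`-continuous representatives, on
strips `[0,T[ × ℝ^d` with `t < T ≤ ∞`. -/
def solutionsAt (F : ℝ → EuclideanSpace ℝ (Fin d)) (M t : ℝ) :
    Set (EuclideanSpace ℝ (Fin d) → ℝ) :=
  {v | ∃ (T : EReal) (u₀ : EuclideanSpace ℝ (Fin d) → ℝ) (u : ℝ → EuclideanSpace ℝ (Fin d) → ℝ),
    (t : EReal) < T ∧ IsInitialDatum M u₀ ∧ IsEntropySolution F M T u₀ u ∧
      ContinuousL1Loc T u ∧ v = u t}

/-- The uniform smoothing exponent `s_sup`: the supremum of all `s ≥ 0` such that for every `t > 0`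
the set of values at time `t` is bounded in `W^{s,1}_loc(ℝ^d)`. -/
def uniformSmoothingSup (F : ℝ → EuclideanSpace ℝ (Fin d)) (M : ℝ) : EReal :=
  ⨆ (s : ℝ) (_ : 0 ≤ s ∧ ∀ t : ℝ, 0 < t → BddSobolevLoc s univ (solutionsAt F M t)), (s : EReal)

end ScalarLaw

end

namespace ScalarLaw

/-! ### Sublevel sets of functions with a non-vanishing derivative -/

/-! The number `alphaSup F M` equals 1/q, where q is the largest integer for which some state c and
some unit vector ξ satisfy a^(k)(c)·ξ = 0 for 1 ≤ k < q. With τ = -a(c)·ξ, Taylor expansion gives |τ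
+ a(v)·ξ| ≤ C|v-c|^q, so singular sets at height δ have length at least of order δ^(1/q), and no
exponent exceeds 1/q (`IsDegenerate.exponent_mul_le_one`). Conversely, by maximality of q and
compactness, at every state and in every direction one of the first q derivatives of a·ξ is bounded
below, and a sublevel estimate shows that 1/q is an exponent (`volume_sublevel_le`,
`one_div_mem_nonlinearityExponents`).

The solutions are plane waves about c in the direction ξ, of amplitude comparable to ε and wave
length ε^q. In the frame moving with speed a(c)·ξ the remaining characteristic speeds are O(ε^q),
that is O(1) wave lengths per unit time. In the rescaled phase the characteristic map is θ ↦ θ +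
tG(θ), with G and G' bounded independently of ε. It stays invertible up to a time T₀ that does not
depend on ε, so no shock forms and the wave keeps its amplitude and wave length
(`exists_inverse_characteristic`, `exists_oscillating_solution`).

For s ≤ 1/q the W^{s,1} norms are bounded, because interpolation between amplitude and Lipschitz
constant controls the seminorm by a multiple of ε·ε^(-qs) ≤ 1 (`gagliardo_le`,
`exists_sobolevNorm_wave_le`). For s > 1/q they blow up: near every point, at distance O(ε^q), there
is a ball of comparable radius on which the wave has changed by a fixed fraction of its amplitude,
which bounds the seminorm or the L¹ norm of the gradient from below (`Oscillates`,
`exists_le_sobolevNorm_wave`). If q = 1 the gradient only stays of order one, and the same argument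
is applied to the gradient.

Smooth solutions satisfy the Kruzhkov inequalities by regularising |u-k|
(`IsClassicalSolution.isEntropySolution`). They are the only entropy solutions with their data by a
relative entropy argument: averaging the Kruzhkov inequalities over k yields the quadratic entropy,
and a cone cut-off with exponential damping localises the comparison (`IsEntropyPair.relative`,
`IsEntropyPair.ae_eq`). The bound on the smoothing exponent follows because these waves, at time
T₀/2, are values of the solution operator. -/

lemma exists_abs_deriv_le_of_separated {h : ℕ → ℝ → ℝ} {a b ρ : ℝ} (hρ : 0 < ρ)
    (hh : ∀ k, ∀ v ∈ Icc a b, HasDerivWithinAt (h k) (h (k + 1) v) (Icc a b) v) (k : ℕ) :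
    ∀ (δ : ℝ) (j : ℕ) (x : ℕ → ℝ), (∀ i < 2 ^ k, x i ∈ Icc a b ∧ |h j (x i)| ≤ δ) →
      (∀ i, i + 1 < 2 ^ k → x i + ρ ≤ x (i + 1)) →
      ∃ y ∈ Icc a b, |h (j + k) y| ≤ (2 / ρ) ^ k * δ := by
  induction k with
  | zero =>
    intro δ j x hx _
    exact ⟨x 0, (hx 0 (by simp)).1, by simpa using (hx 0 (by simp)).2⟩
  | succ k ih =>
    intro δ j x hx hsep
    -- The mean value theorem on disjoint consecutive pairs halves the number of points and costs a
    -- factor 2/ρ. The unused gap between two pairs keeps the new points ρ-separated.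
    have key : ∀ i, ∃ y, i < 2 ^ k → y ∈ Ioo (x (2 * i)) (x (2 * i + 1)) ∧ y ∈ Icc a b ∧
        |h (j + 1) y| ≤ 2 / ρ * δ := by
      intro i
      by_cases hi : i < 2 ^ k
      swap
      · exact ⟨0, fun h => absurd h hi⟩
      have h1 : 2 * i + 1 < 2 ^ (k + 1) := by rw [pow_succ]; omega
      have hs := hsep (2 * i) h1
      obtain ⟨m0, d0⟩ := hx (2 * i) (by omega)
      obtain ⟨m1, d1⟩ := hx (2 * i + 1) h1
      have hsub : Icc (x (2 * i)) (x (2 * i + 1)) ⊆ Icc a b := Icc_subset_Icc m0.1 m1.2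
      obtain ⟨y, hy, hy'⟩ := exists_hasDerivAt_eq_slope (h j) (h (j + 1))
        (show x (2 * i) < x (2 * i + 1) by linarith)
        (fun v hv => ((hh j v (hsub hv)).continuousWithinAt).mono hsub)
        (fun v hv => (hh j v (hsub (Ioo_subset_Icc_self hv))).hasDerivAt
          (Icc_mem_nhds (by linarith [hv.1, m0.1]) (by linarith [hv.2, m1.2])))
      refine ⟨y, fun _ => ⟨hy, hsub (Ioo_subset_Icc_self hy), ?_⟩⟩
      rw [hy', abs_div, abs_of_pos (show 0 < x (2 * i + 1) - x (2 * i) by linarith)]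
      rw [div_le_iff₀ (by linarith)]
      have hδ : 0 ≤ δ := (abs_nonneg _).trans d0
      calc |h j (x (2 * i + 1)) - h j (x (2 * i))| ≤ δ + δ := (abs_sub _ _).trans (add_le_add d1 d0)
        _ = 2 / ρ * δ * ρ := by field_simp; ring
        _ ≤ _ := by gcongr; linarith
    choose y hy using key
    obtain ⟨z, hz, hz'⟩ := ih (2 / ρ * δ) (j + 1) y
      (fun i hi => ⟨(hy i hi).2.1, (hy i hi).2.2⟩) (by
        intro i hi
        have h1 := (hy i (by omega)).1.2
        have h2 := (hy (i + 1) hi).1.1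
        have h3 := hsep (2 * i + 1) (by rw [pow_succ]; omega)
        have : 2 * (i + 1) = 2 * i + 1 + 1 := by ring
        rw [this] at h2
        linarith)
    refine ⟨z, hz, ?_⟩
    have e : j + (k + 1) = j + 1 + k := by ring
    rw [e, pow_succ, mul_assoc]
    exact hz'

/-- Greedy choice: take the least point of the set and discard the interval of length ρ to its
right. Each step costs at most ρ of measure, and compactness guarantees that the least point belongs
to the set. -/
lemma exists_separated_of_lt_volume {ρ : ℝ} (hρ : 0 < ρ) (n : ℕ) :
    ∀ E : Set ℝ, IsCompact E → ENNReal.ofReal (n * ρ) < volume E →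
      ∃ x : ℕ → ℝ, (∀ i ≤ n, x i ∈ E) ∧ ∀ i < n, x i + ρ ≤ x (i + 1) := by
  induction n with
  | zero =>
    intro E _ hE
    obtain ⟨x, hx⟩ : E.Nonempty := by
      by_contra h
      rw [not_nonempty_iff_eq_empty] at h
      simp [h] at hE
    exact ⟨fun _ => x, fun _ _ => hx, fun i hi => absurd hi (by omega)⟩
  | succ n ih =>
    intro E hc hE
    have hne : E.Nonempty := by
      by_contra h
      rw [not_nonempty_iff_eq_empty] at h
      simp [h] at hE
    have hmin := hc.sInf_mem hne
    set x₀ := sInf E with hx₀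
    have hle : ∀ v ∈ E, x₀ ≤ v := fun v hv => csInf_le hc.bddBelow hv
    have hcov : E ⊆ Icc x₀ (x₀ + ρ) ∪ (E ∩ Ici (x₀ + ρ)) := by
      intro v hv
      rcases le_total v (x₀ + ρ) with h | h
      · exact Or.inl ⟨hle v hv, h⟩
      · exact Or.inr ⟨hv, h⟩
    have hvol : ENNReal.ofReal (n * ρ) < volume (E ∩ Ici (x₀ + ρ)) := by
      by_contra hcon
      push Not at hcon
      have := (measure_mono hcov).trans (measure_union_le (μ := volume) _ _)
      rw [Real.volume_Icc, add_sub_cancel_left] at this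
      have h2 := this.trans (add_le_add_right hcon _)
      rw [← ENNReal.ofReal_add hρ.le (by positivity)] at h2
      have h3 := hE.trans_le h2
      rw [Nat.cast_succ, show ((n : ℝ) + 1) * ρ = ρ + n * ρ by ring] at h3
      exact lt_irrefl _ h3
    obtain ⟨x, hx, hx'⟩ := ih _ (hc.inter_right isClosed_Ici) hvol
    refine ⟨fun i => if i = 0 then x₀ else x (i - 1), ?_, ?_⟩
    · intro i hi
      rcases Nat.eq_zero_or_pos i with h | h
      · simpa [h] using hmin
      · simp only [h.ne', if_false]
        exact (hx (i - 1) (by omega)).1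
    · intro i hi
      rcases Nat.eq_zero_or_pos i with h | h
      · simpa [h] using (hx 0 (by omega)).2
      · have := hx' (i - 1) (by omega)
        simp only [h.ne', if_false, Nat.succ_ne_zero, Nat.add_sub_cancel]
        rwa [Nat.sub_add_cancel h] at this

/-- Sublevel sets of a function whose `k`-th derivative is bounded below. -/
lemma volume_sublevel_le {h : ℕ → ℝ → ℝ} {a b c δ : ℝ} (hc : 0 < c) (hδ : 0 < δ)
    (hh : ∀ k, ∀ v ∈ Icc a b, HasDerivWithinAt (h k) (h (k + 1) v) (Icc a b) v) {k : ℕ}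
    (hk : 1 ≤ k) (hck : ∀ v ∈ Icc a b, c ≤ |h k v|) :
    volume {v | v ∈ Icc a b ∧ |h 0 v| ≤ δ} ≤
      ENNReal.ofReal (2 ^ k * (4 * (δ / c) ^ (1 / (k : ℝ)))) := by
  by_contra hcon
  push Not at hcon
  have hk0 : (k : ℝ) ≠ 0 := by positivity
  set r := (δ / c) ^ (1 / (k : ℝ)) with hr
  have hr0 : 0 < r := by positivity
  have hrk : r ^ k = δ / c := by
    rw [hr, ← Real.rpow_natCast, ← Real.rpow_mul (by positivity), one_div_mul_cancel hk0,
      Real.rpow_one]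
  have hE : IsCompact {v | v ∈ Icc a b ∧ |h 0 v| ≤ δ} := by
    have hcont : ContinuousOn (fun v => |h 0 v|) (Icc a b) :=
      ContinuousOn.abs fun v hv => (hh 0 v hv).continuousWithinAt
    exact isCompact_Icc.of_isClosed_subset
      (hcont.preimage_isClosed_of_isClosed isClosed_Icc isClosed_Iic) (fun v hv => hv.1)
  -- The spacing 4r makes (2/(4r))^k δ = 2^(-k) c, strictly below the assumed lower bound c of the
  -- k-th derivative.
  obtain ⟨x, hx, hx'⟩ := exists_separated_of_lt_volume (ρ := 4 * r) (by positivity) (2 ^ k) _ hE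
    (by simpa using hcon)
  obtain ⟨y, hy, hy'⟩ := exists_abs_deriv_le_of_separated (ρ := 4 * r) (by positivity) hh k δ 0 x
    (fun i hi => hx i hi.le) (fun i hi => hx' i (by omega))
  have h1 := (hck y hy).trans (by simpa using hy')
  have h2 : (2 / (4 * r)) ^ k * δ = (1 / 2) ^ k * c := by
    rw [show 2 / (4 * r) = (1 / 2) * r⁻¹ by field_simp; norm_num, mul_pow, inv_pow, hrk]
    field_simp
  rw [h2] at h1
  have h3 : ((1 : ℝ) / 2) ^ k < 1 := pow_lt_one₀ (by norm_num) (by norm_num) (by omega)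
  nlinarith

end ScalarLaw

namespace ScalarLaw

/-! ### The sharp nonlinearity exponent -/

variable {d : ℕ} {F : ℝ → EuclideanSpace ℝ (Fin d)} {M : ℝ}

/-- The derivative of order `k` of the flux on `[-M,M]`. -/
noncomputable def fluxDeriv (F : ℝ → EuclideanSpace ℝ (Fin d)) (M : ℝ) (k : ℕ) :
    ℝ → EuclideanSpace ℝ (Fin d) :=
  iteratedDerivWithin k F (Icc (-M) M)

lemma fluxDeriv_one : fluxDeriv F M 1 = velocity F M := by
  funext v
  simp [fluxDeriv, velocity, iteratedDerivWithin_one]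

lemma hasDerivWithinAt_fluxDeriv (hM : 0 < M) (hF : ContDiffOn ℝ ∞ F (Icc (-M) M)) (k : ℕ)
    {v : ℝ} (hv : v ∈ Icc (-M) M) :
    HasDerivWithinAt (fluxDeriv F M k) (fluxDeriv F M (k + 1) v) (Icc (-M) M) v := by
  have h := hF.differentiableOn_iteratedDerivWithin (m := k) (by exact_mod_cast WithTop.coe_lt_top _)
    (uniqueDiffOn_Icc (by linarith)) v hv
  have h2 := h.hasDerivWithinAt
  rwa [← iteratedDerivWithin_succ] at h2

lemma hasDerivWithinAt_flux (hM : 0 < M) (hF : ContDiffOn ℝ ∞ F (Icc (-M) M))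
    {v : ℝ} (hv : v ∈ Icc (-M) M) :
    HasDerivWithinAt F (velocity F M v) (Icc (-M) M) v := by
  have := hasDerivWithinAt_fluxDeriv hM hF 0 hv
  rw [zero_add, fluxDeriv_one] at this
  simpa [fluxDeriv] using this

lemma continuousOn_fluxDeriv (hM : 0 < M) (hF : ContDiffOn ℝ ∞ F (Icc (-M) M)) (k : ℕ) :
    ContinuousOn (fluxDeriv F M k) (Icc (-M) M) :=
  fun _ hv => (hasDerivWithinAt_fluxDeriv hM hF k hv).continuousWithinAt

lemma exists_bound_fluxDeriv (hM : 0 < M) (hF : ContDiffOn ℝ ∞ F (Icc (-M) M)) (n : ℕ) :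
    ∃ B : ℝ, 1 ≤ B ∧ ∀ k ≤ n, ∀ v ∈ Icc (-M) M, ‖fluxDeriv F M k v‖ ≤ B := by
  induction n with
  | zero =>
    obtain ⟨B, hB⟩ := isCompact_Icc.exists_bound_of_continuousOn (continuousOn_fluxDeriv hM hF 0)
    refine ⟨max B 1, le_max_right _ _, fun k hk v hv => ?_⟩
    obtain rfl : k = 0 := by omega
    exact (hB v hv).trans (le_max_left _ _)
  | succ n ih =>
    obtain ⟨B', h1, hB'⟩ := ih
    obtain ⟨B, hB⟩ := isCompact_Icc.exists_bound_of_continuousOn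
      (continuousOn_fluxDeriv hM hF (n + 1))
    refine ⟨max B B', h1.trans (le_max_right _ _), fun k hk v hv => ?_⟩
    rcases Nat.lt_or_ge k (n + 1) with h | h
    · exact (hB' k (by omega) v hv).trans (le_max_right _ _)
    · obtain rfl : k = n + 1 := by omega
      exact (hB v hv).trans (le_max_left _ _)

lemma hasDerivWithinAt_inner_fluxDeriv (hM : 0 < M) (hF : ContDiffOn ℝ ∞ F (Icc (-M) M)) (k : ℕ)
    (ξ : EuclideanSpace ℝ (Fin d)) {v : ℝ} (hv : v ∈ Icc (-M) M) :
    HasDerivWithinAt (fun v => inner ℝ (fluxDeriv F M k v) ξ)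
      (inner ℝ (fluxDeriv F M (k + 1) v) ξ) (Icc (-M) M) v := by
  have := (hasDerivWithinAt_fluxDeriv hM hF k hv).inner ℝ
    (hasDerivWithinAt_const v (Icc (-M) M) ξ)
  simpa using this

/-- `u` is a point where the derivatives of the velocity of order `1, …, q-1` are orthogonal to a
unit vector `ξ`. -/
def IsDegenerate (F : ℝ → EuclideanSpace ℝ (Fin d)) (M : ℝ) (q : ℕ) (u : ℝ)
    (ξ : EuclideanSpace ℝ (Fin d)) : Prop :=
  u ∈ Icc (-M) M ∧ ‖ξ‖ = 1 ∧ ∀ k, 1 ≤ k → k < q → inner ℝ (fluxDeriv F M (k + 1) u) ξ = (0 : ℝ)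

/-- Taylor estimates at a degenerate point. -/
lemma IsDegenerate.exists_bound (hM : 0 < M) (hF : ContDiffOn ℝ ∞ F (Icc (-M) M)) {q : ℕ} {u : ℝ}
    {ξ : EuclideanSpace ℝ (Fin d)} (hq : 1 ≤ q) (h : IsDegenerate F M q u ξ) :
    ∃ C : ℝ, 1 ≤ C ∧ ∀ v ∈ Icc (-M) M,
      |inner ℝ (velocity F M v - velocity F M u) ξ| ≤ C * |v - u| ^ q ∧
      |inner ℝ (fluxDeriv F M 2 v) ξ| ≤ C * |v - u| ^ (q - 1) := by
  obtain ⟨hu, hξ, hz⟩ := h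
  obtain ⟨B, hB1, hB⟩ := exists_bound_fluxDeriv hM hF (q + 1)
  -- One integration from u: a bound on the derivative of order k+1 becomes a bound on the increment
  -- at order k, with one more power of |v-u|.
  have step : ∀ (k j : ℕ), (∀ v ∈ Icc (-M) M,
        |inner ℝ (fluxDeriv F M (k + 1) v) ξ| ≤ B * |v - u| ^ j) → ∀ v ∈ Icc (-M) M,
      |inner ℝ (fluxDeriv F M k v) ξ - inner ℝ (fluxDeriv F M k u) ξ| ≤ B * |v - u| ^ (j + 1) := by
    intro k j hj v hv
    have hsub : uIcc u v ⊆ Icc (-M) M := uIcc_subset_Icc hu hv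
    have := (convex_uIcc u v).norm_image_sub_le_of_norm_hasDerivWithin_le
      (C := B * |v - u| ^ j)
      (fun w hw => (hasDerivWithinAt_inner_fluxDeriv hM hF k ξ (hsub hw)).mono hsub)
      (fun w hw => by
        rw [Real.norm_eq_abs]
        refine (hj w (hsub hw)).trans ?_
        have : |w - u| ≤ |v - u| := abs_sub_left_of_mem_uIcc hw
        gcongr)
      left_mem_uIcc right_mem_uIcc
    rw [Real.norm_eq_abs, Real.norm_eq_abs] at this
    rw [pow_succ, ← mul_assoc]
    exact this
  -- Descent from order q+1 of the flux, where only boundedness is known, to order 2. Degeneracy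
  -- makes the values at u vanish for orders 2 to q; order 1 need not vanish, hence the difference
  -- of velocities in the conclusion.
  have main : ∀ j, j < q → ∀ v ∈ Icc (-M) M,
      |inner ℝ (fluxDeriv F M (q + 1 - j) v) ξ| ≤ B * |v - u| ^ j := by
    intro j
    induction j with
    | zero =>
      intro _ v hv
      have := abs_real_inner_le_norm (fluxDeriv F M (q + 1 - 0) v) ξ
      rw [hξ, mul_one] at this
      simpa using this.trans (hB _ (by omega) v hv)
    | succ j ih =>
      intro hj v hv
      have e : q + 1 - j = q + 1 - (j + 1) + 1 := by omega
      have := step (q + 1 - (j + 1)) j (by rw [← e]; exact ih (by omega)) v hv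
      have h0 := hz (q + 1 - (j + 1) - 1) (by omega) (by omega)
      rw [show q + 1 - (j + 1) - 1 + 1 = q + 1 - (j + 1) by omega] at h0
      rwa [h0, sub_zero] at this
  refine ⟨B, hB1, fun v hv => ⟨?_, ?_⟩⟩
  · rw [inner_sub_left, ← fluxDeriv_one]
    have := step 1 (q - 1) (by
      have := main (q - 1) (by omega)
      rwa [show q + 1 - (q - 1) = 1 + 1 by omega] at this) v hv
    rwa [Nat.sub_add_cancel hq] at this
  · have := main (q - 1) (by omega) v hv
    rwa [show q + 1 - (q - 1) = 2 by omega] at this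

/-- By the Taylor bound the singular set at height C h^q contains an interval of length h, so an
exponent α forces h ≤ D(C h^q)^α. Letting h tend to 0 excludes αq > 1. -/
lemma IsDegenerate.exponent_mul_le_one (hM : 0 < M) (hF : ContDiffOn ℝ ∞ F (Icc (-M) M)) {q : ℕ}
    {u : ℝ} {ξ : EuclideanSpace ℝ (Fin d)} (hq : 1 ≤ q) (h : IsDegenerate F M q u ξ) {α : ℝ}
    (hα : α ∈ nonlinearityExponents F M) : α * q ≤ 1 := by
  obtain ⟨C, hC1, hC⟩ := h.exists_bound hM hF hq
  obtain ⟨hu, hξ, -⟩ := h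
  obtain ⟨hα0, D, hD⟩ := hα
  set τ₀ : ℝ := -inner ℝ (velocity F M u) ξ with hτ₀
  set N : ℝ := Real.sqrt (τ₀ ^ 2 + 1) with hN
  have hN1 : 1 ≤ N := by
    rw [hN]; exact Real.one_le_sqrt.mpr (by nlinarith [sq_nonneg τ₀])
  have hNsq : N ^ 2 = τ₀ ^ 2 + 1 := Real.sq_sqrt (by positivity)
  have hsphere : (τ₀ / N) ^ 2 + ‖N⁻¹ • ξ‖ ^ 2 = 1 := by
    rw [norm_smul, hξ, mul_one, norm_inv, Real.norm_of_nonneg (by linarith)]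
    field_simp
    linarith
  have hmeas : ∀ h : ℝ, 0 < h → h ≤ M → h ≤ D * (C * h ^ q) ^ α := by
    intro h h0 hh
    have hδ : 0 < C * h ^ q := by positivity
    have hsub : ∀ v ∈ Icc (-M) M, |v - u| ≤ h →
        v ∈ singularSet F M (C * h ^ q) (τ₀ / N) (N⁻¹ • ξ) := by
      intro v hv hvu
      refine ⟨hv, ?_⟩
      rw [inner_smul_right]
      have e : τ₀ / N + N⁻¹ * inner ℝ (velocity F M v) ξ
          = N⁻¹ * inner ℝ (velocity F M v - velocity F M u) ξ := by
        rw [inner_sub_left, hτ₀]; ring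
      rw [e, abs_mul, abs_of_pos (by positivity)]
      calc N⁻¹ * |inner ℝ (velocity F M v - velocity F M u) ξ| ≤ 1 * (C * |v - u| ^ q) := by
            gcongr
            · exact inv_le_one_of_one_le₀ hN1
            · exact (hC v hv).1
        _ ≤ C * h ^ q := by rw [one_mul]; gcongr
    have hvol : ENNReal.ofReal h ≤ volume (singularSet F M (C * h ^ q) (τ₀ / N) (N⁻¹ • ξ)) := by
      -- A one-sided interval pointing towards 0 is used, since u may be an endpoint of [-M,M]; it
      -- fits because h ≤ M.
      rcases le_total u 0 with hu0 | hu0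
      · have : Icc u (u + h) ⊆ singularSet F M (C * h ^ q) (τ₀ / N) (N⁻¹ • ξ) := fun v hv =>
          hsub v ⟨by linarith [hv.1, hu.1], by linarith [hv.2]⟩
            (abs_le.mpr ⟨by linarith [hv.1], by linarith [hv.2]⟩)
        simpa using measure_mono (μ := volume) this
      · have : Icc (u - h) u ⊆ singularSet F M (C * h ^ q) (τ₀ / N) (N⁻¹ • ξ) := fun v hv =>
          hsub v ⟨by linarith [hv.1], by linarith [hv.2, hu.2]⟩
            (abs_le.mpr ⟨by linarith [hv.1], by linarith [hv.2]⟩)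
        simpa using measure_mono (μ := volume) this
    have h2 := hvol.trans (hD _ hδ _ _ hsphere)
    by_contra hcon
    push Not at hcon
    exact absurd h2 (not_le.mpr ((ENNReal.ofReal_lt_ofReal_iff h0).mpr hcon))
  by_contra hcon
  push Not at hcon
  have hlim : Tendsto (fun h : ℝ => D * C ^ α * h ^ (α * q - 1)) (𝓝[>] 0) (𝓝 0) := by
    have h1 : Tendsto (fun h : ℝ => h ^ (α * q - 1)) (𝓝[>] 0) (𝓝 0) := by
      have := (Real.continuousAt_rpow_const 0 (α * q - 1) (Or.inr (by linarith))).tendsto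
      rw [Real.zero_rpow (by linarith)] at this
      exact this.mono_left nhdsWithin_le_nhds
    simpa using h1.const_mul (D * C ^ α)
  have hev : ∀ᶠ h : ℝ in 𝓝[>] 0, 1 ≤ D * C ^ α * h ^ (α * q - 1) := by
    filter_upwards [Ioo_mem_nhdsGT hM] with h hh
    have := hmeas h hh.1 hh.2.le
    rw [Real.mul_rpow (by linarith) (by have := hh.1; positivity), ← Real.rpow_natCast,
      ← Real.rpow_mul hh.1.le] at this
    rw [Real.rpow_sub hh.1, Real.rpow_one, mul_comm α]
    rw [← mul_div_assoc, le_div_iff₀ hh.1]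
    linarith
  have := le_of_tendsto_of_tendsto tendsto_const_nhds hlim hev
  linarith

/-- If no unit vector is orthogonal to the first `q` derivatives of the velocity at some point, then
`1/q` is an exponent of nonlinearity. -/
lemma one_div_mem_nonlinearityExponents (hM : 0 < M) (hF : ContDiffOn ℝ ∞ F (Icc (-M) M)) {q : ℕ}
    (hq : 1 ≤ q) (h : ∀ u ξ, ¬ IsDegenerate F M (q + 1) u ξ) :
    1 / (q : ℝ) ∈ nonlinearityExponents F M := by
  classical
  obtain ⟨B, hB1, hB⟩ := exists_bound_fluxDeriv hM hF (q + 2)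
  have hB0 : 0 < B := by linarith
  have hq0 : (0 : ℝ) < q := by exact_mod_cast hq
  have hinner : ∀ k ≤ q + 2, ∀ v ∈ Icc (-M) M, ∀ ξ : EuclideanSpace ℝ (Fin d),
      |inner ℝ (fluxDeriv F M k v) ξ| ≤ B * ‖ξ‖ := fun k hk v hv ξ =>
    (abs_real_inner_le_norm _ _).trans (by gcongr; exact hB k hk v hv)
  -- uniform lower bound for one of the derivatives
  obtain ⟨c₀, hc₀, hc₀'⟩ : ∃ c₀ : ℝ, 0 < c₀ ∧ ∀ p ∈ Icc (-M) M ×ˢ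
      Metric.sphere (0 : EuclideanSpace ℝ (Fin d)) 1,
      c₀ ≤ ∑ k ∈ Finset.Icc 1 q, |inner ℝ (fluxDeriv F M (k + 1) p.1) p.2| := by
    refine (isCompact_Icc.prod (isCompact_sphere _ _)).exists_forall_le' ?_ ?_
    · refine continuousOn_finsetSum _ fun k _ => ContinuousOn.abs ?_
      exact ContinuousOn.inner ((continuousOn_fluxDeriv hM hF (k + 1)).comp continuousOn_fst
        fun p hp => hp.1) continuousOn_snd
    · rintro ⟨u, ξ⟩ ⟨hu, hξ⟩
      have := h u ξ
      simp only [IsDegenerate, not_and, not_forall] at this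
      obtain ⟨k, hk1, hk2, hk3⟩ := this hu (by simpa using hξ)
      exact Finset.sum_pos' (fun _ _ => abs_nonneg _)
        ⟨k, Finset.mem_Icc.mpr ⟨hk1, by omega⟩, abs_pos.mpr hk3⟩
  -- Below this size of ξ the velocity term is at most 1/4 while |τ| ≥ 3/4, so the singular set is
  -- empty for δ < 1/4.
  set r₀ : ℝ := 1 / (4 * B) with hr₀
  have hr₀0 : 0 < r₀ := by positivity
  set c₁ : ℝ := c₀ / q * r₀ with hc₁
  have hc₁0 : 0 < c₁ := by positivity
  have hlow : ∀ u ∈ Icc (-M) M, ∀ ξ : EuclideanSpace ℝ (Fin d), r₀ ≤ ‖ξ‖ →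
      ∃ k, 1 ≤ k ∧ k ≤ q ∧ c₁ ≤ |inner ℝ (fluxDeriv F M (k + 1) u) ξ| := by
    intro u hu ξ hξ
    by_contra hcon
    push Not at hcon
    have hξ0 : 0 < ‖ξ‖ := hr₀0.trans_le hξ
    have h1 := hc₀' (u, ‖ξ‖⁻¹ • ξ) ⟨hu, by
      rw [mem_sphere_zero_iff_norm, norm_smul, norm_inv, norm_norm, inv_mul_cancel₀ hξ0.ne']⟩
    have h2 : ∑ k ∈ Finset.Icc 1 q, |inner ℝ (fluxDeriv F M (k + 1) u) (‖ξ‖⁻¹ • ξ)|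
        < ∑ k ∈ Finset.Icc 1 q, c₀ / q := by
      refine Finset.sum_lt_sum_of_nonempty ⟨1, Finset.mem_Icc.mpr ⟨le_rfl, hq⟩⟩ fun k hk => ?_
      rw [Finset.mem_Icc] at hk
      rw [inner_smul_right, abs_mul, abs_of_pos (inv_pos.mpr hξ0), inv_mul_lt_iff₀ hξ0]
      refine (hcon k hk.1 hk.2).trans_le ?_
      rw [hc₁, mul_comm]
      gcongr
    simp only [Finset.sum_const, Nat.card_Icc, Nat.add_sub_cancel, nsmul_eq_mul] at h2
    rw [mul_div_cancel₀ _ hq0.ne'] at h2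
    exact absurd h1 (not_le.mpr h2)
  -- On an interval of this length the derivatives involved vary by at most Bℓ = c₁/2, so the order
  -- found at its left end serves the whole interval with lower bound c₁/2.
  set ℓ : ℝ := c₁ / (2 * B) with hℓ
  have hℓ0 : 0 < ℓ := by positivity
  set N : ℕ := ⌈2 * M / ℓ⌉₊ with hN
  set δ₀ : ℝ := min (1 / 4) (c₁ / 2) with hδ₀
  have hδ₀0 : 0 < δ₀ := by positivity
  -- The first summand collects the N pieces for δ < δ₀; the second covers δ ≥ δ₀ by the trivial
  -- measure bound 2M.
  refine ⟨by positivity, N * (2 ^ q * (4 * (1 / (c₁ / 2)) ^ (1 / (q : ℝ))))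
    + 2 * M * (1 / δ₀) ^ (1 / (q : ℝ)), fun δ hδ τ ξ hτξ => ?_⟩
  have hξ1 : ‖ξ‖ ≤ 1 := by nlinarith [sq_nonneg τ, norm_nonneg ξ]
  rw [add_mul, mul_assoc (2 * M), ← Real.mul_rpow (by positivity) hδ.le]
  have hterm1 : 0 ≤ N * (2 ^ q * (4 * (1 / (c₁ / 2)) ^ (1 / (q : ℝ)))) * δ ^ (1 / (q : ℝ)) := by
    positivity
  have hterm2 : 0 ≤ 2 * M * (1 / δ₀ * δ) ^ (1 / (q : ℝ)) := by positivity
  rcases le_or_gt δ₀ δ with hbig | hsmall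
  · calc volume (singularSet F M δ τ ξ) ≤ volume (Icc (-M) M) := measure_mono fun v hv => hv.1
      _ = ENNReal.ofReal (2 * M) := by rw [Real.volume_Icc]; ring_nf
      _ ≤ _ := ENNReal.ofReal_le_ofReal ?_
    have : 1 ≤ (1 / δ₀ * δ) ^ (1 / (q : ℝ)) := by
      refine Real.one_le_rpow ?_ (by positivity)
      rw [one_div_mul_eq_div, le_div_iff₀ hδ₀0]; linarith
    nlinarith
  have hδ4 : δ < 1 / 4 := hsmall.trans_le (min_le_left _ _)
  have hδc : δ < c₁ / 2 := hsmall.trans_le (min_le_right _ _)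
  refine le_trans ?_ (ENNReal.ofReal_le_ofReal (le_add_of_nonneg_right hterm2))
  rcases lt_or_ge ‖ξ‖ r₀ with hξ | hξ
  · have hempty : singularSet F M δ τ ξ = ∅ := by
      rw [eq_empty_iff_forall_notMem]
      rintro v ⟨hv, hv'⟩
      rw [← fluxDeriv_one] at hv'
      have h1 := hinner 1 (by omega) v hv ξ
      have h2 : B * ‖ξ‖ ≤ 1 / 4 := by
        calc B * ‖ξ‖ ≤ B * r₀ := by gcongr
          _ = 1 / 4 := by rw [hr₀]; field_simp
      have h3 : ‖ξ‖ ≤ 1 / 4 := by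
        have : ‖ξ‖ ≤ B * ‖ξ‖ := by nlinarith [norm_nonneg ξ]
        linarith
      have h4 : (3 / 4 : ℝ) ≤ |τ| := by
        refine abs_le_of_sq_le_sq' ?_ (abs_nonneg _) |>.2
        rw [sq_abs]
        nlinarith [norm_nonneg ξ]
      have h5 := abs_sub_abs_le_abs_sub τ (-inner ℝ (fluxDeriv F M 1 v) ξ)
      rw [abs_neg, sub_neg_eq_add] at h5
      linarith
    rw [hempty, measure_empty]
    exact zero_le
  set h' : ℕ → ℝ → ℝ := fun k v => (if k = 0 then τ else 0) + inner ℝ (fluxDeriv F M (k + 1) v) ξ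
    with hh'
  have hder : ∀ k, ∀ v ∈ Icc (-M) M, HasDerivWithinAt (h' k) (h' (k + 1) v) (Icc (-M) M) v := by
    intro k v hv
    have := (hasDerivWithinAt_inner_fluxDeriv hM hF (k + 1) ξ hv).const_add
      (if k = 0 then τ else 0)
    simpa [hh'] using this
  have hpos : ∀ k, 1 ≤ k → ∀ v, h' k v = inner ℝ (fluxDeriv F M (k + 1) v) ξ := by
    intro k hk v
    simp [hh', show k ≠ 0 by omega]
  set J : ℕ → Set ℝ := fun i => Icc (-M + i * ℓ) (min M (-M + (i + 1) * ℓ)) with hJ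
  have hcover : singularSet F M δ τ ξ ⊆
      ⋃ i ∈ Finset.range N, {v | v ∈ J i ∧ |h' 0 v| ≤ δ} := by
    rintro v ⟨hv, hv'⟩
    have hx0 : 0 ≤ (v + M) / ℓ := div_nonneg (by linarith [hv.1]) hℓ0.le
    rw [← fluxDeriv_one] at hv'
    simp only [mem_iUnion, Finset.mem_range]
    -- The right endpoint is assigned to the last piece by hand: the floor would give the index N
    -- when 2M/ℓ is an integer.
    rcases hv.2.eq_or_lt with hvM | hvM
    · have hNpos : 0 < N := Nat.ceil_pos.mpr (by positivity)
      refine ⟨N - 1, by omega, ⟨?_, ?_⟩, by simpa [hh'] using hv'⟩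
      · have h1 : ((N - 1 : ℕ) : ℝ) < 2 * M / ℓ := by
          rw [← Nat.lt_ceil]; omega
        rw [lt_div_iff₀ hℓ0] at h1
        linarith
      · refine le_min hv.2 ?_
        have h1 : 2 * M / ℓ ≤ N := Nat.le_ceil _
        rw [div_le_iff₀ hℓ0] at h1
        rw [Nat.cast_sub hNpos, Nat.cast_one, sub_add_cancel]
        linarith
    · refine ⟨⌊(v + M) / ℓ⌋₊, ?_, ⟨?_, ?_⟩, by simpa [hh'] using hv'⟩
      · rw [Nat.floor_lt hx0]
        refine lt_of_lt_of_le ?_ (Nat.le_ceil _)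
        gcongr
        linarith
      · have := Nat.floor_le hx0
        rw [le_div_iff₀ hℓ0] at this
        linarith
      · refine le_min hv.2 ?_
        have := (Nat.lt_floor_add_one ((v + M) / ℓ)).le
        rw [div_le_iff₀ hℓ0] at this
        linarith
  have hpiece : ∀ i : ℕ, volume {v | v ∈ J i ∧ |h' 0 v| ≤ δ} ≤
      ENNReal.ofReal (2 ^ q * (4 * (1 / (c₁ / 2) * δ) ^ (1 / (q : ℝ)))) := by
    intro i
    rcases (J i).eq_empty_or_nonempty with he | hne
    · simp [he]
    have hle : -M + i * ℓ ≤ min M (-M + (i + 1) * ℓ) := nonempty_Icc.mp hne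
    have hi0 : 0 ≤ i * ℓ := by positivity
    have hsub : J i ⊆ Icc (-M) M := Icc_subset_Icc (by linarith) (min_le_left _ _)
    obtain ⟨k, hk1, hkq, hk⟩ := hlow (-M + i * ℓ) (hsub (left_mem_Icc.mpr hle)) ξ hξ
    have hck : ∀ v ∈ J i, c₁ / 2 ≤ |h' k v| := by
      intro v hv
      have hlip := (convex_Icc (-M + i * ℓ) (min M (-M + (i + 1) * ℓ))).norm_image_sub_le_of_norm_hasDerivWithin_le
        (C := B)
        (fun w hw => (hder k w (hsub hw)).mono hsub)
        (fun w hw => by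
          rw [Real.norm_eq_abs, hpos _ (by omega)]
          refine (hinner (k + 2) (by omega) w (hsub hw) ξ).trans ?_
          nlinarith)
        (left_mem_Icc.mpr hle) hv
      rw [Real.norm_eq_abs, Real.norm_eq_abs] at hlip
      have hd1 : |v - (-M + i * ℓ)| ≤ ℓ := by
        rw [abs_of_nonneg (by linarith [hv.1])]
        have := hv.2.trans (min_le_right _ _)
        linarith
      have hd2 : B * |v - (-M + i * ℓ)| ≤ c₁ / 2 := by
        calc B * |v - (-M + i * ℓ)| ≤ B * ℓ := by gcongr
          _ = c₁ / 2 := by rw [hℓ]; field_simp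
      rw [← hpos k hk1] at hk
      have := abs_sub_abs_le_abs_sub (h' k (-M + i * ℓ)) (h' k v)
      rw [abs_sub_comm] at this
      linarith
    refine (volume_sublevel_le (c := c₁ / 2) (by positivity) hδ
      (fun k v hv => (hder k v (hsub hv)).mono hsub) hk1 hck).trans ?_
    refine ENNReal.ofReal_le_ofReal ?_
    have hb : 1 / (c₁ / 2) * δ = δ / (c₁ / 2) := by ring
    rw [hb]
    gcongr 2 ^ ?_ * (4 * ?_)
    · norm_num
    -- The order k varies from piece to piece. Since k ≤ q and the base is at most 1, the power 1/k
    -- is dominated by the power 1/q.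
    refine Real.rpow_le_rpow_of_exponent_ge (by positivity) ?_ ?_
    · rw [div_le_one (by positivity)]; exact hδc.le
    · have : (0 : ℝ) < k := by exact_mod_cast hk1
      gcongr
  calc volume (singularSet F M δ τ ξ)
      ≤ volume (⋃ i ∈ Finset.range N, {v | v ∈ J i ∧ |h' 0 v| ≤ δ}) := measure_mono hcover
    _ ≤ ∑ i ∈ Finset.range N, volume {v | v ∈ J i ∧ |h' 0 v| ≤ δ} := measure_biUnion_finset_le _ _
    _ ≤ ∑ i ∈ Finset.range N,
        ENNReal.ofReal (2 ^ q * (4 * (1 / (c₁ / 2) * δ) ^ (1 / (q : ℝ)))) :=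
        Finset.sum_le_sum fun i _ => hpiece i
    _ = _ := by
        rw [Finset.sum_const, Finset.card_range, nsmul_eq_mul, ← ENNReal.ofReal_natCast,
          ← ENNReal.ofReal_mul (by positivity), Real.mul_rpow (by positivity) hδ.le]
        congr 1
        ring

/-- q is the largest order of degeneracy. The set of orders contains 1, for which the condition is
void, and any one nonlinearity exponent α bounds it by 1/α. Maximality excludes order q+1 and hence
makes 1/q an exponent. -/
theorem exists_isDegenerate_alphaSup (hd : 1 ≤ d) (hM : 0 < M)
    (hF : ContDiffOn ℝ ∞ F (Icc (-M) M)) (hnl : IsNonlinearFlux F M) :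
    ∃ q : ℕ, 1 ≤ q ∧ alphaSup F M = 1 / q ∧ ∃ u ξ, IsDegenerate F M q u ξ := by
  obtain ⟨α, hα⟩ := hnl
  set S : Set ℕ := {q | 1 ≤ q ∧ ∃ u ξ, IsDegenerate F M q u ξ} with hS
  have hbdd : BddAbove S := by
    refine ⟨⌈1 / α⌉₊, fun q hq => ?_⟩
    obtain ⟨h1, u, ξ, h⟩ := hq
    have := h.exponent_mul_le_one hM hF h1 hα
    have h3 : (q : ℝ) ≤ 1 / α := by
      rw [le_div_iff₀ hα.1]; linarith
    exact_mod_cast h3.trans (Nat.le_ceil _)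
  have hne : S.Nonempty := by
    refine ⟨1, le_rfl, 0, EuclideanSpace.single ⟨0, hd⟩ 1, ⟨by constructor <;> linarith, by simp, ?_⟩⟩
    intro k h1 h2
    omega
  obtain ⟨hq1, u, ξ, hdeg⟩ := Nat.sSup_mem hne hbdd
  set q := sSup S with hq
  refine ⟨q, hq1, ?_, u, ξ, hdeg⟩
  have hmem : 1 / (q : ℝ) ∈ nonlinearityExponents F M := by
    refine one_div_mem_nonlinearityExponents hM hF hq1 fun u ξ hcon => ?_
    have : q + 1 ≤ q := le_csSup hbdd ⟨by omega, u, ξ, hcon⟩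
    omega
  have hle : ∀ β ∈ nonlinearityExponents F M, β ≤ 1 / (q : ℝ) := by
    intro β hβ
    have h0 : (0 : ℝ) < q := by exact_mod_cast hq1
    rw [le_div_iff₀ h0]
    exact hdeg.exponent_mul_le_one hM hF hq1 hβ
  exact le_antisymm (csSup_le ⟨_, hmem⟩ hle) (le_csSup ⟨_, hle⟩ hmem)

end ScalarLaw

namespace ScalarLaw

/-! ### Bounds for the intrinsic seminorm -/

section Gagliardo

set_option linter.unusedSectionVars false

variable {E : Type} [NormedAddCommGroup E] [NormedSpace ℝ E] [MeasureSpace E] [BorelSpace E]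
  [FiniteDimensional ℝ E] [(volume : Measure E).IsAddHaarMeasure]
  {G : Type} [NormedAddCommGroup G]

lemma enorm_rpow_eq_ofReal {x : E} (hx : x ≠ 0) (p : ℝ) :
    ‖x‖ₑ ^ p = ENNReal.ofReal (‖x‖ ^ p) := by
  rw [← ofReal_norm, ENNReal.ofReal_rpow_of_pos (norm_pos_iff.mpr hx)]

/-- In polar coordinates the radial density is r^(-σ) on (0,1] and r^(-1-σ) beyond, integrable
exactly because 0 < σ < 1. -/
lemma integrable_min_one_norm_div [Nontrivial E] {σ : ℝ} (h0 : 0 < σ) (h1 : σ < 1) :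
    Integrable (fun z : E => min 1 ‖z‖ / ‖z‖ ^ ((Module.finrank ℝ E : ℝ) + σ)) := by
  have hn : 0 < Module.finrank ℝ E := Module.finrank_pos
  rw [integrable_fun_norm_addHaar volume
    (f := fun r : ℝ => min 1 r / r ^ ((Module.finrank ℝ E : ℝ) + σ))]
  have hpow : ∀ r : ℝ, 0 < r → r ^ (Module.finrank ℝ E - 1) / r ^ ((Module.finrank ℝ E : ℝ) + σ)
      = r ^ (-1 - σ) := by
    intro r hr
    rw [← Real.rpow_natCast, ← Real.rpow_sub hr, Nat.cast_sub hn]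
    congr 1
    push_cast
    ring
  rw [← Ioc_union_Ioi_eq_Ioi (zero_le_one (α := ℝ)), integrableOn_union]
  constructor
  · have : IntegrableOn (fun r : ℝ => r ^ (-σ)) (Ioc 0 1) := by
      rw [← intervalIntegrable_iff_integrableOn_Ioc_of_le zero_le_one]
      exact intervalIntegral.intervalIntegrable_rpow' (by linarith)
    refine this.congr_fun (fun r hr => ?_) measurableSet_Ioc
    simp only [smul_eq_mul]
    rw [min_eq_right hr.2, ← mul_div_assoc, mul_comm, mul_div_assoc, hpow r hr.1,
      ← Real.rpow_one_add' hr.1.le (by linarith)]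
    congr 1
    ring
  · have : IntegrableOn (fun r : ℝ => r ^ (-1 - σ)) (Ioi 1) :=
      integrableOn_Ioi_rpow_of_lt (by linarith) one_pos
    refine this.congr_fun (fun r hr => ?_) measurableSet_Ioi
    have hr' : (1 : ℝ) < r := hr
    simp only [smul_eq_mul]
    rw [min_eq_left hr'.le, ← mul_div_assoc, mul_one, hpow r (by linarith)]

/-- The constant of `gagliardo_le`. -/
noncomputable def gagliardoConst (E : Type) [NormedAddCommGroup E] [NormedSpace ℝ E]
    [MeasureSpace E] (σ : ℝ) : ℝ≥0∞ :=
  ∫⁻ z : E, ENNReal.ofReal (min 1 ‖z‖ / ‖z‖ ^ ((Module.finrank ℝ E : ℝ) + σ))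

lemma gagliardoConst_lt_top [Nontrivial E] {σ : ℝ} (h0 : 0 < σ) (h1 : σ < 1) :
    gagliardoConst E σ < ⊤ :=
  (integrable_min_one_norm_div h0 h1).lintegral_lt_top

/-- Interpolation: increments are at most a·min(1, r|x-y|) with r = b/a, the length scale at which
the two bounds cross being 1/r. Dilating by r turns the kernel into the fixed one of
`gagliardoConst` and produces the factor r^σ. -/
lemma gagliardo_le {σ a b : ℝ} (ha : 0 < a) (hb : 0 < b) {Ω : Set E}
    (hΩ : MeasurableSet Ω) {f : E → G} (hfa : ∀ x ∈ Ω, ∀ y ∈ Ω, ‖f x - f y‖ ≤ a)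
    (hfb : ∀ x ∈ Ω, ∀ y ∈ Ω, ‖f x - f y‖ ≤ b * ‖x - y‖) :
    gagliardo Ω σ f ≤ ENNReal.ofReal (a * (b / a) ^ σ) * gagliardoConst E σ * volume Ω := by
  set n := Module.finrank ℝ E with hn
  set r := b / a with hr
  have hr0 : 0 < r := by positivity
  set h : E → ℝ≥0∞ := fun z => ENNReal.ofReal (min 1 ‖z‖ / ‖z‖ ^ ((n : ℝ) + σ)) with hh
  have hmeas : Measurable h := by
    apply Measurable.ennreal_ofReal
    fun_prop
  have hpt : ∀ x ∈ Ω, ∀ y ∈ Ω, ‖f x - f y‖ₑ / ‖x - y‖ₑ ^ ((n : ℝ) + σ) ≤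
      ENNReal.ofReal (a * r ^ ((n : ℝ) + σ)) * h (r • (x - y)) := by
    intro x hx y hy
    rcases eq_or_ne x y with rfl | hxy
    · simp
    have hz : x - y ≠ 0 := sub_ne_zero.mpr hxy
    have hz' : 0 < ‖x - y‖ := norm_pos_iff.mpr hz
    rw [enorm_rpow_eq_ofReal hz, ← ofReal_norm,
      ← ENNReal.ofReal_div_of_pos (by positivity), hh, ← ENNReal.ofReal_mul (by positivity)]
    refine ENNReal.ofReal_le_ofReal ?_
    rw [norm_smul, Real.norm_of_nonneg hr0.le, Real.mul_rpow hr0.le hz'.le]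
    have e : a * r ^ ((n : ℝ) + σ) * (min 1 (r * ‖x - y‖) /
        (r ^ ((n : ℝ) + σ) * ‖x - y‖ ^ ((n : ℝ) + σ))) =
        a * min 1 (r * ‖x - y‖) / ‖x - y‖ ^ ((n : ℝ) + σ) := by
      field_simp
    rw [e]
    gcongr
    rw [mul_min_of_nonneg _ _ ha.le, mul_one]
    refine le_min (hfa x hx y hy) ((hfb x hx y hy).trans_eq ?_)
    rw [hr]; field_simp
  have hscale : ∀ x : E, ∫⁻ y, h (r • (x - y)) = ENNReal.ofReal ((r ^ n)⁻¹) * gagliardoConst E σ := by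
    intro x
    rw [lintegral_sub_left_eq_self (fun z => h (r • z)) x]
    have : ∫⁻ z, h (r • z) = ∫⁻ w, h w ∂(Measure.map (r • ·) (volume : Measure E)) := by
      rw [lintegral_map hmeas (by fun_prop)]
    rw [this, Measure.map_addHaar_smul _ hr0.ne', lintegral_smul_measure,
      abs_of_pos (by positivity), smul_eq_mul]
    rfl
  calc gagliardo Ω σ f
      ≤ ∫⁻ x in Ω, ENNReal.ofReal (a * r ^ σ) * gagliardoConst E σ := by
        refine setLIntegral_mono' hΩ fun x hx => ?_
        calc ∫⁻ y in Ω, ‖f x - f y‖ₑ / ‖x - y‖ₑ ^ ((n : ℝ) + σ)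
            ≤ ∫⁻ y in Ω, ENNReal.ofReal (a * r ^ ((n : ℝ) + σ)) * h (r • (x - y)) :=
              setLIntegral_mono' hΩ fun y hy => hpt x hx y hy
          _ ≤ ∫⁻ y, ENNReal.ofReal (a * r ^ ((n : ℝ) + σ)) * h (r • (x - y)) :=
              setLIntegral_le_lintegral _ _
          _ = ENNReal.ofReal (a * r ^ σ) * gagliardoConst E σ := by
              rw [lintegral_const_mul _ (show Measurable fun y => h (r • (x - y)) from
                hmeas.comp (by fun_prop)), hscale, ← mul_assoc,
                ← ENNReal.ofReal_mul (by positivity), Real.rpow_add hr0, Real.rpow_natCast]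
              congr 2
              field_simp
    _ = _ := by rw [setLIntegral_const]

/-- `f` oscillates by `η` at the scale `r ≤ R` around all points of `Ω'`. -/
def Oscillates (Ω Ω' : Set E) (r R η : ℝ) (f : E → G) : Prop :=
  ∀ x ∈ Ω', Metric.ball x R ⊆ Ω ∧ ∃ p, Metric.ball p r ⊆ Metric.ball x R ∧
    ∀ y ∈ Metric.ball p r, η ≤ ‖f x - f y‖

lemma Oscillates.subset {Ω Ω' : Set E} {r R η : ℝ} {f : E → G} (hR : 0 < R)
    (h : Oscillates Ω Ω' r R η f) : Ω' ⊆ Ω :=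
  fun x hx => (h x hx).1 (Metric.mem_ball_self hR)

lemma volume_ball_eq (p : E) {r : ℝ} (hr : 0 < r) :
    volume (Metric.ball p r) = ENNReal.ofReal (r ^ Module.finrank ℝ E) *
      volume (Metric.ball (0 : E) 1) :=
  Measure.addHaar_ball_of_pos _ p hr

/-- For each x the inner integral is restricted to the ball where f differs from f(x) by η; there
the distance to x is at most R. -/
lemma Oscillates.le_gagliardo {σ : ℝ} (h0 : 0 < σ) {Ω Ω' : Set E} (hΩ' : MeasurableSet Ω')
    {r R η : ℝ} (hr : 0 < r) (hR : 0 < R) (hη : 0 < η) {f : E → G}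
    (h : Oscillates Ω Ω' r R η f) :
    ENNReal.ofReal (η * (r ^ Module.finrank ℝ E / R ^ ((Module.finrank ℝ E : ℝ) + σ))) *
      (volume (Metric.ball (0 : E) 1) * volume Ω') ≤ gagliardo Ω σ f := by
  set n := Module.finrank ℝ E with hn
  have hinner : ∀ x ∈ Ω', ENNReal.ofReal (η * (r ^ n / R ^ ((n : ℝ) + σ))) *
      volume (Metric.ball (0 : E) 1) ≤ ∫⁻ y in Ω, ‖f x - f y‖ₑ / ‖x - y‖ₑ ^ ((n : ℝ) + σ) := by
    intro x hx
    obtain ⟨hΩ, p, hp, hy⟩ := h x hx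
    calc ENNReal.ofReal (η * (r ^ n / R ^ ((n : ℝ) + σ))) * volume (Metric.ball (0 : E) 1)
        = ∫⁻ _ in Metric.ball p r, ENNReal.ofReal (η / R ^ ((n : ℝ) + σ)) := by
          rw [setLIntegral_const, volume_ball_eq p hr, ← mul_assoc,
            ← ENNReal.ofReal_mul (by positivity)]
          congr 2
          ring
      _ ≤ ∫⁻ y in Metric.ball p r, ‖f x - f y‖ₑ / ‖x - y‖ₑ ^ ((n : ℝ) + σ) := by
          refine setLIntegral_mono' measurableSet_ball fun y hy' => ?_
          have hne : x - y ≠ 0 := by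
            intro h0
            have := hy y hy'
            rw [sub_eq_zero.mp h0, sub_self, norm_zero] at this
            linarith
          have hpos : 0 < ‖x - y‖ := norm_pos_iff.mpr hne
          rw [enorm_rpow_eq_ofReal hne, ← ofReal_norm,
            ← ENNReal.ofReal_div_of_pos (by positivity)]
          refine ENNReal.ofReal_le_ofReal ?_
          have hd : ‖x - y‖ ≤ R := by
            have := hp hy'
            rw [Metric.mem_ball, dist_comm, dist_eq_norm] at this
            exact this.le
          gcongr
          exact hy y hy'
      _ ≤ _ := lintegral_mono_set (hp.trans hΩ)
  calc _ = ∫⁻ _ in Ω', ENNReal.ofReal (η * (r ^ n / R ^ ((n : ℝ) + σ))) *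
      volume (Metric.ball (0 : E) 1) := by rw [setLIntegral_const, mul_assoc]
    _ ≤ ∫⁻ x in Ω', ∫⁻ y in Ω, ‖f x - f y‖ₑ / ‖x - y‖ₑ ^ ((n : ℝ) + σ) :=
        setLIntegral_mono' hΩ' hinner
    _ ≤ _ := lintegral_mono_set (h.subset hR)

/-- An oscillation at small scale forces a large gradient. -/
lemma Oscillates.le_lintegral_fderiv [NormedSpace ℝ G] [CompleteSpace G] {Ω Ω' : Set E}
    (hΩ : MeasurableSet Ω) (hΩ' : MeasurableSet Ω')
    {r R η : ℝ} (hr : 0 < r) (hR : 0 < R) {f : E → G} (hf : ContDiff ℝ 1 f)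
    (h : Oscillates Ω Ω' r R η f) :
    ENNReal.ofReal (η * r ^ Module.finrank ℝ E) * volume Ω' ≤
      ENNReal.ofReal (R * R ^ Module.finrank ℝ E) * ∫⁻ x in Ω, ‖fderiv ℝ f x‖ₑ := by
  set n := Module.finrank ℝ E with hn
  set V := volume (Metric.ball (0 : E) 1) with hV
  have hV0 : V ≠ 0 := (Metric.measure_ball_pos _ _ one_pos).ne'
  have hVt : V ≠ ⊤ := Metric.isBounded_ball.measure_lt_top.ne
  have hDf : Continuous (fderiv ℝ f) := hf.continuous_fderiv one_ne_zero
  set K : E → E × ℝ → ℝ≥0∞ := fun x w => ‖fderiv ℝ f (x + w.2 • w.1)‖ₑ * ‖w.1‖ₑ with hK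
  have hKm : Measurable (Function.uncurry K) := by
    have : Continuous (Function.uncurry K) := by
      have h1 : Continuous fun p : E × E × ℝ => ‖fderiv ℝ f (p.1 + p.2.2 • p.2.1)‖ₑ * ‖p.2.1‖ₑ := by
        have h2 : Continuous fun p : E × E × ℝ =>
            ENNReal.ofReal (‖fderiv ℝ f (p.1 + p.2.2 • p.2.1)‖ * ‖p.2.1‖) := by
          refine ENNReal.continuous_ofReal.comp ?_
          refine Continuous.mul (Continuous.norm (hDf.comp (by fun_prop))) (by fun_prop)
        refine h2.congr fun p => ?_
        rw [ENNReal.ofReal_mul (norm_nonneg _), ofReal_norm, ofReal_norm]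
      exact h1
    exact this.measurable
  set ν : Measure (E × ℝ) :=
    (volume.restrict (Metric.ball (0 : E) R)).prod (volume.restrict (Icc (0 : ℝ) 1)) with hν
  -- Increments are written as integrals of the gradient along segments. After integrating over |z|
  -- < R and x ∈ Ω' and exchanging the order, each translation by sz maps Ω' into Ω, so the inner
  -- integral is at most R times the L¹ norm of the gradient on Ω.
  have hFTC : ∀ x z : E, ‖f x - f (x + z)‖ₑ ≤ ∫⁻ s in Icc (0 : ℝ) 1, K x (z, s) := by
    intro x z
    have hd : ∀ s : ℝ, HasDerivAt (fun s : ℝ => f (x + s • z)) (fderiv ℝ f (x + s • z) z) s := by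
      intro s
      have h1 : HasDerivAt (fun s : ℝ => x + s • z) z s := by
        simpa using ((hasDerivAt_id s).smul_const z).const_add x
      exact ((hf.differentiable one_ne_zero _).hasFDerivAt).comp_hasDerivAt s h1
    have hc : Continuous fun s : ℝ => fderiv ℝ f (x + s • z) z :=
      (hDf.comp (by fun_prop)).clm_apply continuous_const
    have h1 := intervalIntegral.integral_eq_sub_of_hasDerivAt (a := 0) (b := 1)
      (fun s _ => hd s) (hc.intervalIntegrable _ _)
    simp only [one_smul, zero_smul, add_zero] at h1
    rw [← enorm_neg, neg_sub, ← h1, intervalIntegral.integral_of_le zero_le_one,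
      ← integral_Icc_eq_integral_Ioc]
    refine (enorm_integral_le_lintegral_enorm _).trans (lintegral_mono fun s => ?_)
    exact ContinuousLinearMap.le_opENorm _ _
  have hlow : ∀ x ∈ Ω', ENNReal.ofReal (η * r ^ n) * V ≤ ∫⁻ w, K x w ∂ν := by
    intro x hx
    obtain ⟨-, p, hp, hy⟩ := h x hx
    rw [hν, lintegral_prod _ (by exact (hKm.comp measurable_prodMk_left).aemeasurable)]
    calc ENNReal.ofReal (η * r ^ n) * V
        = ∫⁻ _ in Metric.ball p r, ENNReal.ofReal η := by
          rw [setLIntegral_const, volume_ball_eq p hr, ← mul_assoc,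
            mul_comm η, ENNReal.ofReal_mul (by positivity), mul_comm (ENNReal.ofReal η)]
      _ ≤ ∫⁻ y in Metric.ball p r, ‖f x - f y‖ₑ := by
          refine setLIntegral_mono' measurableSet_ball fun y hy' => ?_
          rw [← ofReal_norm]
          exact ENNReal.ofReal_le_ofReal (hy y hy')
      _ ≤ ∫⁻ y in Metric.ball x R, ‖f x - f y‖ₑ := lintegral_mono_set hp
      _ = ∫⁻ z in Metric.ball (0 : E) R, ‖f x - f (x + z)‖ₑ := by
          rw [← lintegral_indicator measurableSet_ball, ← lintegral_indicator measurableSet_ball,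
            ← lintegral_add_left_eq_self _ x]
          congr 1
          ext z
          simp [indicator]
      _ ≤ _ := lintegral_mono fun z => hFTC x z
  have hup : ∀ᵐ w ∂ν, ∫⁻ x in Ω', K x w ≤ ENNReal.ofReal R * ∫⁻ x in Ω, ‖fderiv ℝ f x‖ₑ := by
    have hmem : ∀ᵐ w ∂ν, w ∈ Metric.ball (0 : E) R ×ˢ Icc (0 : ℝ) 1 := by
      rw [hν, Measure.prod_restrict]
      exact ae_restrict_mem (measurableSet_ball.prod measurableSet_Icc)
    filter_upwards [hmem] with w hw
    obtain ⟨hw1, hw2⟩ := hw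
    have hwR : ‖w.1‖ < R := by simpa using hw1
    calc ∫⁻ x in Ω', K x w
        ≤ ∫⁻ x in Ω', Ω.indicator (fun x => ‖fderiv ℝ f x‖ₑ) (x + w.2 • w.1) *
            ENNReal.ofReal R := by
          refine setLIntegral_mono' hΩ' fun x hx => ?_
          have hmem : x + w.2 • w.1 ∈ Ω := by
            refine (h x hx).1 ?_
            rw [Metric.mem_ball, dist_self_add_left, norm_smul, Real.norm_of_nonneg hw2.1]
            nlinarith [hw2.2, norm_nonneg w.1]
          rw [indicator_of_mem hmem]
          refine mul_le_mul_right ?_ _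
          rw [← ofReal_norm]
          exact ENNReal.ofReal_le_ofReal hwR.le
      _ ≤ ∫⁻ x, Ω.indicator (fun x => ‖fderiv ℝ f x‖ₑ) (x + w.2 • w.1) * ENNReal.ofReal R :=
          setLIntegral_le_lintegral _ _
      _ = _ := by
          rw [lintegral_mul_const' _ _ ENNReal.ofReal_ne_top,
            lintegral_add_right_eq_self (fun x => Ω.indicator (fun x => ‖fderiv ℝ f x‖ₑ) x),
            lintegral_indicator hΩ, mul_comm]
  have hνu : ν univ = ENNReal.ofReal (R ^ n) * V := by
    rw [hν, ← univ_prod_univ, Measure.prod_prod, Measure.restrict_apply_univ,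
      Measure.restrict_apply_univ, volume_ball_eq (0 : E) hR]
    simp [hV, hn]
  have hmain : ENNReal.ofReal (η * r ^ n) * volume Ω' * V ≤
      ENNReal.ofReal (R * R ^ n) * (∫⁻ x in Ω, ‖fderiv ℝ f x‖ₑ) * V := by
    calc ENNReal.ofReal (η * r ^ n) * volume Ω' * V
        = ∫⁻ _ in Ω', ENNReal.ofReal (η * r ^ n) * V := by rw [setLIntegral_const]; ring
      _ ≤ ∫⁻ x in Ω', ∫⁻ w, K x w ∂ν := setLIntegral_mono' hΩ' hlow
      _ = ∫⁻ w, (∫⁻ x in Ω', K x w) ∂ν := lintegral_lintegral_swap hKm.aemeasurable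
      _ ≤ ∫⁻ _, ENNReal.ofReal R * (∫⁻ x in Ω, ‖fderiv ℝ f x‖ₑ) ∂ν := lintegral_mono_ae hup
      _ = _ := by
          rw [lintegral_const, hνu, ENNReal.ofReal_mul hR.le]
          ring
  exact (ENNReal.mul_le_mul_iff_left hV0 hVt).mp hmain

end Gagliardo

end ScalarLaw

namespace ScalarLaw

/-! ### Weak derivatives of smooth functions -/

section WeakDeriv

set_option linter.unusedSectionVars false

variable {E : Type} [NormedAddCommGroup E] [NormedSpace ℝ E] [MeasureSpace E] [BorelSpace E]
  [FiniteDimensional ℝ E] [(volume : Measure E).IsAddHaarMeasure]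
  {G : Type} [NormedAddCommGroup G] [NormedSpace ℝ G] [CompleteSpace G]

lemma hasWeakDeriv_fderiv {Ω : Set E} {f : E → G} (hf : ContDiff ℝ 1 f) :
    HasWeakDeriv Ω f (fderiv ℝ f) := by
  have : ProperSpace E := FiniteDimensional.proper ℝ E
  have hDf : Continuous (fderiv ℝ f) := hf.continuous_fderiv one_ne_zero
  refine ⟨hf.continuous.locallyIntegrable.locallyIntegrableOn _,
    hDf.locallyIntegrable.locallyIntegrableOn _, fun φ hφ hφc hφΩ v => ?_⟩
  have hφ0 : ∀ x, x ∉ Ω → φ x = 0 := fun x hx =>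
    image_eq_zero_of_notMem_tsupport fun h => hx (hφΩ h)
  have hφ1 : ∀ x, x ∉ Ω → fderiv ℝ φ x = 0 := fun x hx =>
    image_eq_zero_of_notMem_tsupport fun h => hx (hφΩ (tsupport_fderiv_subset ℝ h))
  rw [setIntegral_eq_integral_of_forall_compl_eq_zero fun x hx => by simp [hφ1 x hx],
    setIntegral_eq_integral_of_forall_compl_eq_zero fun x hx => by simp [hφ0 x hx]]
  have hDφ : Continuous (fderiv ℝ φ) := hφ.continuous_fderiv (by simp)
  have hDφc : HasCompactSupport (fun x => fderiv ℝ φ x v) :=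
    hφc.fderiv_apply ℝ v
  rw [integral_smul_fderiv_eq_neg_fderiv_smul_of_integrable, neg_neg]
  · exact ((hDφ.clm_apply continuous_const).smul hf.continuous).integrable_of_hasCompactSupport
      hDφc.smul_right
  · exact (hφ.continuous.smul (hDf.clm_apply continuous_const)).integrable_of_hasCompactSupport
      hφc.smul_right
  · exact (hφ.continuous.smul hf.continuous).integrable_of_hasCompactSupport hφc.smul_right
  · exact fun x _ => hφ.differentiable (by simp) x
  · exact fun x _ => hf.differentiable one_ne_zero x

/-- The fundamental lemma of the calculus of variations applies in each fixed direction; a finite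
basis then gives a single null set for all directions. -/
lemma HasWeakDeriv.ae_eq {Ω : Set E} (hΩ : IsOpen Ω) {f : E → G} {g₁ g₂ : E → E →L[ℝ] G}
    (h₁ : HasWeakDeriv Ω f g₁) (h₂ : HasWeakDeriv Ω f g₂) : g₁ =ᵐ[volume.restrict Ω] g₂ := by
  have : ProperSpace E := FiniteDimensional.proper ℝ E
  have hint : ∀ g : E → E →L[ℝ] G, LocallyIntegrableOn g Ω → ∀ φ : E → ℝ, Continuous φ →
      HasCompactSupport φ → tsupport φ ⊆ Ω → ∀ v : E, Integrable fun x => φ x • g x v := by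
    intro g hg φ hφ hφc hφΩ v
    have h1 : IntegrableOn g (tsupport φ) := hg.integrableOn_compact_subset hφΩ hφc
    have h2 : IntegrableOn (fun x => g x v) (tsupport φ) :=
      ContinuousLinearMap.integrable_comp (ContinuousLinearMap.apply ℝ G v) h1
    have h3 := IntegrableOn.continuousOn_smul h2 hφ.continuousOn hφc
    rwa [integrableOn_iff_integrable_of_support_subset] at h3
    intro x hx
    refine subset_tsupport φ ?_
    intro h0
    exact hx (by simp [h0])
  have key : ∀ v : E, ∀ᵐ x, x ∈ Ω → g₁ x v - g₂ x v = 0 := by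
    intro v
    refine hΩ.ae_eq_zero_of_integral_contDiff_smul_eq_zero ?_ fun φ hφ hφc hφΩ => ?_
    · have h3 : LocallyIntegrableOn (fun x => g₁ x - g₂ x) Ω := h₁.2.1.sub h₂.2.1
      intro x hx
      obtain ⟨u, hu, hu'⟩ := h3 x hx
      exact ⟨u, hu, ContinuousLinearMap.integrable_comp (ContinuousLinearMap.apply ℝ G v) hu'⟩
    · simp only [smul_sub]
      rw [integral_sub (hint _ h₁.2.1 φ hφ.continuous hφc hφΩ v)
        (hint _ h₂.2.1 φ hφ.continuous hφc hφΩ v), sub_eq_zero]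
      have hφ0 : ∀ x, x ∉ Ω → φ x = 0 := fun x hx =>
        image_eq_zero_of_notMem_tsupport fun h => hx (hφΩ h)
      have e : ∀ g : E → E →L[ℝ] G, ∫ x, φ x • g x v = ∫ x in Ω, φ x • g x v := fun g =>
        (setIntegral_eq_integral_of_forall_compl_eq_zero fun x hx => by simp [hφ0 x hx]).symm
      rw [e g₁, e g₂]
      exact neg_injective ((h₁.2.2 φ hφ hφc hφΩ v).symm.trans (h₂.2.2 φ hφ hφc hφΩ v))
  rw [Filter.EventuallyEq, ae_restrict_iff' hΩ.measurableSet]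
  set b := Module.finBasis ℝ E
  have := ae_all_iff.mpr fun i => key (b i)
  filter_upwards [this] with x hx hxΩ
  ext v
  have : (g₁ x : E →ₗ[ℝ] G) = g₂ x := b.ext fun i => sub_eq_zero.mp (hx i hxΩ)
  exact congrArg (fun l : E →ₗ[ℝ] G => l v) this

lemma HasWeakDeriv.congr {Ω : Set E} {f₁ f₂ : E → G} {g : E → E →L[ℝ] G}
    (h : HasWeakDeriv Ω f₁ g) (hf : LocallyIntegrableOn f₂ Ω)
    (h12 : f₁ =ᵐ[volume.restrict Ω] f₂) : HasWeakDeriv Ω f₂ g := by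
  refine ⟨hf, h.2.1, fun φ hφ hφc hφΩ v => ?_⟩
  rw [← h.2.2 φ hφ hφc hφΩ v]
  refine integral_congr_ae ?_
  filter_upwards [h12] with x hx
  rw [hx]

lemma HasWeakDeriv.ae_eq_fderiv {Ω : Set E} (hΩ : IsOpen Ω) {f : E → G} (hf : ContDiff ℝ 1 f)
    {g : E → E →L[ℝ] G} (h : HasWeakDeriv Ω f g) : g =ᵐ[volume.restrict Ω] fderiv ℝ f :=
  h.ae_eq hΩ (hasWeakDeriv_fderiv hf)

lemma gagliardo_congr {Ω : Set E} {σ : ℝ} {f g : E → G} (h : f =ᵐ[volume.restrict Ω] g) :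
    gagliardo Ω σ f = gagliardo Ω σ g := by
  refine lintegral_congr_ae ?_
  filter_upwards [h] with x hx
  refine lintegral_congr_ae ?_
  filter_upwards [h] with y hy
  rw [hx, hy]

lemma lintegral_le_sobolevNormAux (Ω : Set E) (σ : ℝ) (m : ℕ) (H : Type) [NormedAddCommGroup H]
    [NormedSpace ℝ H] (u : E → H) : ∫⁻ x in Ω, ‖u x‖ₑ ≤ sobolevNormAux Ω σ m H u := by
  cases m with
  | zero => exact le_self_add
  | succ m => exact le_self_add

lemma sobolevNorm_of_lt_one {s : ℝ} (h0 : 0 ≤ s) (h1 : s < 1) (Ω : Set E) (f : E → ℝ) :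
    sobolevNorm s Ω f = (∫⁻ x in Ω, ‖f x‖ₑ) + (if 0 < s then gagliardo Ω s f else 0) := by
  have h2 : ⌊s⌋₊ = 0 := Nat.floor_eq_zero.mpr h1
  have h3 : Int.fract s = s := Int.fract_eq_self.mpr ⟨h0, h1⟩
  rw [sobolevNorm, h2, h3]
  rfl

lemma sobolevNorm_one_le (Ω : Set E) {f : E → ℝ} (hf : ContDiff ℝ 1 f) :
    sobolevNorm 1 Ω f ≤ (∫⁻ x in Ω, ‖f x‖ₑ) + ∫⁻ x in Ω, ‖fderiv ℝ f x‖ₑ := by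
  rw [sobolevNorm, Nat.floor_one, Int.fract_one]
  refine add_le_add_right ((iInf₂_le _ (hasWeakDeriv_fderiv hf)).trans ?_) _
  simp [sobolevNormAux]

lemma gagliardo_le_sobolevNorm {s : ℝ} (h0 : 0 < s) (h1 : s < 1) (Ω : Set E) (f : E → ℝ) :
    gagliardo Ω s f ≤ sobolevNorm s Ω f := by
  rw [sobolevNorm_of_lt_one h0.le h1, if_pos h0]
  exact le_add_self

/-- The norm is an infimum over all weak derivatives, so a lower bound has to hold for each of them;
uniqueness identifies each with the classical derivative almost everywhere. -/
lemma lintegral_fderiv_le_sobolevNorm {s : ℝ} (h1 : 1 ≤ s) {Ω : Set E} (hΩ : IsOpen Ω) {f : E → ℝ}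
    (hf : ContDiff ℝ 1 f) : ∫⁻ x in Ω, ‖fderiv ℝ f x‖ₑ ≤ sobolevNorm s Ω f := by
  obtain ⟨m, hm⟩ : ∃ m, ⌊s⌋₊ = m + 1 := Nat.exists_eq_succ_of_ne_zero
    (by have := Nat.le_floor (n := 1) (by exact_mod_cast h1) (a := s); omega)
  rw [sobolevNorm, hm]
  refine le_trans (le_iInf₂ fun g hg => ?_) le_add_self
  rw [lintegral_congr_ae (g := fun x => ‖g x‖ₑ)]
  · exact lintegral_le_sobolevNormAux _ _ _ _ _
  · filter_upwards [hg.ae_eq_fderiv hΩ hf] with x hx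
    rw [hx]

lemma gagliardo_fderiv_le_sobolevNorm {s : ℝ} (h1 : 1 < s) (h2 : s < 2) {Ω : Set E}
    (hΩ : IsOpen Ω) {f : E → ℝ} (hf : ContDiff ℝ 1 f) :
    gagliardo Ω (s - 1) (fderiv ℝ f) ≤ sobolevNorm s Ω f := by
  have hm : ⌊s⌋₊ = 0 + 1 := (Nat.floor_eq_iff (by linarith)).mpr ⟨by norm_num; linarith, by norm_num; linarith⟩
  have hz : ⌊s⌋ = 1 := Int.floor_eq_iff.mpr ⟨by norm_num; linarith, by norm_num; linarith⟩
  have hfr : Int.fract s = s - 1 := by rw [Int.fract, hz]; norm_num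
  rw [sobolevNorm, hm, hfr]
  refine le_trans (le_iInf₂ fun g hg => ?_) le_add_self
  rw [← gagliardo_congr (hg.ae_eq_fderiv hΩ hf), sobolevNormAux, if_pos (by linarith)]
  exact le_add_self

lemma lintegral_fderiv_fderiv_le_sobolevNorm {s : ℝ} (h2 : 2 ≤ s) {Ω : Set E} (hΩ : IsOpen Ω)
    {f : E → ℝ} (hf : ContDiff ℝ 2 f) :
    ∫⁻ x in Ω, ‖fderiv ℝ (fderiv ℝ f) x‖ₑ ≤ sobolevNorm s Ω f := by
  have : ProperSpace E := FiniteDimensional.proper ℝ E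
  obtain ⟨m, hm⟩ : ∃ m, ⌊s⌋₊ = m + 1 + 1 := by
    have := Nat.le_floor (n := 2) (by exact_mod_cast h2) (a := s)
    exact ⟨⌊s⌋₊ - 2, by omega⟩
  have hDf : ContDiff ℝ 1 (fderiv ℝ f) := hf.fderiv_right (by norm_num)
  rw [sobolevNorm, hm]
  refine le_trans (le_iInf₂ fun g hg => ?_) le_add_self
  refine le_trans (le_iInf₂ fun g' hg' => ?_) le_add_self
  -- The second weak derivative is one of g, which equals the classical gradient only almost
  -- everywhere; it is transferred before uniqueness is used again.
  have hg'' := hg'.congr (hDf.continuous.locallyIntegrable.locallyIntegrableOn _)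
    (hg.ae_eq_fderiv hΩ (hf.of_le one_le_two))
  rw [lintegral_congr_ae (g := fun x => ‖g' x‖ₑ)]
  · exact lintegral_le_sobolevNormAux _ _ _ _ _
  · filter_upwards [hg''.ae_eq_fderiv hΩ hDf] with x hx
    rw [hx]

end WeakDeriv

end ScalarLaw

namespace ScalarLaw

/-! ### Sobolev norms of oscillating waves -/

lemma exists_angle_mem_Icc (a θ₀ : ℝ) :
    ∃ θ ∈ Icc a (a + 2 * Real.pi), Real.sin θ = Real.sin θ₀ ∧ Real.cos θ = Real.cos θ₀ := by
  refine ⟨toIcoMod Real.two_pi_pos a θ₀, Ico_subset_Icc_self (toIcoMod_mem_Ico _ _ _), ?_, ?_⟩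
  · rw [toIcoMod]; exact Real.sin_periodic.sub_zsmul_eq _
  · rw [toIcoMod]; exact Real.cos_periodic.sub_zsmul_eq _

lemma abs_sin_sub_sin_le (a b : ℝ) : |Real.sin a - Real.sin b| ≤ |a - b| := by
  simpa [Real.norm_eq_abs] using (convex_univ (𝕜 := ℝ) (E := ℝ)).norm_image_sub_le_of_norm_hasDerivWithin_le
    (C := 1) (fun x _ => (Real.hasDerivAt_sin x).hasDerivWithinAt)
    (fun x _ => by rw [Real.norm_eq_abs]; exact Real.abs_cos_le_one x) (mem_univ b) (mem_univ a)

lemma abs_cos_sub_cos_le (a b : ℝ) : |Real.cos a - Real.cos b| ≤ |a - b| := by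
  simpa [Real.norm_eq_abs] using (convex_univ (𝕜 := ℝ) (E := ℝ)).norm_image_sub_le_of_norm_hasDerivWithin_le
    (C := 1) (fun x _ => (Real.hasDerivAt_cos x).hasDerivWithinAt)
    (fun x _ => by rw [Real.norm_eq_abs, abs_neg]; exact Real.abs_sin_le_one x)
    (mem_univ b) (mem_univ a)

/-- The wave profile `c + μ (1 + sin θ) / 2`. -/
noncomputable def waveProfile (c μ θ : ℝ) : ℝ := c + μ * ((1 + Real.sin θ) / 2)

lemma contDiff_waveProfile (c μ : ℝ) {n : WithTop ℕ∞} : ContDiff ℝ n (waveProfile c μ) := by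
  unfold waveProfile
  fun_prop

lemma hasDerivAt_waveProfile (c μ θ : ℝ) :
    HasDerivAt (waveProfile c μ) (μ / 2 * Real.cos θ) θ := by
  have := (((Real.hasDerivAt_sin θ).const_add 1).div_const 2).const_mul μ |>.const_add c
  convert! this using 1
  ring

/-! ### Phase functions and oscillation of waves and of their gradients -/

section Phase

set_option linter.unusedSectionVars false

variable {E : Type} [NormedAddCommGroup E] [NormedSpace ℝ E]

/-- A phase function of wave length `ρ` on `Ω`, advancing in the direction `e`. -/
structure IsPhase (Ω Ω' : Set E) (ρ L K : ℝ) (e : E) (Z : E → ℝ) : Prop where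
  contDiff : ContDiff ℝ ∞ Z
  lipschitz : ∀ x ∈ Ω, ∀ y ∈ Ω, |Z x - Z y| ≤ L / ρ * ‖x - y‖
  ball_subset : ∀ x ∈ Ω', Metric.ball x (K * ρ) ⊆ Ω
  reach : ∀ x ∈ Ω', ∀ θ ∈ Icc (Z x) (Z x + 2 * Real.pi), ∃ p, ‖p - x‖ ≤ (K - 1) * ρ ∧ Z p = θ
  norm_dir : ‖e‖ = 1
  le_deriv : ∀ x ∈ Ω, 1 / (2 * ρ) ≤ fderiv ℝ Z x e
  deriv_le : ∀ x ∈ Ω, fderiv ℝ Z x e ≤ 2 / ρ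

variable {Ω Ω' : Set E} {ρ L K : ℝ} {e : E} {Z : E → ℝ}

/-- Every angle is attained modulo 2π within (K-1)ρ of x. The spare ρ leaves room for a ball of
radius ρ/(32L), on which the Lipschitz bound lets the phase move by at most 1/32. -/
lemma IsPhase.exists_ball (h : IsPhase Ω Ω' ρ L K e Z) (hρ : 0 < ρ) (hL : 1 ≤ L) {x : E}
    (hx : x ∈ Ω') (θ₀ : ℝ) : ∃ p θ, Metric.ball p (ρ / (32 * L)) ⊆ Metric.ball x (K * ρ) ∧
      Real.sin θ = Real.sin θ₀ ∧ Real.cos θ = Real.cos θ₀ ∧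
      ∀ y ∈ Metric.ball p (ρ / (32 * L)), |Z y - θ| ≤ 1 / 32 := by
  obtain ⟨θ, hθ, hs, hc⟩ := exists_angle_mem_Icc (Z x) θ₀
  obtain ⟨p, hp, hZ⟩ := h.reach x hx θ hθ
  have hr : ρ / (32 * L) ≤ ρ := div_le_self hρ.le (by linarith)
  have hr0 : 0 < ρ / (32 * L) := by positivity
  have hsub : Metric.ball p (ρ / (32 * L)) ⊆ Metric.ball x (K * ρ) := by
    refine Metric.ball_subset_ball' ?_
    rw [dist_eq_norm]
    linarith
  refine ⟨p, θ, hsub, hs, hc, fun y hy => ?_⟩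
  have hsub' := hsub.trans (h.ball_subset x hx)
  have h1 := h.lipschitz y (hsub' hy) p (hsub' (Metric.mem_ball_self hr0))
  rw [hZ] at h1
  refine h1.trans ?_
  rw [Metric.mem_ball, dist_eq_norm] at hy
  calc L / ρ * ‖y - p‖ ≤ L / ρ * (ρ / (32 * L)) := by gcongr
    _ = 1 / 32 := by field_simp

/-- The point is compared with a nearby crest or trough of the sine, whichever lies on the other
side of zero; the sines then differ by at least 1/2. -/
lemma IsPhase.oscillates (h : IsPhase Ω Ω' ρ L K e Z) (hρ : 0 < ρ) (hL : 1 ≤ L) (c μ : ℝ) :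
    Oscillates Ω Ω' (ρ / (32 * L)) (K * ρ) (|μ| / 4) (fun x => waveProfile c μ (Z x)) := by
  intro x hx
  refine ⟨h.ball_subset x hx, ?_⟩
  have hdiff : ∀ y, ‖waveProfile c μ (Z x) - waveProfile c μ (Z y)‖
      = |μ| / 2 * |Real.sin (Z x) - Real.sin (Z y)| := by
    intro y
    rw [Real.norm_eq_abs, waveProfile, waveProfile, ← abs_two (α := ℝ), ← abs_div, abs_two, ← abs_mul]
    congr 1
    ring
  have hμ := abs_nonneg μ
  rcases le_total (Real.sin (Z x)) 0 with hs | hs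
  · obtain ⟨p, θ, hsub, hsin, -, hy⟩ := h.exists_ball hρ hL hx (Real.pi / 2)
    refine ⟨p, hsub, fun y hyp => ?_⟩
    rw [hdiff]
    have h1 := (abs_sin_sub_sin_le (Z y) θ).trans (hy y hyp)
    rw [hsin, Real.sin_pi_div_two] at h1
    have h2 := (abs_le.mp h1).1
    have h3 : 1 / 2 ≤ |Real.sin (Z x) - Real.sin (Z y)| := by
      rw [abs_sub_comm]
      exact le_trans (by linarith) (le_abs_self _)
    nlinarith
  · obtain ⟨p, θ, hsub, hsin, -, hy⟩ := h.exists_ball hρ hL hx (-(Real.pi / 2))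
    refine ⟨p, hsub, fun y hyp => ?_⟩
    rw [hdiff]
    have h1 := (abs_sin_sub_sin_le (Z y) θ).trans (hy y hyp)
    rw [hsin, Real.sin_neg, Real.sin_pi_div_two] at h1
    have h2 := (abs_le.mp h1).2
    have h3 : 1 / 2 ≤ |Real.sin (Z x) - Real.sin (Z y)| :=
      le_trans (by linarith) (le_abs_self _)
    nlinarith

/-- The derivative along e is (μ/2) cos Z times a factor between 1/(2ρ) and 2/ρ, so it is small
where cos Z is near 0 and large where cos Z is near 1. One of these two places contrasts with the
given point. -/
lemma IsPhase.oscillates_fderiv (h : IsPhase Ω Ω' ρ L K e Z) (hρ : 0 < ρ) (hL : 1 ≤ L)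
    (c μ : ℝ) :
    Oscillates Ω Ω' (ρ / (32 * L)) (K * ρ) (|μ| / (16 * ρ))
      (fderiv ℝ fun x => waveProfile c μ (Z x)) := by
  set f : E → ℝ := fun x => waveProfile c μ (Z x) with hf
  have hderiv : ∀ y, fderiv ℝ f y e = μ / 2 * Real.cos (Z y) * fderiv ℝ Z y e := by
    intro y
    have h1 := (hasDerivAt_waveProfile c μ (Z y)).comp_hasFDerivAt y
      (h.contDiff.differentiable (by simp) y).hasFDerivAt
    have h2 : fderiv ℝ f y = _ := h1.fderiv
    rw [h2]
    simp
  have hnorm : ∀ x y, |fderiv ℝ f x e - fderiv ℝ f y e| ≤ ‖fderiv ℝ f x - fderiv ℝ f y‖ := by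
    intro x y
    have := (fderiv ℝ f x - fderiv ℝ f y).le_opNorm e
    rwa [h.norm_dir, mul_one, sub_apply, Real.norm_eq_abs] at this
  have habs : ∀ y ∈ Ω, |fderiv ℝ f y e| = |μ| / 2 * |Real.cos (Z y)| * fderiv ℝ Z y e := by
    intro y hy
    have : 0 ≤ fderiv ℝ Z y e := le_trans (by positivity) (h.le_deriv y hy)
    rw [hderiv, abs_mul, abs_mul, abs_div, abs_two, abs_of_nonneg this]
  have hμ := abs_nonneg μ
  intro x hx
  have hxb := h.ball_subset x hx
  refine ⟨hxb, ?_⟩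
  -- The threshold lies between the two reference sizes: at most |μ|/(32ρ) where cos Z is near 0, at
  -- least 31|μ|/(128ρ) where it is near 1. Both gaps exceed |μ|/(16ρ).
  rcases le_total (|μ| / (8 * ρ)) |fderiv ℝ f x e| with hbig | hsmall
  · obtain ⟨p, θ, hsub, -, hcos, hy⟩ := h.exists_ball hρ hL hx (Real.pi / 2)
    refine ⟨p, hsub, fun y hyp => le_trans ?_ (hnorm x y)⟩
    have h1 := (abs_cos_sub_cos_le (Z y) θ).trans (hy y hyp)
    rw [hcos, Real.cos_pi_div_two, sub_zero] at h1
    have hyΩ := hxb (hsub hyp)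
    have h2 : |fderiv ℝ f y e| ≤ |μ| / (32 * ρ) := by
      rw [habs y hyΩ]
      calc |μ| / 2 * |Real.cos (Z y)| * fderiv ℝ Z y e ≤ |μ| / 2 * (1 / 32) * (2 / ρ) := by
            gcongr
            · exact le_trans (by positivity) (h.le_deriv y hyΩ)
            · exact h.deriv_le y hyΩ
        _ = |μ| / (32 * ρ) := by field_simp
    have h3 := abs_sub_abs_le_abs_sub (fderiv ℝ f x e) (fderiv ℝ f y e)
    have h4 : |μ| / (16 * ρ) ≤ |μ| / (8 * ρ) - |μ| / (32 * ρ) := by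
      have : 0 ≤ |μ| / ρ := by positivity
      have e1 : |μ| / (16 * ρ) = |μ| / ρ / 16 := by field_simp
      have e2 : |μ| / (8 * ρ) = |μ| / ρ / 8 := by field_simp
      have e3 : |μ| / (32 * ρ) = |μ| / ρ / 32 := by field_simp
      rw [e1, e2, e3]
      linarith
    linarith
  · obtain ⟨p, θ, hsub, -, hcos, hy⟩ := h.exists_ball hρ hL hx 0
    refine ⟨p, hsub, fun y hyp => le_trans ?_ (hnorm x y)⟩
    have h1 := (abs_cos_sub_cos_le (Z y) θ).trans (hy y hyp)
    rw [hcos, Real.cos_zero] at h1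
    have h1' : 31 / 32 ≤ |Real.cos (Z y)| :=
      le_trans (by linarith [(abs_le.mp h1).1]) (le_abs_self _)
    have hyΩ := hxb (hsub hyp)
    have h2 : |μ| * 31 / (128 * ρ) ≤ |fderiv ℝ f y e| := by
      rw [habs y hyΩ]
      calc |μ| * 31 / (128 * ρ) = |μ| / 2 * (31 / 32) * (1 / (2 * ρ)) := by field_simp; ring
        _ ≤ |μ| / 2 * |Real.cos (Z y)| * fderiv ℝ Z y e := by
            gcongr
            exact h.le_deriv y hyΩ
    have h3 := abs_sub_abs_le_abs_sub (fderiv ℝ f y e) (fderiv ℝ f x e)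
    rw [abs_sub_comm] at h3
    have h4 : |μ| / (16 * ρ) ≤ |μ| * 31 / (128 * ρ) - |μ| / (8 * ρ) := by
      have : 0 ≤ |μ| / ρ := by positivity
      have e1 : |μ| / (16 * ρ) = |μ| / ρ / 16 := by field_simp
      have e2 : |μ| / (8 * ρ) = |μ| / ρ / 8 := by field_simp
      have e3 : |μ| * 31 / (128 * ρ) = 31 / 128 * (|μ| / ρ) := by field_simp
      rw [e1, e2, e3]
      linarith
    linarith

end Phase

/-! ### Lower bounds for Sobolev norms of waves -/

section PhaseMeasure

set_option linter.unusedSectionVars false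

variable {E : Type} [NormedAddCommGroup E] [NormedSpace ℝ E] [MeasureSpace E] [BorelSpace E]
  [FiniteDimensional ℝ E] [(volume : Measure E).IsAddHaarMeasure]
  {G : Type} [NormedAddCommGroup G] [NormedSpace ℝ G] [CompleteSpace G] {Ω Ω' : Set E}

/-- Both radii are proportional to ρ, so r^n/R^(n+σ) is a constant times ρ^(-σ); the constant is
independent of the wave. -/
lemma exists_le_gagliardo_of_oscillates (hΩ' : MeasurableSet Ω') (hv0 : volume Ω' ≠ 0)
    (hvt : volume Ω' ≠ ⊤) {L K σ : ℝ} (hL : 1 ≤ L) (hK : 0 < K) (hσ : 0 < σ) :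
    ∃ c : ℝ, 0 < c ∧ ∀ (ρ η : ℝ) (f : E → G), 0 < ρ → 0 < η →
      Oscillates Ω Ω' (ρ / (32 * L)) (K * ρ) η f →
      ENNReal.ofReal (c * (η * ρ ^ (-σ))) ≤ gagliardo Ω σ f := by
  set n := Module.finrank ℝ E with hn
  have hV0 : 0 < (volume (Metric.ball (0 : E) 1)).toReal := ENNReal.toReal_pos
    (Metric.measure_ball_pos _ _ one_pos).ne' Metric.isBounded_ball.measure_lt_top.ne
  have hw0 : 0 < (volume Ω').toReal := ENNReal.toReal_pos hv0 hvt
  refine ⟨(1 / (32 * L)) ^ n / K ^ ((n : ℝ) + σ) *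
    ((volume (Metric.ball (0 : E) 1)).toReal * (volume Ω').toReal), by positivity,
    fun ρ η f hρ hη h => ?_⟩
  refine le_trans (le_of_eq ?_) (h.le_gagliardo hσ hΩ' (by positivity) (by positivity) hη)
  rw [← hn]
  conv_rhs => rw [← ENNReal.ofReal_toReal hvt,
    ← ENNReal.ofReal_toReal (Metric.isBounded_ball (x := (0 : E)) (r := 1)).measure_lt_top.ne,
    ← ENNReal.ofReal_mul (by positivity), ← ENNReal.ofReal_mul (by positivity)]
  congr 1
  rw [Real.mul_rpow hK.le hρ.le, Real.rpow_add hρ, Real.rpow_neg hρ.le, Real.rpow_natCast,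
    div_pow, div_pow, one_pow]
  field_simp

lemma exists_le_lintegral_fderiv_of_oscillates (hΩ : MeasurableSet Ω) (hΩ' : MeasurableSet Ω')
    (hv0 : volume Ω' ≠ 0) (hvt : volume Ω' ≠ ⊤) {L K : ℝ} (hL : 1 ≤ L) (hK : 0 < K) :
    ∃ c : ℝ, 0 < c ∧ ∀ (ρ η : ℝ) (f : E → G), 0 < ρ → 0 < η → ContDiff ℝ 1 f →
      Oscillates Ω Ω' (ρ / (32 * L)) (K * ρ) η f →
      ENNReal.ofReal (c * (η * ρ⁻¹)) ≤ ∫⁻ x in Ω, ‖fderiv ℝ f x‖ₑ := by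
  set n := Module.finrank ℝ E with hn
  have hw0 : 0 < (volume Ω').toReal := ENNReal.toReal_pos hv0 hvt
  refine ⟨(1 / (32 * L)) ^ n / (K * K ^ n) * (volume Ω').toReal, by positivity,
    fun ρ η f hρ hη hf h => ?_⟩
  have h1 := h.le_lintegral_fderiv hΩ hΩ' (by positivity) (by positivity) hf
  rw [← hn, ← ENNReal.ofReal_toReal hvt] at h1
  have hpos : 0 < K * ρ * (K * ρ) ^ n := by positivity
  rw [← ENNReal.ofReal_mul (by positivity), mul_comm (ENNReal.ofReal (K * ρ * (K * ρ) ^ n))] at h1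
  have h2 := ENNReal.div_le_of_le_mul h1
  refine le_trans (le_of_eq ?_) h2
  rw [← ENNReal.ofReal_div_of_pos hpos]
  congr 1
  rw [div_pow, div_pow, one_pow, mul_pow K ρ]
  field_simp

/-- Blow-up of the `W^{s,1}` norms, `s > 1/q`, of waves of amplitude `ε` and wave length `ε^q`. -/
theorem exists_le_sobolevNorm_wave (hΩ : IsOpen Ω) (hΩ' : MeasurableSet Ω')
    (hv0 : volume Ω' ≠ 0) (hvt : volume Ω' ≠ ⊤) {L K : ℝ} (hL : 1 ≤ L) (hK : 0 < K)
    {lam : ℝ} (hlam : 0 < lam) {q : ℕ} (hq : 1 ≤ q) {s : ℝ} (hs : 1 / (q : ℝ) < s) :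
    ∃ c γ : ℝ, 0 < c ∧ 0 < γ ∧ ∀ (ε u μ : ℝ) (e : E) (Z : E → ℝ), 0 < ε → |μ| = lam * ε →
      IsPhase Ω Ω' (ε ^ q) L K e Z →
      ENNReal.ofReal (c * ε ^ (-γ)) ≤ sobolevNorm s Ω fun x => waveProfile u μ (Z x) := by
  have hq0 : (0 : ℝ) < q := by exact_mod_cast hq
  have hs0 : 0 < s := lt_trans (by positivity) hs
  have hsq : 1 < s * q := by rwa [div_lt_iff₀ hq0] at hs
  have hsmooth : ∀ (u μ : ℝ) (e : E) (Z : E → ℝ) (ρ : ℝ), IsPhase Ω Ω' ρ L K e Z →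
      ContDiff ℝ 2 fun x => waveProfile u μ (Z x) := fun u μ e Z ρ h =>
    (contDiff_waveProfile u μ).comp (h.contDiff.of_le (WithTop.coe_le_coe.mpr le_top))
  -- For s < 1 the seminorm is of order at least ε·ε^(-qs). For s ≥ 1 and q ≥ 2 the first derivative
  -- is already of order at least ε^(1-q) in L¹.
  rcases lt_or_ge s 1 with h1 | h1
  · obtain ⟨c, hc, H⟩ := exists_le_gagliardo_of_oscillates (G := ℝ) (Ω := Ω) hΩ' hv0 hvt hL hK hs0
    refine ⟨c * (lam / 4), s * q - 1, by positivity, by linarith, fun ε u μ e Z hε hμ h => ?_⟩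
    have hρ : 0 < ε ^ q := by positivity
    refine le_trans (le_of_eq ?_) ((H _ (lam * ε / 4) _ hρ (by positivity)
      (hμ ▸ h.oscillates hρ hL u μ)).trans (gagliardo_le_sobolevNorm hs0 h1 _ _))
    congr 1
    rw [← Real.rpow_natCast, ← Real.rpow_mul hε.le,
      show -(s * q - 1) = 1 + q * -s by ring, Real.rpow_add hε, Real.rpow_one]
    ring
  rcases Nat.lt_or_ge 1 q with hq2 | hq1
  · obtain ⟨c, hc, H⟩ := exists_le_lintegral_fderiv_of_oscillates (G := ℝ) hΩ.measurableSet hΩ'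
      hv0 hvt hL hK
    have hq2' : (1 : ℝ) < q := by exact_mod_cast hq2
    refine ⟨c * (lam / 4), q - 1, by positivity, by linarith, fun ε u μ e Z hε hμ h => ?_⟩
    have hρ : 0 < ε ^ q := by positivity
    have hsm := (hsmooth u μ e Z _ h).of_le one_le_two
    refine le_trans (le_of_eq ?_) ((H _ (lam * ε / 4) _ hρ (by positivity) hsm
      (hμ ▸ h.oscillates hρ hL u μ)).trans (lintegral_fderiv_le_sobolevNorm h1 hΩ hsm))
    congr 1
    rw [← Real.rpow_natCast, ← Real.rpow_neg hε.le,
      show -((q : ℝ) - 1) = 1 + -q by ring, Real.rpow_add hε, Real.rpow_one]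
    ring
  -- Amplitude and wave length are now both proportional to ε, so the gradient oscillates by a fixed
  -- amount at scale ε. The blow-up is read off its seminorm of order s-1, or the second derivative
  -- if s ≥ 2.
  obtain rfl : q = 1 := by omega
  have hs1 : 1 < s := by simpa using hs
  rcases lt_or_ge s 2 with h2 | h2
  · obtain ⟨c, hc, H⟩ := exists_le_gagliardo_of_oscillates (G := E →L[ℝ] ℝ) (Ω := Ω) hΩ' hv0 hvt hL
      hK (sub_pos.mpr hs1)
    refine ⟨c * (lam / 16), s - 1, by positivity, by linarith, fun ε u μ e Z hε hμ h => ?_⟩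
    rw [pow_one] at h
    have hsm := (hsmooth u μ e Z _ h).of_le one_le_two
    refine le_trans (le_of_eq ?_) ((H _ (lam * ε / (16 * ε)) _ hε (by positivity)
      (hμ ▸ h.oscillates_fderiv hε hL u μ)).trans
      (gagliardo_fderiv_le_sobolevNorm hs1 h2 hΩ hsm))
    congr 1
    field_simp
  · obtain ⟨c, hc, H⟩ := exists_le_lintegral_fderiv_of_oscillates (G := E →L[ℝ] ℝ)
      hΩ.measurableSet hΩ' hv0 hvt hL hK
    refine ⟨c * (lam / 16), 1, by positivity, one_pos, fun ε u μ e Z hε hμ h => ?_⟩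
    rw [pow_one] at h
    have hsm := hsmooth u μ e Z _ h
    refine le_trans (le_of_eq ?_) ((H _ (lam * ε / (16 * ε)) _ hε (by positivity)
      (hsm.fderiv_right (by norm_num)) (hμ ▸ h.oscillates_fderiv hε hL u μ)).trans
      (lintegral_fderiv_fderiv_le_sobolevNorm h2 hΩ hsm))
    congr 1
    rw [Real.rpow_neg_one]
    field_simp

end PhaseMeasure

end ScalarLaw

namespace ScalarLaw

/-! ### Classical solutions are entropy solutions -/

variable {d : ℕ} {F : ℝ → EuclideanSpace ℝ (Fin d)} {M T₀ : ℝ}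

lemma strip_coe (d : ℕ) (T₀ : ℝ) :
    strip d (T₀ : EReal) = Ioo 0 T₀ ×ˢ (univ : Set (EuclideanSpace ℝ (Fin d))) := by
  ext p
  simp [strip]

lemma isOpen_strip (d : ℕ) (T₀ : ℝ) : IsOpen (strip d (T₀ : EReal)) := by
  rw [strip_coe]
  exact isOpen_Ioo.prod isOpen_univ

lemma measurableSet_strip (d : ℕ) (T₀ : ℝ) : MeasurableSet (strip d (T₀ : EReal)) :=
  (isOpen_strip d T₀).measurableSet

lemma tsupport_subset_coe {φ : ℝ × EuclideanSpace ℝ (Fin d) → ℝ} {T₀ : ℝ}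
    (h : tsupport φ ⊆ {p | (p.1 : EReal) < (T₀ : EReal)}) : ∀ p, T₀ ≤ p.1 → φ p = 0 := by
  intro p hp
  refine image_eq_zero_of_notMem_tsupport fun hmem => ?_
  have := h hmem
  simp only [mem_ofPred_eq, EReal.coe_lt_coe_iff] at this
  linarith

lemma integral_strip_fderiv_space {Ψ : ℝ × EuclideanSpace ℝ (Fin d) → ℝ} (hΨ : ContDiff ℝ 1 Ψ)
    (hc : HasCompactSupport Ψ) (e : EuclideanSpace ℝ (Fin d)) :
    ∫ p in strip d (T₀ : EReal), fderiv ℝ Ψ p (0, e) = 0 := by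
  have hD : Continuous (fun p => fderiv ℝ Ψ p (0, e)) :=
    (hΨ.continuous_fderiv one_ne_zero).clm_apply continuous_const
  have hDc : HasCompactSupport (fun p => fderiv ℝ Ψ p (0, e)) := hc.fderiv_apply ℝ _
  rw [strip_coe, Measure.volume_eq_prod, setIntegral_prod _
    (hD.integrable_of_hasCompactSupport hDc).integrableOn]
  refine integral_eq_zero_of_ae (Eventually.of_forall fun t => ?_)
  simp only [Measure.restrict_univ, Pi.zero_apply]
  set g : EuclideanSpace ℝ (Fin d) → ℝ := fun x => Ψ (t, x) with hg
  have hemb : Topology.IsClosedEmbedding (fun x : EuclideanSpace ℝ (Fin d) => (t, x)) :=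
    ⟨isEmbedding_prodMkRight t, by
      have : range (fun x : EuclideanSpace ℝ (Fin d) => (t, x)) = {t} ×ˢ univ := by
        ext p; rcases p with ⟨a, b⟩; simp [eq_comm]
      rw [this]; exact isClosed_singleton.prod isClosed_univ⟩
  have hgs : ContDiff ℝ 1 g := hΨ.comp (by fun_prop)
  have hgc : HasCompactSupport g := hc.comp_isClosedEmbedding hemb
  have hder : ∀ x, fderiv ℝ Ψ (t, x) (0, e) = fderiv ℝ g x e := by
    intro x
    have h1 := (hΨ.differentiable one_ne_zero (t, x)).hasFDerivAt.comp x
      (hasFDerivAt_prodMk_right t x)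
    have h2 : fderiv ℝ g x = _ := h1.fderiv
    rw [h2]
    simp
  simp only [hder]
  have hDg : Continuous (fun x => fderiv ℝ g x e) :=
    (hgs.continuous_fderiv one_ne_zero).clm_apply continuous_const
  have := integral_mul_fderiv_eq_neg_fderiv_mul_of_integrable (𝕜 := ℝ) (μ := volume)
    (f := fun _ : EuclideanSpace ℝ (Fin d) => (1 : ℝ)) (g := g) (v := e)
    (by simp)
    (by simpa using hDg.integrable_of_hasCompactSupport (hgc.fderiv_apply ℝ _))
    (by simpa using hgs.continuous.integrable_of_hasCompactSupport hgc)
    (fun x _ => by fun_prop) (fun x _ => hgs.differentiable one_ne_zero x)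
  simpa using this

lemma integral_strip_fderiv_time (hT₀ : 0 < T₀) {Ψ : ℝ × EuclideanSpace ℝ (Fin d) → ℝ}
    (hΨ : ContDiff ℝ 1 Ψ) (hc : HasCompactSupport Ψ) (h0 : ∀ p, T₀ ≤ p.1 → Ψ p = 0) :
    ∫ p in strip d (T₀ : EReal), fderiv ℝ Ψ p (1, 0) = - ∫ x, Ψ (0, x) := by
  have hD : Continuous (fun p => fderiv ℝ Ψ p (1, 0)) :=
    (hΨ.continuous_fderiv one_ne_zero).clm_apply continuous_const
  have hDc : HasCompactSupport (fun p => fderiv ℝ Ψ p (1, 0)) := hc.fderiv_apply ℝ _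
  have hint := (hD.integrable_of_hasCompactSupport hDc (μ := volume)).integrableOn
    (s := Ioo 0 T₀ ×ˢ (univ : Set (EuclideanSpace ℝ (Fin d))))
  rw [strip_coe, Measure.volume_eq_prod, ← Measure.prod_restrict, Measure.restrict_univ]
  rw [IntegrableOn, Measure.volume_eq_prod, ← Measure.prod_restrict, Measure.restrict_univ] at hint
  rw [integral_prod_symm _ hint, ← integral_neg]
  congr 1
  ext x
  have hder : ∀ t, HasDerivAt (fun t => Ψ (t, x)) (fderiv ℝ Ψ (t, x) (1, 0)) t := by
    intro t
    have h1 : HasDerivAt (fun t : ℝ => (t, x)) ((1 : ℝ), (0 : EuclideanSpace ℝ (Fin d))) t :=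
      (hasDerivAt_id t).prodMk (hasDerivAt_const t x)
    exact (hΨ.differentiable one_ne_zero (t, x)).hasFDerivAt.comp_hasDerivAt t h1
  rw [← integral_Ioc_eq_integral_Ioo, ← intervalIntegral.integral_of_le hT₀.le,
    intervalIntegral.integral_eq_sub_of_hasDerivAt (fun t _ => hder t)
      (Continuous.intervalIntegrable (hD.comp (by fun_prop)) _ _), h0 (T₀, x) le_rfl, zero_sub]

/-- A classical solution of the conservation law, with values in `[-M,M]`. -/
structure IsClassicalSolution (F : ℝ → EuclideanSpace ℝ (Fin d)) (M T₀ : ℝ)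
    (U : ℝ × EuclideanSpace ℝ (Fin d) → ℝ) : Prop where
  contDiff : ContDiff ℝ ∞ U
  mem_Icc : ∀ p, U p ∈ Icc (-M) M
  eqn : ∀ p ∈ strip d (T₀ : EReal), fderiv ℝ U p (1, velocity F M (U p)) = 0
  bound : ∃ L : ℝ, ∀ p ∈ strip d (T₀ : EReal), ‖fderiv ℝ U p‖ ≤ L

/-- The flux has only one-sided derivatives at ±M. Since U takes all its values in [-M,M], the chain
rule within that interval still gives a full derivative. -/
lemma hasFDerivAt_comp_of_mem_Icc {G : Type} [NormedAddCommGroup G] [NormedSpace ℝ G]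
    {U : ℝ × EuclideanSpace ℝ (Fin d) → ℝ} (hU : Differentiable ℝ U)
    (hm : ∀ p, U p ∈ Icc (-M) M) {B B' : ℝ → G}
    (hB : ∀ v ∈ Icc (-M) M, HasDerivWithinAt B (B' v) (Icc (-M) M) v)
    (p : ℝ × EuclideanSpace ℝ (Fin d)) :
    HasFDerivAt (fun p => B (U p)) ((fderiv ℝ U p).smulRight (B' (U p))) p := by
  have h1 := (hB (U p) (hm p)).hasFDerivWithinAt.comp p
    ((hU p).hasFDerivAt.hasFDerivWithinAt (s := univ)) (fun q _ => hm q)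
  rw [hasFDerivWithinAt_univ] at h1
  convert! h1 using 1

/-- Integration by parts in space against a field that is a function of `U`. -/
lemma integral_strip_div {U φ : ℝ × EuclideanSpace ℝ (Fin d) → ℝ} (hU : ContDiff ℝ 1 U)
    (hm : ∀ p, U p ∈ Icc (-M) M) {B B' : ℝ → EuclideanSpace ℝ (Fin d)}
    (hB : ∀ v ∈ Icc (-M) M, HasDerivWithinAt B (B' v) (Icc (-M) M) v)
    (hB' : ContinuousOn B' (Icc (-M) M)) (hφ : ContDiff ℝ 1 φ) (hφc : HasCompactSupport φ) :
    ∫ p in strip d (T₀ : EReal), (fderiv ℝ φ p (0, B (U p)) + φ p * fderiv ℝ U p (0, B' (U p)))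
      = 0 := by
  have hDU : Continuous (fderiv ℝ U) := hU.continuous_fderiv one_ne_zero
  have hDφ : Continuous (fderiv ℝ φ) := hφ.continuous_fderiv one_ne_zero
  have hB'U : Continuous fun p => B' (U p) := hB'.comp_continuous hU.continuous hm
  have hBder := hasFDerivAt_comp_of_mem_Icc (hU.differentiable one_ne_zero) hm hB
  have hBU : ContDiff ℝ 1 fun p => B (U p) := by
    rw [contDiff_one_iff_fderiv]
    refine ⟨fun p => (hBder p).differentiableAt, ?_⟩
    have : (fderiv ℝ fun p => B (U p)) = fun p => (fderiv ℝ U p).smulRight (B' (U p)) :=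
      funext fun p => (hBder p).fderiv
    rw [this]
    exact (ContinuousLinearMap.smulRightL ℝ _ _).continuous₂.comp₂ hDU hB'U
  have hcoord : ∀ i, ∀ p, HasFDerivAt (fun p => (B (U p)) i)
      ((fderiv ℝ U p).smulRight (B' (U p) i)) p := by
    intro i p
    have := (EuclideanSpace.proj (𝕜 := ℝ) i).hasFDerivAt.comp p (hBder p)
    convert! this using 1
  set Ψ : Fin d → ℝ × EuclideanSpace ℝ (Fin d) → ℝ := fun i p => φ p * (B (U p)) i with hΨ
  have hΨs : ∀ i, ContDiff ℝ 1 (Ψ i) := fun i =>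
    hφ.mul ((EuclideanSpace.proj (𝕜 := ℝ) i).contDiff.comp hBU)
  have hΨc : ∀ i, HasCompactSupport (Ψ i) := fun i => hφc.mul_right
  have hzero := fun i => integral_strip_fderiv_space (T₀ := T₀) (hΨs i) (hΨc i)
    (EuclideanSpace.single i 1)
  have hint : ∀ i, IntegrableOn (fun p => fderiv ℝ (Ψ i) p (0, EuclideanSpace.single i 1))
      (strip d (T₀ : EReal)) := fun i =>
    ((((hΨs i).continuous_fderiv one_ne_zero).clm_apply
      continuous_const).integrable_of_hasCompactSupport ((hΨc i).fderiv_apply ℝ _)).integrableOn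
  have hsum : ∀ v : EuclideanSpace ℝ (Fin d), ((0 : ℝ), v) =
      ∑ i, v i • ((0 : ℝ), EuclideanSpace.single i (1 : ℝ)) := by
    intro v
    refine Prod.ext (by simp [Prod.fst_sum]) ?_
    rw [Prod.snd_sum]
    ext j
    simp [Finset.sum_apply, Pi.single_apply]
  have hpt : ∀ p, fderiv ℝ φ p (0, B (U p)) + φ p * fderiv ℝ U p (0, B' (U p)) =
      ∑ i, fderiv ℝ (Ψ i) p (0, EuclideanSpace.single i 1) := by
    intro p
    have h1 : ∀ i, fderiv ℝ (Ψ i) p (0, EuclideanSpace.single i 1) =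
        B (U p) i * fderiv ℝ φ p (0, EuclideanSpace.single i 1) +
        φ p * (B' (U p) i * fderiv ℝ U p (0, EuclideanSpace.single i 1)) := by
      intro i
      have h2 := ((hφ.differentiable one_ne_zero p).hasFDerivAt.mul (hcoord i p)).fderiv
      have h3 : fderiv ℝ (Ψ i) p = _ := h2
      rw [h3]
      simp
      ring
    simp only [h1]
    rw [Finset.sum_add_distrib, ← Finset.mul_sum]
    conv_lhs => rw [hsum (B (U p)), hsum (B' (U p))]
    simp only [map_sum, map_smul, smul_eq_mul]
  simp only [hpt]
  rw [integral_finsetSum _ fun i _ => hint i]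
  simp [hzero]

end ScalarLaw

namespace ScalarLaw

/-! ### Entropy identity and limit to the Kruzhkov entropies -/

section Existence

variable {d : ℕ} {F : ℝ → EuclideanSpace ℝ (Fin d)} {M T₀ : ℝ}
  {U : ℝ × EuclideanSpace ℝ (Fin d) → ℝ}

lemma continuousOn_velocity (hM : 0 < M) (hF : ContDiffOn ℝ ∞ F (Icc (-M) M)) :
    ContinuousOn (velocity F M) (Icc (-M) M) :=
  fluxDeriv_one (F := F) (M := M) ▸ continuousOn_fluxDeriv hM hF 1

lemma exists_lipschitz_flux (hM : 0 < M) (hF : ContDiffOn ℝ ∞ F (Icc (-M) M)) :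
    ∃ C : ℝ, 0 ≤ C ∧ ∀ u ∈ Icc (-M) M, ∀ v ∈ Icc (-M) M,
      ‖velocity F M u‖ ≤ C ∧ ‖F u - F v‖ ≤ C * |u - v| ∧
      ‖velocity F M u - velocity F M v‖ ≤ C * |u - v| := by
  obtain ⟨B, hB1, hB⟩ := exists_bound_fluxDeriv hM hF 2
  refine ⟨B, by linarith, fun u hu v hv => ⟨?_, ?_, ?_⟩⟩
  · rw [← fluxDeriv_one]
    exact hB 1 (by norm_num) u hu
  · rw [← Real.norm_eq_abs]
    refine (convex_Icc (-M) M).norm_image_sub_le_of_norm_hasDerivWithin_le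
      (fun w hw => hasDerivWithinAt_flux hM hF hw) (fun w hw => ?_) hv hu
    rw [← fluxDeriv_one]
    exact hB 1 (by norm_num) w hw
  · rw [← Real.norm_eq_abs, ← fluxDeriv_one]
    exact (convex_Icc (-M) M).norm_image_sub_le_of_norm_hasDerivWithin_le
      (fun w hw => hasDerivWithinAt_fluxDeriv hM hF 1 hw) (fun w hw => hB 2 le_rfl w hw) hv hu

lemma IsClassicalSolution.fderiv_time (h : IsClassicalSolution F M T₀ U)
    {p : ℝ × EuclideanSpace ℝ (Fin d)} (hp : p ∈ strip d (T₀ : EReal)) :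
    fderiv ℝ U p (1, 0) = - fderiv ℝ U p (0, velocity F M (U p)) := by
  have h1 := h.eqn p hp
  have : ((1 : ℝ), velocity F M (U p)) =
      ((1 : ℝ), (0 : EuclideanSpace ℝ (Fin d))) + ((0 : ℝ), velocity F M (U p)) := by simp
  rw [this, map_add] at h1
  linarith

/-- The entropy identity of a classical solution for a smooth function `η` of `U - k`. -/
lemma IsClassicalSolution.entropy_identity (hM : 0 < M) (hT₀ : 0 < T₀)
    (hF : ContDiffOn ℝ ∞ F (Icc (-M) M)) (h : IsClassicalSolution F M T₀ U) {η S S' : ℝ → ℝ}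
    (hη : ∀ r, HasDerivAt η (S r) r) (hS : ∀ r, HasDerivAt S (S' r) r) (hS' : Continuous S')
    (k : ℝ) {φ : ℝ × EuclideanSpace ℝ (Fin d) → ℝ} (hφ : ContDiff ℝ ∞ φ)
    (hφc : HasCompactSupport φ) (h0 : ∀ p, T₀ ≤ p.1 → φ p = 0) :
    (∫ p in strip d (T₀ : EReal), (η (U p - k) * fderiv ℝ φ p (1, 0) +
      S (U p - k) * fderiv ℝ φ p (0, F (U p) - F k) +
      φ p * (S' (U p - k) * fderiv ℝ U p (0, F (U p) - F k)))) +
      ∫ x, η (U (0, x) - k) * φ (0, x) = 0 := by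
  have hU1 : ContDiff ℝ 1 U := h.contDiff.of_le (WithTop.coe_le_coe.mpr le_top)
  have hφ1 : ContDiff ℝ 1 φ := hφ.of_le (WithTop.coe_le_coe.mpr le_top)
  have hSc : Continuous S := continuous_iff_continuousAt.mpr fun r => (hS r).continuousAt
  have hη1 : ContDiff ℝ 1 η := by
    rw [contDiff_one_iff_deriv]
    refine ⟨fun r => (hη r).differentiableAt, ?_⟩
    rwa [funext fun r => (hη r).deriv]
  have hdU : ∀ p, HasFDerivAt U (fderiv ℝ U p) p := fun p =>
    (hU1.differentiable one_ne_zero p).hasFDerivAt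
  -- the time part
  set Ψ : ℝ × EuclideanSpace ℝ (Fin d) → ℝ := fun p => η (U p - k) * φ p with hΨ
  have hΨ1 : ContDiff ℝ 1 Ψ := (hη1.comp (hU1.sub contDiff_const)).mul hφ1
  have hΨc : HasCompactSupport Ψ := hφc.mul_left
  have htime := integral_strip_fderiv_time hT₀ hΨ1 hΨc fun p hp => by simp [hΨ, h0 p hp]
  have hΨd : ∀ p, fderiv ℝ Ψ p (1, 0) = η (U p - k) * fderiv ℝ φ p (1, 0) +
      φ p * (S (U p - k) * fderiv ℝ U p (1, 0)) := by
    intro p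
    have h1 := ((hη (U p - k)).comp_hasFDerivAt p ((hdU p).sub_const k)).mul
      (hφ1.differentiable one_ne_zero p).hasFDerivAt
    have h2 : fderiv ℝ Ψ p = _ := h1.fderiv
    rw [h2]
    simp
  -- the space part
  have hB : ∀ v ∈ Icc (-M) M, HasDerivWithinAt (fun v => S (v - k) • (F v - F k))
      (S (v - k) • velocity F M v + S' (v - k) • (F v - F k)) (Icc (-M) M) v := by
    intro v hv
    have h1 : HasDerivAt (fun v => S (v - k)) (S' (v - k)) v := by
      simpa using (hS (v - k)).comp_sub_const v k
    exact h1.hasDerivWithinAt.smul ((hasDerivWithinAt_flux hM hF hv).sub_const (F k))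
  have hB' : ContinuousOn (fun v => S (v - k) • velocity F M v + S' (v - k) • (F v - F k))
      (Icc (-M) M) := by
    have h1 := continuousOn_velocity hM hF
    have h2 := hF.continuousOn
    have h3 : Continuous fun v : ℝ => S (v - k) := by fun_prop
    have h4 : Continuous fun v : ℝ => S' (v - k) := by fun_prop
    exact (h3.continuousOn.smul h1).add (h4.continuousOn.smul (h2.sub continuousOn_const))
  have hspace := integral_strip_div (T₀ := T₀) hU1 h.mem_Icc hB hB' hφ1 hφc
  -- combination
  have hDφ : Continuous (fderiv ℝ φ) := hφ1.continuous_fderiv one_ne_zero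
  have hi1 : IntegrableOn (fun p => fderiv ℝ Ψ p (1, 0)) (strip d (T₀ : EReal)) :=
    (((hΨ1.continuous_fderiv one_ne_zero).clm_apply
      continuous_const).integrable_of_hasCompactSupport (hΨc.fderiv_apply ℝ _)).integrableOn
  have hi2 : IntegrableOn (fun p => fderiv ℝ φ p (0, S (U p - k) • (F (U p) - F k)) +
      φ p * fderiv ℝ U p (0, S (U p - k) • velocity F M (U p) + S' (U p - k) • (F (U p) - F k)))
      (strip d (T₀ : EReal)) := by
    refine Integrable.integrableOn ?_
    have hFU : Continuous fun p => F (U p) := hF.continuousOn.comp_continuous hU1.continuous h.mem_Icc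
    have hBU : Continuous fun p => S (U p - k) • velocity F M (U p) +
        S' (U p - k) • (F (U p) - F k) := hB'.comp_continuous hU1.continuous h.mem_Icc
    have hDU : Continuous (fderiv ℝ U) := hU1.continuous_fderiv one_ne_zero
    have hUc := hU1.continuous
    have hSU : Continuous fun p => S (U p - k) • (F (U p) - F k) :=
      (hSc.comp (hUc.sub continuous_const)).smul (hFU.sub continuous_const)
    refine Continuous.integrable_of_hasCompactSupport ?_ ?_
    · exact (hDφ.clm_apply (continuous_const.prodMk hSU)).add
        (hφ1.continuous.mul (hDU.clm_apply (continuous_const.prodMk hBU)))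
    · refine HasCompactSupport.add ?_ hφc.mul_right
      refine (hφc.fderiv ℝ).mono' ?_
      intro p hp
      refine subset_tsupport _ fun h0 => hp ?_
      simp [h0]
  have hsum := congrArg₂ (· + ·) htime hspace
  simp only [add_zero] at hsum
  rw [← integral_add hi1 hi2] at hsum
  rw [← sub_eq_zero, sub_neg_eq_add] at hsum
  refine Eq.trans ?_ hsum
  congr 1
  -- By the equation, φSU_t cancels the velocity part of the space term; only the term with S'
  -- survives.
  refine setIntegral_congr_fun (measurableSet_strip d T₀) fun p hp => ?_
  rw [hΨd, h.fderiv_time hp]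
  have hlin : ∀ (l : ℝ × EuclideanSpace ℝ (Fin d) →L[ℝ] ℝ) (c : ℝ) (v : EuclideanSpace ℝ (Fin d)),
      l (0, c • v) = c * l (0, v) := by
    intro l c v
    rw [← smul_eq_mul, ← map_smul]
    simp
  have hadd : ∀ (l : ℝ × EuclideanSpace ℝ (Fin d) →L[ℝ] ℝ) (v w : EuclideanSpace ℝ (Fin d)),
      l (0, v + w) = l (0, v) + l (0, w) := by
    intro l v w
    rw [← map_add]
    simp
  rw [hadd, hlin, hlin, hlin]
  ring

lemma hasDerivAt_sqrt_sq_add {δ : ℝ} (hδ : 0 < δ) (r : ℝ) :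
    HasDerivAt (fun r => √(r ^ 2 + δ ^ 2)) (r / √(r ^ 2 + δ ^ 2)) r := by
  have hpos : 0 < r ^ 2 + δ ^ 2 := by positivity
  have := (((hasDerivAt_id r).pow 2).add_const (δ ^ 2)).sqrt (by simpa using hpos.ne')
  convert! this using 1
  simp
  field_simp

lemma hasDerivAt_div_sqrt_sq_add {δ : ℝ} (hδ : 0 < δ) (r : ℝ) :
    HasDerivAt (fun r => r / √(r ^ 2 + δ ^ 2)) (δ ^ 2 / √(r ^ 2 + δ ^ 2) ^ 3) r := by
  have hpos : 0 < r ^ 2 + δ ^ 2 := by positivity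
  have hs : 0 < √(r ^ 2 + δ ^ 2) := Real.sqrt_pos.mpr hpos
  have := (hasDerivAt_id r).div (hasDerivAt_sqrt_sq_add hδ r) hs.ne'
  convert! this using 1
  have hsq : √(r ^ 2 + δ ^ 2) ^ 2 = r ^ 2 + δ ^ 2 := Real.sq_sqrt hpos.le
  simp only [id]
  field_simp
  rw [hsq]
  ring

/-- The entropy identity is applied with √(r²+δ²) in place of |r|, and δ tends to 0. The error term
carries δ²/(r²+δ²)^(3/2), which is singular at r = 0 but is compensated by |F(U)-F(k)| ≤ C|r|.
Dominated convergence even gives equality. -/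
theorem IsClassicalSolution.isEntropySolution (hM : 0 < M) (hT₀ : 0 < T₀)
    (hF : ContDiffOn ℝ ∞ F (Icc (-M) M)) (h : IsClassicalSolution F M T₀ U) :
    IsEntropySolution F M (T₀ : EReal) (fun x => U (0, x)) (fun t x => U (t, x)) := by
  have hUc : Continuous U := h.contDiff.continuous
  refine ⟨hUc.aestronglyMeasurable, Eventually.of_forall h.mem_Icc, fun k hk φ hφ hφc _ hφT => ?_⟩
  have h0 := tsupport_subset_coe hφT
  obtain ⟨C, hC0, hC⟩ := exists_lipschitz_flux hM hF
  have hφ1 : ContDiff ℝ 1 φ := hφ.of_le (WithTop.coe_le_coe.mpr le_top)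
  have hU1 : ContDiff ℝ 1 U := h.contDiff.of_le (WithTop.coe_le_coe.mpr le_top)
  have hDU : Continuous (fderiv ℝ U) := hU1.continuous_fderiv one_ne_zero
  have hDφ : Continuous (fderiv ℝ φ) := hφ1.continuous_fderiv one_ne_zero
  have hFU : Continuous fun p => F (U p) := hF.continuousOn.comp_continuous hUc h.mem_Icc
  set δ : ℕ → ℝ := fun n => 1 / ((n : ℝ) + 1) with hδ
  have hδ0 : ∀ n, 0 < δ n := fun n => by positivity
  have hδ1 : ∀ n, δ n ≤ 1 := fun n => by
    rw [hδ]; simp only; rw [div_le_one (by positivity)]; linarith [n.cast_nonneg (α := ℝ)]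
  have hδl : Tendsto δ atTop (𝓝 0) := tendsto_one_div_add_atTop_nhds_zero_nat
  have hs0 : ∀ n r, 0 < √(r ^ 2 + δ n ^ 2) := fun n r => Real.sqrt_pos.mpr (by have := hδ0 n; positivity)
  have hs1 : ∀ n r, |r| ≤ √(r ^ 2 + δ n ^ 2) := fun n r =>
    Real.abs_le_sqrt (by nlinarith [sq_nonneg (δ n)])
  have hs2 : ∀ n r, δ n ≤ √(r ^ 2 + δ n ^ 2) := fun n r => by
    have := Real.abs_le_sqrt (x := δ n) (y := r ^ 2 + δ n ^ 2) (by nlinarith [sq_nonneg r])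
    rwa [abs_of_pos (hδ0 n)] at this
  have hsl : ∀ r, Tendsto (fun n => √(r ^ 2 + δ n ^ 2)) atTop (𝓝 |r|) := by
    intro r
    have : Tendsto (fun n => √(r ^ 2 + δ n ^ 2)) atTop (𝓝 √(r ^ 2 + 0 ^ 2)) :=
      (Real.continuous_sqrt.tendsto _).comp (tendsto_const_nhds.add (hδl.pow 2))
    rwa [zero_pow two_ne_zero, add_zero, Real.sqrt_sq_eq_abs] at this
  have hid := fun n => h.entropy_identity hM hT₀ hF (hasDerivAt_sqrt_sq_add (hδ0 n))
    (hasDerivAt_div_sqrt_sq_add (hδ0 n))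
    (by
      refine Continuous.div continuous_const (by fun_prop) fun r => ?_
      have := hs0 n r
      positivity) k hφ hφc h0
  have hrange : ∀ p, |U p - k| ≤ 2 * M := fun p => by
    have h1 := h.mem_Icc p
    rw [abs_le]
    constructor <;> linarith [h1.1, h1.2, hk.1, hk.2]
  have hη_le : ∀ n p, √((U p - k) ^ 2 + δ n ^ 2) ≤ 2 * M + 1 := fun n p => by
    rw [Real.sqrt_le_left (by linarith)]
    have h1 := hrange p
    have h2 := hδ1 n
    have h3 := hδ0 n
    nlinarith [sq_abs (U p - k), abs_nonneg (U p - k)]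
  have hlim1 : Tendsto (fun n => ∫ x, √((U (0, x) - k) ^ 2 + δ n ^ 2) * φ (0, x)) atTop
      (𝓝 (∫ x, |U (0, x) - k| * φ (0, x))) := by
    have hemb : Topology.IsClosedEmbedding
        (fun x : EuclideanSpace ℝ (Fin d) => ((0 : ℝ), x)) :=
      ⟨isEmbedding_prodMkRight 0, by
        have : range (fun x : EuclideanSpace ℝ (Fin d) => ((0 : ℝ), x)) = {0} ×ˢ univ := by
          ext p; rcases p with ⟨a, b⟩; simp [eq_comm]
        rw [this]; exact isClosed_singleton.prod isClosed_univ⟩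
    refine tendsto_integral_of_dominated_convergence (fun x => (2 * M + 1) * |φ (0, x)|) ?_ ?_ ?_ ?_
    · intro n
      refine Continuous.aestronglyMeasurable ?_
      have := hφ1.continuous
      fun_prop
    · refine Integrable.const_mul (Integrable.abs ?_) _
      exact (hφ1.continuous.comp (by fun_prop)).integrable_of_hasCompactSupport
        (hφc.comp_isClosedEmbedding hemb)
    · intro n
      refine Eventually.of_forall fun x => ?_
      rw [norm_mul, Real.norm_of_nonneg (hs0 n _).le, Real.norm_eq_abs]
      gcongr
      exact hη_le n _
    · exact Eventually.of_forall fun x => (hsl _).mul_const _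
  have hlim2 : Tendsto (fun n => ∫ p in strip d (T₀ : EReal),
      (√((U p - k) ^ 2 + δ n ^ 2) * fderiv ℝ φ p (1, 0) +
      (U p - k) / √((U p - k) ^ 2 + δ n ^ 2) * fderiv ℝ φ p (0, F (U p) - F k) +
      φ p * (δ n ^ 2 / √((U p - k) ^ 2 + δ n ^ 2) ^ 3 * fderiv ℝ U p (0, F (U p) - F k)))) atTop
      (𝓝 (∫ p in strip d (T₀ : EReal), (|U p - k| * fderiv ℝ φ p (1, 0) +
        Real.sign (U p - k) * fderiv ℝ φ p (0, F (U p) - F k)))) := by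
    have hnormF : ∀ p, ‖F (U p) - F k‖ ≤ C * |U p - k| := fun p => (hC _ (h.mem_Icc p) _ hk).2.1
    have hle0 : ∀ (l : ℝ × EuclideanSpace ℝ (Fin d) →L[ℝ] ℝ) (v : EuclideanSpace ℝ (Fin d)),
        |l (0, v)| ≤ ‖l‖ * ‖v‖ := by
      intro l v
      have := l.le_opNorm (0, v)
      simpa [Prod.norm_def] using this
    refine tendsto_integral_of_dominated_convergence
      (fun p => (2 * M + 1) * |fderiv ℝ φ p (1, 0)| + ‖fderiv ℝ φ p‖ * (C * (2 * M)) +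
        |φ p| * (‖fderiv ℝ U p‖ * C)) ?_ ?_ ?_ ?_
    · intro n
      refine Continuous.aestronglyMeasurable ?_
      have h1 : Continuous fun p => fderiv ℝ φ p (1, 0) := hDφ.clm_apply continuous_const
      have h2 : Continuous fun p => fderiv ℝ φ p (0, F (U p) - F k) :=
        hDφ.clm_apply (continuous_const.prodMk (hFU.sub continuous_const))
      have h3 : Continuous fun p => fderiv ℝ U p (0, F (U p) - F k) :=
        hDU.clm_apply (continuous_const.prodMk (hFU.sub continuous_const))
      have h4 : Continuous fun p => √((U p - k) ^ 2 + δ n ^ 2) := by fun_prop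
      have h5 := hφ1.continuous
      refine ((h4.mul h1).add (((hUc.sub continuous_const).div h4 fun p => (hs0 n _).ne').mul h2)).add
        (h5.mul ((continuous_const.div (h4.pow 3) fun p => (pow_pos (hs0 n _) 3).ne').mul h3))
    · refine Integrable.integrableOn ?_
      have h1 : Integrable fun p => fderiv ℝ φ p (1, 0) :=
        (hDφ.clm_apply continuous_const).integrable_of_hasCompactSupport (hφc.fderiv_apply ℝ _)
      have h2 : Integrable fun p => ‖fderiv ℝ φ p‖ :=
        (hDφ.integrable_of_hasCompactSupport (hφc.fderiv ℝ)).norm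
      have h3 : Integrable fun p => |φ p| * (‖fderiv ℝ U p‖ * C) := by
        refine Continuous.integrable_of_hasCompactSupport ?_ ?_
        · have := hφ1.continuous
          fun_prop
        · exact (hφc.comp_left abs_zero).mul_right
      exact ((h1.abs.const_mul _).add (h2.mul_const _)).add h3
    · intro n
      refine Eventually.of_forall fun p => ?_
      have hs := hs0 n (U p - k)
      have hr := hs1 n (U p - k)
      have hd := hs2 n (U p - k)
      have hk' := hrange p
      have hdn := hδ0 n
      refine (norm_add_le _ _).trans (add_le_add ((norm_add_le _ _).trans (add_le_add ?_ ?_)) ?_)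
      · rw [norm_mul, Real.norm_of_nonneg hs.le, Real.norm_eq_abs]
        gcongr
        exact hη_le n p
      · rw [norm_mul, norm_div, Real.norm_of_nonneg hs.le, Real.norm_eq_abs, Real.norm_eq_abs]
        calc |U p - k| / √((U p - k) ^ 2 + δ n ^ 2) * |fderiv ℝ φ p (0, F (U p) - F k)|
            ≤ 1 * (‖fderiv ℝ φ p‖ * (C * (2 * M))) := by
              gcongr
              · rwa [div_le_one hs]
              · refine (hle0 _ _).trans ?_
                gcongr
                exact (hnormF p).trans (by gcongr)
          _ = _ := one_mul _
      · rw [norm_mul, norm_mul, norm_div, norm_pow, norm_pow, Real.norm_of_nonneg hs.le,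
          Real.norm_of_nonneg hdn.le, Real.norm_eq_abs, Real.norm_eq_abs]
        refine mul_le_mul_of_nonneg_left ?_ (abs_nonneg _)
        calc δ n ^ 2 / √((U p - k) ^ 2 + δ n ^ 2) ^ 3 * |fderiv ℝ U p (0, F (U p) - F k)|
            ≤ δ n ^ 2 / √((U p - k) ^ 2 + δ n ^ 2) ^ 3 *
              (‖fderiv ℝ U p‖ * (C * √((U p - k) ^ 2 + δ n ^ 2))) := by
              gcongr
              refine (hle0 _ _).trans ?_
              gcongr
              exact (hnormF p).trans (by gcongr)
          _ = (δ n / √((U p - k) ^ 2 + δ n ^ 2)) ^ 2 * (‖fderiv ℝ U p‖ * C) := by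
              field_simp
          _ ≤ 1 * (‖fderiv ℝ U p‖ * C) := by
              refine mul_le_mul_of_nonneg_right ?_ (by positivity)
              refine pow_le_one₀ (by positivity) ?_
              rwa [div_le_one hs]
          _ = _ := one_mul _
    · refine Eventually.of_forall fun p => ?_
      -- Where U = k the factor of the error term grows like 1/δ, but it multiplies F(U)-F(k) = 0.
      rcases eq_or_ne (U p - k) 0 with hz | hz
      · have hUk : U p = k := sub_eq_zero.mp hz
        simp only [hUk, sub_self, abs_zero, Real.sign_zero, zero_mul, zero_div, add_zero,
          Prod.mk_zero_zero, map_zero, mul_zero]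
        have := (hsl 0).mul_const (fderiv ℝ φ p (1, 0))
        simpa using this
      · have habs : |U p - k| ≠ 0 := abs_ne_zero.mpr hz
        have e : Real.sign (U p - k) = (U p - k) / |U p - k| := by
          rcases lt_or_gt_of_ne hz with h1 | h1
          · rw [Real.sign_of_neg h1, abs_of_neg h1, div_neg, div_self hz]
          · rw [Real.sign_of_pos h1, abs_of_pos h1, div_self hz]
        rw [e]
        have l1 := (hsl (U p - k)).mul_const (fderiv ℝ φ p (1, 0))
        have l2 := ((tendsto_const_nhds (x := U p - k)).div (hsl (U p - k)) habs).mul_const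
          (fderiv ℝ φ p (0, F (U p) - F k))
        have l3 := (((hδl.pow 2).div ((hsl (U p - k)).pow 3) (pow_ne_zero 3 habs)).mul_const
          (fderiv ℝ U p (0, F (U p) - F k))).const_mul (φ p)
        have := (l1.add l2).add l3
        simpa using this
  have hlim := hlim2.add hlim1
  have hz : ∀ n, (∫ p in strip d (T₀ : EReal),
      (√((U p - k) ^ 2 + δ n ^ 2) * fderiv ℝ φ p (1, 0) +
      (U p - k) / √((U p - k) ^ 2 + δ n ^ 2) * fderiv ℝ φ p (0, F (U p) - F k) +
      φ p * (δ n ^ 2 / √((U p - k) ^ 2 + δ n ^ 2) ^ 3 * fderiv ℝ U p (0, F (U p) - F k)))) +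
      ∫ x, √((U (0, x) - k) ^ 2 + δ n ^ 2) * φ (0, x) = 0 := hid
  simp only [hz] at hlim
  exact (tendsto_nhds_unique hlim tendsto_const_nhds).ge

end Existence

end ScalarLaw

namespace ScalarLaw

/-! ### Uniqueness of classical solutions among entropy solutions -/

section Uniqueness

variable {d : ℕ} {F : ℝ → EuclideanSpace ℝ (Fin d)} {M T₀ : ℝ}
  {U : ℝ × EuclideanSpace ℝ (Fin d) → ℝ}

lemma IsEntropySolution.restrict {T : EReal} (hT : (T₀ : EReal) ≤ T)
    {u₀ : EuclideanSpace ℝ (Fin d) → ℝ} {w : ℝ → EuclideanSpace ℝ (Fin d) → ℝ}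
    (h : IsEntropySolution F M T u₀ w) : IsEntropySolution F M (T₀ : EReal) u₀ w := by
  have hsub : strip d (T₀ : EReal) ⊆ strip d T := fun p hp => ⟨hp.1, hp.2.trans_le hT⟩
  have hmeas : MeasurableSet (strip d T) := by
    have h1 : Measurable fun p : ℝ × EuclideanSpace ℝ (Fin d) => (p.1 : EReal) :=
      measurable_coe_real_ereal.comp measurable_fst
    exact (measurableSet_lt measurable_const measurable_fst).inter
      (measurableSet_lt h1 measurable_const)
  refine ⟨h.aestronglyMeasurable.mono_set hsub, ae_restrict_of_ae_restrict_of_subset hsub h.mem_Icc,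
    fun k hk φ hφ hφc hφ0 hφT => ?_⟩
  have h1 := h.entropy k hk φ hφ hφc hφ0 fun p hp => lt_of_lt_of_le (hφT hp) hT
  rwa [setIntegral_eq_of_subset_of_forall_sdiff_eq_zero hmeas hsub] at h1
  intro p hp
  have hnot : p ∉ tsupport φ := fun hmem => hp.2 ⟨hp.1.1, hφT hmem⟩
  have hz : fderiv ℝ φ p = 0 :=
    image_eq_zero_of_notMem_tsupport fun hmem => hnot (tsupport_fderiv_subset ℝ hmem)
  simp [hz]

/-- A bounded measurable function with values in `[-M,M]` satisfying the entropy inequalities on a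
strip, with continuous initial datum. -/
structure IsEntropyPair (F : ℝ → EuclideanSpace ℝ (Fin d)) (M T₀ : ℝ)
    (u₀ : EuclideanSpace ℝ (Fin d) → ℝ) (w : ℝ × EuclideanSpace ℝ (Fin d) → ℝ) : Prop where
  measurable : Measurable w
  mem_Icc : ∀ p, w p ∈ Icc (-M) M
  entropy : ∀ k ∈ Icc (-M) M, ∀ φ : ℝ × EuclideanSpace ℝ (Fin d) → ℝ,
    ContDiff ℝ ∞ φ → HasCompactSupport φ → (∀ p, 0 ≤ φ p) → (∀ p, T₀ ≤ p.1 → φ p = 0) →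
    tsupport φ ⊆ {p | p.1 < T₀} →
    0 ≤ ∫ p in strip d (T₀ : EReal),
      fderiv ℝ φ p (|w p - k| - |u₀ p.2 - k|, Real.sign (w p - k) • (F (w p) - F k))

lemma clm_prod_eq (l : ℝ × EuclideanSpace ℝ (Fin d) →L[ℝ] ℝ) (a : ℝ)
    (v : EuclideanSpace ℝ (Fin d)) : l (a, v) = a * l (1, 0) + l (0, v) := by
  rw [← smul_eq_mul, ← map_smul, ← map_add]
  simp

lemma clm_prod_smul (l : ℝ × EuclideanSpace ℝ (Fin d) →L[ℝ] ℝ) (a : ℝ)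
    (v : EuclideanSpace ℝ (Fin d)) : l (0, a • v) = a * l (0, v) := by
  rw [← smul_eq_mul, ← map_smul]
  simp

lemma integrable_clm_apply {μ : Measure (ℝ × EuclideanSpace ℝ (Fin d))}
    [IsFiniteMeasureOnCompacts μ]
    {l : ℝ × EuclideanSpace ℝ (Fin d) → ℝ × EuclideanSpace ℝ (Fin d) →L[ℝ] ℝ}
    (hl : Continuous l) (hlc : HasCompactSupport l)
    {m : ℝ × EuclideanSpace ℝ (Fin d) → ℝ × EuclideanSpace ℝ (Fin d)} (hm : Measurable m) {C : ℝ}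
    (hC : ∀ p, ‖m p‖ ≤ C) : Integrable (fun p => l p (m p)) μ := by
  refine Integrable.mono' (g := fun p => ‖l p‖ * C) ?_ ?_ ?_
  · exact ((hl.integrable_of_hasCompactSupport hlc).norm).mul_const C
  · exact ((hl.comp continuous_fst).clm_apply continuous_snd).measurable.comp
      (measurable_id.prodMk hm) |>.aestronglyMeasurable
  · exact Eventually.of_forall fun p => ((l p).le_opNorm _).trans (by gcongr; exact hC p)

/-- Integration in time against a time-independent factor. -/
lemma integral_strip_time (hT₀ : 0 < T₀) {φ : ℝ × EuclideanSpace ℝ (Fin d) → ℝ}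
    (hφ : ContDiff ℝ 1 φ) (hc : HasCompactSupport φ) (h0 : ∀ p, T₀ ≤ p.1 → φ p = 0)
    {g : EuclideanSpace ℝ (Fin d) → ℝ} (hg : Continuous g) :
    ∫ p in strip d (T₀ : EReal), g p.2 * fderiv ℝ φ p (1, 0) = - ∫ x, g x * φ (0, x) := by
  have hD : Continuous (fun p => fderiv ℝ φ p (1, 0)) :=
    (hφ.continuous_fderiv one_ne_zero).clm_apply continuous_const
  have hDc : HasCompactSupport (fun p => g p.2 * fderiv ℝ φ p (1, 0)) :=
    (hc.fderiv_apply ℝ _).mul_left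
  have hDg : Continuous (fun p : ℝ × EuclideanSpace ℝ (Fin d) => g p.2 * fderiv ℝ φ p (1, 0)) :=
    (hg.comp continuous_snd).mul hD
  have hint := (hDg.integrable_of_hasCompactSupport hDc (μ := volume)).integrableOn
    (s := Ioo 0 T₀ ×ˢ (univ : Set (EuclideanSpace ℝ (Fin d))))
  rw [strip_coe, Measure.volume_eq_prod, ← Measure.prod_restrict, Measure.restrict_univ]
  rw [IntegrableOn, Measure.volume_eq_prod, ← Measure.prod_restrict, Measure.restrict_univ] at hint
  rw [integral_prod_symm _ hint, ← integral_neg]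
  congr 1
  ext x
  have hder : ∀ t, HasDerivAt (fun t => φ (t, x)) (fderiv ℝ φ (t, x) (1, 0)) t := by
    intro t
    have h1 : HasDerivAt (fun t : ℝ => (t, x)) ((1 : ℝ), (0 : EuclideanSpace ℝ (Fin d))) t :=
      (hasDerivAt_id t).prodMk (hasDerivAt_const t x)
    exact (hφ.differentiable one_ne_zero (t, x)).hasFDerivAt.comp_hasDerivAt t h1
  simp only
  rw [integral_const_mul, ← integral_Ioc_eq_integral_Ioo,
    ← intervalIntegral.integral_of_le hT₀.le,
    intervalIntegral.integral_eq_sub_of_hasDerivAt (fun t _ => hder t)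
      (Continuous.intervalIntegrable (hD.comp (by fun_prop)) _ _), h0 (T₀, x) le_rfl, zero_sub,
    mul_neg]

lemma measurable_sign : Measurable Real.sign := by
  have : Real.sign = fun r : ℝ => if r < 0 then -1 else if 0 < r then 1 else 0 := by
    funext r; rfl
  rw [this]
  exact Measurable.ite measurableSet_Iio measurable_const
    (Measurable.ite measurableSet_Ioi measurable_const measurable_const)

/-- A continuous extension of the flux. -/
noncomputable def fluxExt (F : ℝ → EuclideanSpace ℝ (Fin d)) (M : ℝ) (v : ℝ) :
    EuclideanSpace ℝ (Fin d) :=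
  F (max (-M) (min M v))

lemma fluxExt_of_mem {v : ℝ} (hv : v ∈ Icc (-M) M) : fluxExt F M v = F v := by
  rw [fluxExt, min_eq_right hv.2, max_eq_right hv.1]

lemma clamp_mem (hM : 0 < M) (v : ℝ) : max (-M) (min M v) ∈ Icc (-M) M :=
  ⟨le_max_left _ _, max_le (by linarith) (min_le_left _ _)⟩

lemma continuous_fluxExt (hM : 0 < M) (hF : ContinuousOn F (Icc (-M) M)) :
    Continuous (fluxExt F M) :=
  hF.comp_continuous (by fun_prop) (clamp_mem hM)

lemma abs_sign_le (r : ℝ) : |Real.sign r| ≤ 1 := by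
  rcases Real.sign_apply_eq r with h | h | h <;> simp [h]

/-- An entropy solution has a representative that is measurable with values in `[-M,M]`. -/
lemma IsEntropySolution.exists_isEntropyPair (hM : 0 < M) (hT₀ : 0 < T₀)
    (hF : ContinuousOn F (Icc (-M) M))
    {u₀ : EuclideanSpace ℝ (Fin d) → ℝ} (hu₀ : Continuous u₀)
    {w : ℝ → EuclideanSpace ℝ (Fin d) → ℝ} (h : IsEntropySolution F M (T₀ : EReal) u₀ w) :
    ∃ w₁, IsEntropyPair F M T₀ u₀ w₁ ∧
      Function.uncurry w =ᵐ[volume.restrict (strip d (T₀ : EReal))] w₁ := by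
  set w₁ : ℝ × EuclideanSpace ℝ (Fin d) → ℝ :=
    fun p => max (-M) (min M (h.aestronglyMeasurable.mk _ p)) with hw₁
  have hae : Function.uncurry w =ᵐ[volume.restrict (strip d (T₀ : EReal))] w₁ := by
    filter_upwards [h.aestronglyMeasurable.ae_eq_mk, h.mem_Icc] with p hp hm
    rw [hw₁]
    simp only
    rw [← hp, min_eq_right hm.2, max_eq_right hm.1]
  have hmeas : Measurable w₁ := by
    have := h.aestronglyMeasurable.stronglyMeasurable_mk.measurable
    fun_prop
  refine ⟨w₁, ⟨hmeas, fun p => clamp_mem hM _, fun k hk φ hφ hφc hφ0 h0 hφT => ?_⟩, hae⟩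
  have h1 := h.entropy k hk φ hφ hφc hφ0 fun p hp => by
    have := hφT hp
    simpa using this
  have hφ1 : ContDiff ℝ 1 φ := hφ.of_le (WithTop.coe_le_coe.mpr le_top)
  have hDφ : Continuous (fderiv ℝ φ) := hφ1.continuous_fderiv one_ne_zero
  have hg : Continuous fun x => |u₀ x - k| := by fun_prop
  -- The initial term becomes an integral over the strip, since φ vanishes from T₀ on. The whole
  -- inequality is then a single linear expression in the derivative of φ.
  have h2 := integral_strip_time hT₀ hφ1 hφc h0 hg
  rw [← sub_eq_zero, sub_neg_eq_add] at h2
  have h3 : ∫ x, |u₀ x - k| * φ (0, x) =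
      -∫ p in strip d (T₀ : EReal), |u₀ p.2 - k| * fderiv ℝ φ p (1, 0) := by linarith
  have hFe := continuous_fluxExt hM hF
  have hFw : ∀ p, F (w₁ p) = fluxExt F M (w₁ p) := fun p => (fluxExt_of_mem (clamp_mem hM _)).symm
  obtain ⟨C, hC⟩ := isCompact_Icc.exists_bound_of_continuousOn hF
  have hFm : Measurable fun p => F (w₁ p) - F k := by
    simp only [hFw]
    exact (hFe.measurable.comp hmeas).sub_const _
  have hI : IntegrableOn (fun p => fderiv ℝ φ p
      (|w₁ p - k|, Real.sign (w₁ p - k) • (F (w₁ p) - F k))) (strip d (T₀ : EReal)) := by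
    refine integrable_clm_apply (C := max (2 * M) (C + C)) hDφ (hφc.fderiv ℝ) ?_ fun p => ?_
    · exact (hmeas.sub_const k).abs.prodMk ((measurable_sign.comp (hmeas.sub_const k)).smul hFm)
    · have hm := clamp_mem hM (h.aestronglyMeasurable.mk _ p)
      refine max_le_max ?_ ?_
      · rw [Real.norm_eq_abs, abs_abs, abs_le]
        constructor <;> linarith [hm.1, hm.2, hk.1, hk.2]
      · rw [norm_smul, Real.norm_eq_abs]
        refine (mul_le_of_le_one_left (norm_nonneg _) (abs_sign_le _)).trans ?_
        exact (norm_sub_le _ _).trans (add_le_add (hC _ hm) (hC _ hk))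
  have hJ : IntegrableOn (fun p : ℝ × EuclideanSpace ℝ (Fin d) =>
      |u₀ p.2 - k| * fderiv ℝ φ p (1, 0)) (strip d (T₀ : EReal)) := by
    refine Integrable.integrableOn (Continuous.integrable_of_hasCompactSupport ?_ ?_)
    · exact (hg.comp continuous_snd).mul (hDφ.clm_apply continuous_const)
    · exact (hφc.fderiv_apply ℝ _).mul_left
  have h4 : ∫ p in strip d (T₀ : EReal), (|w p.1 p.2 - k| * fderiv ℝ φ p (1, 0) +
      Real.sign (w p.1 p.2 - k) * fderiv ℝ φ p (0, F (w p.1 p.2) - F k)) =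
      ∫ p in strip d (T₀ : EReal), fderiv ℝ φ p
        (|w₁ p - k|, Real.sign (w₁ p - k) • (F (w₁ p) - F k)) := by
    refine integral_congr_ae ?_
    filter_upwards [hae] with p hp
    have hp' : w p.1 p.2 = w₁ p := hp
    simp only [hp']
    rw [clm_prod_eq _ |w₁ p - k|, clm_prod_smul]
  rw [h4, h3, ← sub_eq_add_neg, ← integral_sub hI hJ] at h1
  refine h1.trans_eq ?_
  congr 1
  funext p
  rw [clm_prod_eq _ |w₁ p - k|, clm_prod_eq _ (|w₁ p - k| - _)]
  ring

variable {u₀ : EuclideanSpace ℝ (Fin d) → ℝ} {w : ℝ × EuclideanSpace ℝ (Fin d) → ℝ}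

lemma IsEntropyPair.measurable_flux (h : IsEntropyPair F M T₀ u₀ w) (hM : 0 < M)
    (hF : ContinuousOn F (Icc (-M) M)) : Measurable fun p => F (w p) := by
  have : (fun p => F (w p)) = fun p => fluxExt F M (w p) :=
    funext fun p => (fluxExt_of_mem (h.mem_Icc p)).symm
  rw [this]
  exact (continuous_fluxExt hM hF).measurable.comp h.measurable

/-- The weak formulation. -/
lemma IsEntropyPair.weak (h : IsEntropyPair F M T₀ u₀ w) (hM : 0 < M)
    (hF : ContinuousOn F (Icc (-M) M)) (hu₀ : Continuous u₀) (hu₀m : ∀ x, u₀ x ∈ Icc (-M) M)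
    {φ : ℝ × EuclideanSpace ℝ (Fin d) → ℝ} (hφ : ContDiff ℝ ∞ φ) (hφc : HasCompactSupport φ)
    (hφ0 : ∀ p, 0 ≤ φ p) (h0 : ∀ p, T₀ ≤ p.1 → φ p = 0) (hφT : tsupport φ ⊆ {p | p.1 < T₀}) :
    ∫ p in strip d (T₀ : EReal), fderiv ℝ φ p (w p - u₀ p.2, F (w p)) = 0 := by
  have hφ1 : ContDiff ℝ 1 φ := hφ.of_le (WithTop.coe_le_coe.mpr le_top)
  have hDφ : Continuous (fderiv ℝ φ) := hφ1.continuous_fderiv one_ne_zero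
  obtain ⟨C, hC⟩ := isCompact_Icc.exists_bound_of_continuousOn hF
  have hI : IntegrableOn (fun p => fderiv ℝ φ p (w p - u₀ p.2, F (w p)))
      (strip d (T₀ : EReal)) := by
    refine integrable_clm_apply (C := max (2 * M) C) hDφ (hφc.fderiv ℝ) ?_ fun p => ?_
    · exact (h.measurable.sub (hu₀.measurable.comp measurable_snd)).prodMk (h.measurable_flux hM hF)
    · refine max_le_max ?_ (hC _ (h.mem_Icc p))
      have h1 := h.mem_Icc p
      have h2 := hu₀m p.2
      rw [Real.norm_eq_abs, abs_le]
      constructor <;> linarith [h1.1, h1.2, h2.1, h2.2]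
  have hconst : ∀ e : EuclideanSpace ℝ (Fin d), IntegrableOn (fun p => fderiv ℝ φ p (0, e))
      (strip d (T₀ : EReal)) := fun e =>
    ((hDφ.clm_apply continuous_const).integrable_of_hasCompactSupport
      (hφc.fderiv_apply ℝ _)).integrableOn
  have hz := fun e => integral_strip_fderiv_space (T₀ := T₀) hφ1 hφc e
  -- On [-M,M] the functions |w+M| and |w-M| are affine with opposite slopes, so the two extreme
  -- values of k give opposite inequalities.
  have hlo := h.entropy (-M) ⟨le_rfl, by linarith⟩ φ hφ hφc hφ0 h0 hφT
  have hhi := h.entropy M ⟨by linarith, le_rfl⟩ φ hφ hφc hφ0 h0 hφT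
  have e1 : ∀ p, fderiv ℝ φ p (|w p - -M| - |u₀ p.2 - -M|,
      Real.sign (w p - -M) • (F (w p) - F (-M))) =
      fderiv ℝ φ p (w p - u₀ p.2, F (w p)) - fderiv ℝ φ p (0, F (-M)) := by
    intro p
    have h1 := h.mem_Icc p
    have h2 := hu₀m p.2
    rw [abs_of_nonneg (show 0 ≤ w p - -M by linarith [h1.1]),
      abs_of_nonneg (show 0 ≤ u₀ p.2 - -M by linarith [h2.1]), ← map_sub]
    congr 1
    refine Prod.ext (by simp) ?_
    rcases h1.1.eq_or_lt with h3 | h3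
    · simp [← h3]
    · simp only [Real.sign_of_pos (show 0 < w p - -M by linarith), one_smul, Prod.snd_sub]
  have e2 : ∀ p, fderiv ℝ φ p (|w p - M| - |u₀ p.2 - M|,
      Real.sign (w p - M) • (F (w p) - F M)) =
      fderiv ℝ φ p (0, F M) - fderiv ℝ φ p (w p - u₀ p.2, F (w p)) := by
    intro p
    have h1 := h.mem_Icc p
    have h2 := hu₀m p.2
    rw [abs_of_nonpos (show w p - M ≤ 0 by linarith [h1.2]),
      abs_of_nonpos (show u₀ p.2 - M ≤ 0 by linarith [h2.2]), ← map_sub]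
    congr 1
    refine Prod.ext (by simp) ?_
    rcases h1.2.eq_or_lt with h3 | h3
    · simp [h3]
    · simp only [Real.sign_of_neg (show w p - M < 0 by linarith), neg_one_smul, neg_sub,
        Prod.snd_sub]
  simp only [e1] at hlo
  simp only [e2] at hhi
  rw [integral_sub hI (hconst _), hz, sub_zero] at hlo
  rw [integral_sub (hconst _) hI, hz, zero_sub] at hhi
  linarith

end Uniqueness

end ScalarLaw

namespace ScalarLaw

/-! ### The quadratic entropy as an average of Kruzhkov entropies -/

section Uniqueness

variable {d : ℕ} {F : ℝ → EuclideanSpace ℝ (Fin d)} {M T₀ : ℝ}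
  {U : ℝ × EuclideanSpace ℝ (Fin d) → ℝ}
  {u₀ : EuclideanSpace ℝ (Fin d) → ℝ} {w : ℝ × EuclideanSpace ℝ (Fin d) → ℝ}

/-- A primitive of the flux. -/
noncomputable def fluxPrim (F : ℝ → EuclideanSpace ℝ (Fin d)) (M : ℝ) (x : ℝ) :
    EuclideanSpace ℝ (Fin d) :=
  ∫ k in (0 : ℝ)..x, fluxExt F M k

lemma integral_abs_sub {c : ℝ} (hc : c ∈ Icc (-M) M) :
    ∫ k in Icc (-M) M, |c - k| = c ^ 2 + M ^ 2 := by
  have hle : -M ≤ M := hc.1.trans hc.2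
  have hi : ∀ a b : ℝ, IntervalIntegrable (fun k => |c - k|) volume a b := fun a b =>
    (by fun_prop : Continuous fun k => |c - k|).intervalIntegrable a b
  rw [integral_Icc_eq_integral_Ioc, ← intervalIntegral.integral_of_le hle,
    ← intervalIntegral.integral_add_adjacent_intervals (hi (-M) c) (hi c M)]
  have h1 : ∫ k in (-M)..c, |c - k| = ∫ k in (-M)..c, (c - k) := by
    refine intervalIntegral.integral_congr fun k hk => ?_
    rw [uIcc_of_le hc.1] at hk
    exact abs_of_nonneg (by linarith [hk.2])
  have h2 : ∫ k in c..M, |c - k| = ∫ k in c..M, (k - c) := by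
    refine intervalIntegral.integral_congr fun k hk => ?_
    rw [uIcc_of_le hc.2] at hk
    rw [abs_of_nonpos (by linarith [hk.1]), neg_sub]
  rw [h1, h2, intervalIntegral.integral_sub (by simp) (by simp),
    intervalIntegral.integral_sub (by simp) (by simp)]
  simp only [intervalIntegral.integral_const, integral_id, smul_eq_mul]
  ring

/-- Averaging the Kruzhkov fluxes over k gives 2cF(c) - 2∫F, the entropy flux belonging to c², up to
a constant vector. The matching average of |c-k| is c² + M². -/
lemma integral_sign_smul (hM : 0 < M) (hF : ContinuousOn F (Icc (-M) M)) {c : ℝ}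
    (hc : c ∈ Icc (-M) M) :
    ∫ k in Icc (-M) M, Real.sign (c - k) • (fluxExt F M c - fluxExt F M k) =
      (2 * c) • fluxExt F M c - (2 : ℝ) • fluxPrim F M c +
        (fluxPrim F M M + fluxPrim F M (-M)) := by
  have hFe := continuous_fluxExt hM hF
  have hle : -M ≤ M := hc.1.trans hc.2
  have hiF : ∀ a b : ℝ, IntervalIntegrable (fluxExt F M) volume a b := fun a b =>
    hFe.intervalIntegrable a b
  have h1 : EqOn (fun k => Real.sign (c - k) • (fluxExt F M c - fluxExt F M k))
      (fun k => fluxExt F M c - fluxExt F M k) (uIcc (-M) c) := by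
    intro k hk
    rw [uIcc_of_le hc.1] at hk
    rcases hk.2.eq_or_lt with h | h
    · simp [h]
    · simp only [Real.sign_of_pos (sub_pos.mpr h), one_smul]
  have h2 : EqOn (fun k => Real.sign (c - k) • (fluxExt F M c - fluxExt F M k))
      (fun k => fluxExt F M k - fluxExt F M c) (uIcc c M) := by
    intro k hk
    rw [uIcc_of_le hc.2] at hk
    rcases hk.1.eq_or_lt with h | h
    · simp [h]
    · simp only [Real.sign_of_neg (sub_neg.mpr h), neg_one_smul, neg_sub]
  have i1 : IntervalIntegrable (fun k => Real.sign (c - k) • (fluxExt F M c - fluxExt F M k))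
      volume (-M) c :=
    ((intervalIntegrable_const (c := fluxExt F M c)).sub (hiF _ _)).congr
      fun k hk => (h1 (uIoc_subset_uIcc hk)).symm
  have i2 : IntervalIntegrable (fun k => Real.sign (c - k) • (fluxExt F M c - fluxExt F M k))
      volume c M :=
    ((hiF _ _).sub (intervalIntegrable_const (c := fluxExt F M c))).congr
      fun k hk => (h2 (uIoc_subset_uIcc hk)).symm
  rw [integral_Icc_eq_integral_Ioc, ← intervalIntegral.integral_of_le hle,
    ← intervalIntegral.integral_add_adjacent_intervals i1 i2,
    intervalIntegral.integral_congr h1, intervalIntegral.integral_congr h2,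
    intervalIntegral.integral_sub (by simp) (hiF _ _),
    intervalIntegral.integral_sub (hiF _ _) (by simp),
    ← intervalIntegral.integral_interval_sub_left (hiF 0 c) (hiF 0 (-M)),
    ← intervalIntegral.integral_interval_sub_left (hiF 0 M) (hiF 0 c)]
  simp only [intervalIntegral.integral_const, fluxPrim]
  module

/-- The entropy inequality for the quadratic entropy. -/
lemma IsEntropyPair.quadratic (h : IsEntropyPair F M T₀ u₀ w) (hM : 0 < M)
    (hF : ContinuousOn F (Icc (-M) M)) (hu₀ : Continuous u₀) (hu₀m : ∀ x, u₀ x ∈ Icc (-M) M)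
    {φ : ℝ × EuclideanSpace ℝ (Fin d) → ℝ} (hφ : ContDiff ℝ ∞ φ) (hφc : HasCompactSupport φ)
    (hφ0 : ∀ p, 0 ≤ φ p) (h0 : ∀ p, T₀ ≤ p.1 → φ p = 0) (hφT : tsupport φ ⊆ {p | p.1 < T₀}) :
    0 ≤ ∫ p in strip d (T₀ : EReal), fderiv ℝ φ p (w p ^ 2 - u₀ p.2 ^ 2,
      (2 * w p) • F (w p) - (2 : ℝ) • fluxPrim F M (w p)) := by
  have hφ1 : ContDiff ℝ 1 φ := hφ.of_le (WithTop.coe_le_coe.mpr le_top)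
  have hDφ : Continuous (fderiv ℝ φ) := hφ1.continuous_fderiv one_ne_zero
  have hFe := continuous_fluxExt hM hF
  obtain ⟨C, hC⟩ := isCompact_Icc.exists_bound_of_continuousOn hF
  have hCe : ∀ v, ‖fluxExt F M v‖ ≤ C := fun v => hC _ (clamp_mem hM v)
  set m : (ℝ × EuclideanSpace ℝ (Fin d)) → ℝ → ℝ × EuclideanSpace ℝ (Fin d) := fun p k =>
    (|w p - k| - |u₀ p.2 - k|, Real.sign (w p - k) • (fluxExt F M (w p) - fluxExt F M k)) with hm
  have hwm := h.measurable
  have hmm : Measurable (Function.uncurry m) := by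
    have hw' : Measurable fun q : (ℝ × EuclideanSpace ℝ (Fin d)) × ℝ => w q.1 - q.2 :=
      (hwm.comp measurable_fst).sub measurable_snd
    have hu' : Measurable fun q : (ℝ × EuclideanSpace ℝ (Fin d)) × ℝ => u₀ q.1.2 - q.2 :=
      (hu₀.measurable.comp (measurable_snd.comp measurable_fst)).sub measurable_snd
    have hFw : Measurable fun q : (ℝ × EuclideanSpace ℝ (Fin d)) × ℝ =>
        fluxExt F M (w q.1) - fluxExt F M q.2 :=
      (hFe.measurable.comp (hwm.comp measurable_fst)).sub (hFe.measurable.comp measurable_snd)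
    exact (hw'.abs.sub hu'.abs).prodMk ((measurable_sign.comp hw').smul hFw)
  have hmb : ∀ p k, ‖m p k‖ ≤ max (2 * M) (C + C) := by
    intro p k
    refine max_le_max ?_ ?_
    · have h1 := h.mem_Icc p
      have h2 := hu₀m p.2
      rw [Real.norm_eq_abs]
      refine (abs_abs_sub_abs_le_abs_sub _ _).trans ?_
      rw [abs_le]
      constructor <;> linarith [h1.1, h1.2, h2.1, h2.2]
    · rw [norm_smul, Real.norm_eq_abs]
      refine (mul_le_of_le_one_left (norm_nonneg _) (abs_sign_le _)).trans ?_
      exact (norm_sub_le _ _).trans (add_le_add (hCe _) (hCe _))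
  set μ : Measure (ℝ × EuclideanSpace ℝ (Fin d)) := volume.restrict (strip d (T₀ : EReal)) with hμ
  set ν : Measure ℝ := volume.restrict (Icc (-M) M) with hν
  have hfi : Integrable (Function.uncurry fun p k => fderiv ℝ φ p (m p k)) (μ.prod ν) := by
    refine Integrable.mono' (g := fun q => ‖fderiv ℝ φ q.1‖ * max (2 * M) (C + C)) ?_ ?_ ?_
    · have hi : Integrable (fun p => ‖fderiv ℝ φ p‖ * max (2 * M) (C + C)) μ :=
        ((hDφ.integrable_of_hasCompactSupport (hφc.fderiv ℝ)).norm.mul_const _).integrableOn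
      exact hi.comp_fst ν
    · exact (((hDφ.comp continuous_fst).clm_apply continuous_snd).measurable.comp
        (measurable_fst.prodMk hmm)).aestronglyMeasurable
    · exact Eventually.of_forall fun q => ((fderiv ℝ φ q.1).le_opNorm _).trans
        (by gcongr; exact hmb _ _)
  -- The inequalities are integrated over k and the order is exchanged. The constant M² cancels
  -- between w and the datum, and the constant flux integrates to zero against the spatial gradient.
  have hnonneg : 0 ≤ ∫ k, ∫ p, fderiv ℝ φ p (m p k) ∂μ ∂ν := by
    refine setIntegral_nonneg measurableSet_Icc fun k hk => ?_
    have := h.entropy k hk φ hφ hφc hφ0 h0 hφT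
    refine this.trans_eq ?_
    congr 1
    funext p
    rw [hm]
    simp only
    rw [fluxExt_of_mem (h.mem_Icc p), fluxExt_of_mem hk]
  rw [← integral_integral_swap hfi] at hnonneg
  have hin : ∀ p, ∫ k, fderiv ℝ φ p (m p k) ∂ν = fderiv ℝ φ p (w p ^ 2 - u₀ p.2 ^ 2,
      (2 * w p) • F (w p) - (2 : ℝ) • fluxPrim F M (w p)) +
      fderiv ℝ φ p (0, fluxPrim F M M + fluxPrim F M (-M)) := by
    intro p
    have i0 : Integrable (m p) ν := by
      refine Integrable.mono' (g := fun _ => max (2 * M) (C + C)) (integrable_const _) ?_ ?_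
      · exact (hmm.comp measurable_prodMk_left).aestronglyMeasurable
      · exact Eventually.of_forall fun k => hmb p k
    rw [ContinuousLinearMap.integral_comp_comm _ i0, ← map_add]
    congr 1
    have ha : ∀ c : ℝ, Integrable (fun k => |c - k|) ν := fun c =>
      (by fun_prop : Continuous fun k => |c - k|).continuousOn.integrableOn_Icc
    rw [hm]
    simp only
    rw [integral_pair i0.fst i0.snd, integral_sub (ha _) (ha _), integral_abs_sub (h.mem_Icc p),
      integral_abs_sub (hu₀m p.2), integral_sign_smul hM hF (h.mem_Icc p),
      fluxExt_of_mem (h.mem_Icc p)]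
    simp
  simp only [hin] at hnonneg
  rw [integral_add, integral_strip_fderiv_space hφ1 hφc, add_zero] at hnonneg
  · exact hnonneg
  · have hi := hfi.integral_prod_left
    simp only [Function.uncurry, hin] at hi
    refine (hi.sub (g := fun p => fderiv ℝ φ p (0, fluxPrim F M M + fluxPrim F M (-M))) ?_).congr ?_
    · exact ((hDφ.clm_apply continuous_const).integrable_of_hasCompactSupport
        (hφc.fderiv_apply ℝ _)).integrableOn
    · exact Eventually.of_forall fun p => by simp
  · exact ((hDφ.clm_apply continuous_const).integrable_of_hasCompactSupport
      (hφc.fderiv_apply ℝ _)).integrableOn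

end Uniqueness

end ScalarLaw

namespace ScalarLaw

/-! ### The relative entropy inequality -/

section Uniqueness

variable {d : ℕ} {F : ℝ → EuclideanSpace ℝ (Fin d)} {M T₀ : ℝ}
  {U : ℝ × EuclideanSpace ℝ (Fin d) → ℝ}
  {w : ℝ × EuclideanSpace ℝ (Fin d) → ℝ}

lemma hasDerivAt_fluxPrim (hM : 0 < M) (hF : ContinuousOn F (Icc (-M) M)) (x : ℝ) :
    HasDerivAt (fluxPrim F M) (fluxExt F M x) x :=
  ((continuous_fluxExt hM hF).integral_hasStrictDerivAt 0 x).hasDerivAt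

/-- The integrand of the relative entropy inequality. -/
noncomputable def relEntropy (F : ℝ → EuclideanSpace ℝ (Fin d)) (M : ℝ)
    (U w φ : ℝ × EuclideanSpace ℝ (Fin d) → ℝ) (p : ℝ × EuclideanSpace ℝ (Fin d)) : ℝ :=
  (w p - U p) ^ 2 * fderiv ℝ φ p (1, 0) -
    2 * φ p * fderiv ℝ U p (0, F (w p) - F (U p) - (w p - U p) • velocity F M (U p)) +
    fderiv ℝ φ p (0, (2 * (w p - U p)) • F (w p) - (2 : ℝ) • (fluxPrim F M (w p) - fluxPrim F M (U p)))

/-- Expand (w-U)² = w² - 2wU + U²: the first term obeys the quadratic entropy inequality, the second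
the weak formulation tested with Uφ, the third the chain rule for the smooth U. The weak formulation
is available only for nonnegative test functions, so (U+M)φ is used and M times the identity for φ
is subtracted. -/
lemma IsEntropyPair.relative (hM : 0 < M) (hT₀ : 0 < T₀) (hF : ContDiffOn ℝ ∞ F (Icc (-M) M))
    (hU : IsClassicalSolution F M T₀ U) (h : IsEntropyPair F M T₀ (fun x => U (0, x)) w)
    {φ : ℝ × EuclideanSpace ℝ (Fin d) → ℝ} (hφ : ContDiff ℝ ∞ φ) (hφc : HasCompactSupport φ)
    (hφ0 : ∀ p, 0 ≤ φ p) (h0 : ∀ p, T₀ ≤ p.1 → φ p = 0) (hφT : tsupport φ ⊆ {p | p.1 < T₀}) :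
    IntegrableOn (relEntropy F M U w φ) (strip d (T₀ : EReal)) ∧
      0 ≤ ∫ p in strip d (T₀ : EReal), relEntropy F M U w φ p := by
  have hFc := hF.continuousOn
  have hφ1 : ContDiff ℝ 1 φ := hφ.of_le (WithTop.coe_le_coe.mpr le_top)
  have hU1 : ContDiff ℝ 1 U := hU.contDiff.of_le (WithTop.coe_le_coe.mpr le_top)
  have hDφ : Continuous (fderiv ℝ φ) := hφ1.continuous_fderiv one_ne_zero
  have hFe := continuous_fluxExt hM hFc
  have hUc := hU1.continuous
  have hu₀ : Continuous fun x : EuclideanSpace ℝ (Fin d) => U (0, x) := by fun_prop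
  have hu₀m : ∀ x : EuclideanSpace ℝ (Fin d), U (0, x) ∈ Icc (-M) M := fun x => hU.mem_Icc _
  have hPd := hasDerivAt_fluxPrim hM hFc
  have hPc : Continuous (fluxPrim F M) := continuous_iff_continuousAt.mpr fun x => (hPd x).continuousAt
  -- the test function `(U + M) φ`
  set ψ : ℝ × EuclideanSpace ℝ (Fin d) → ℝ := fun p => (U p + M) * φ p with hψdef
  have hψ : ContDiff ℝ ∞ ψ := (hU.contDiff.add contDiff_const).mul hφ
  have hψ1 : ContDiff ℝ 1 ψ := hψ.of_le (WithTop.coe_le_coe.mpr le_top)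
  have hψc : HasCompactSupport ψ := hφc.mul_left
  have hψ0 : ∀ p, 0 ≤ ψ p := fun p => mul_nonneg (by linarith [(hU.mem_Icc p).1]) (hφ0 p)
  have hψT0 : ∀ p, T₀ ≤ p.1 → ψ p = 0 := fun p hp => by simp [hψdef, h0 p hp]
  have hψT : tsupport ψ ⊆ {p | p.1 < T₀} := (tsupport_mul_subset_right).trans hφT
  set Ψ : ℝ × EuclideanSpace ℝ (Fin d) → ℝ := fun p => U p ^ 2 * φ p with hΨdef
  have hΨ1 : ContDiff ℝ 1 Ψ := (hU1.pow 2).mul hφ1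
  have hΨc : HasCompactSupport Ψ := hφc.mul_left
  -- derivatives
  have hdU : ∀ p, HasFDerivAt U (fderiv ℝ U p) p := fun p =>
    (hU1.differentiable one_ne_zero p).hasFDerivAt
  have hdφ : ∀ p, HasFDerivAt φ (fderiv ℝ φ p) p := fun p =>
    (hφ1.differentiable one_ne_zero p).hasFDerivAt
  have hdψ : ∀ p v, fderiv ℝ ψ p v = (U p + M) * fderiv ℝ φ p v + φ p * fderiv ℝ U p v := by
    intro p v
    have h2 : fderiv ℝ ψ p = _ := (((hdU p).add_const M).mul (hdφ p)).fderiv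
    rw [h2]
    simp
  have hdΨ : ∀ p v, fderiv ℝ Ψ p v = U p ^ 2 * fderiv ℝ φ p v +
      φ p * (2 * U p * fderiv ℝ U p v) := by
    intro p v
    have h2 : fderiv ℝ Ψ p = _ := (((hdU p).pow 2).mul (hdφ p)).fderiv
    rw [h2]
    simp
  -- the pieces
  set A : ℝ × EuclideanSpace ℝ (Fin d) → ℝ := fun p => fderiv ℝ φ p (w p ^ 2 - U (0, p.2) ^ 2,
      (2 * w p) • F (w p) - (2 : ℝ) • fluxPrim F M (w p)) with hA
  set W₁ : ℝ × EuclideanSpace ℝ (Fin d) → ℝ := fun p =>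
    fderiv ℝ ψ p (w p - U (0, p.2), F (w p)) with hW₁
  set W₂ : ℝ × EuclideanSpace ℝ (Fin d) → ℝ := fun p =>
    fderiv ℝ φ p (w p - U (0, p.2), F (w p)) with hW₂
  set T : ℝ × EuclideanSpace ℝ (Fin d) → ℝ := fun p => fderiv ℝ Ψ p (1, 0) with hT
  set B : ℝ × EuclideanSpace ℝ (Fin d) → ℝ := fun p =>
    fderiv ℝ φ p (0, (2 : ℝ) • fluxPrim F M (U p)) +
      φ p * fderiv ℝ U p (0, (2 : ℝ) • fluxExt F M (U p)) with hB
  set V₁ : ℝ × EuclideanSpace ℝ (Fin d) → ℝ := fun p => U (0, p.2) ^ 2 * fderiv ℝ φ p (1, 0) with hV₁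
  set V₂ : ℝ × EuclideanSpace ℝ (Fin d) → ℝ := fun p => U (0, p.2) * fderiv ℝ ψ p (1, 0) with hV₂
  set V₃ : ℝ × EuclideanSpace ℝ (Fin d) → ℝ := fun p => U (0, p.2) * fderiv ℝ φ p (1, 0) with hV₃
  -- `T` and `B` contribute the terms in U² and in the primitive of the flux at U. The terms `V₁`,
  -- `V₂`, `V₃` restore the initial values subtracted in `A`, `W₁`, `W₂`; together with `T` their
  -- integrals cancel.
  have eG : ∀ p ∈ strip d (T₀ : EReal), A p - 2 * W₁ p + 2 * M * W₂ p + T p + B p + V₁ p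
      - 2 * V₂ p + 2 * M * V₃ p = relEntropy F M U w φ p := by
    intro p hp
    have hlin : ∀ (l : ℝ × EuclideanSpace ℝ (Fin d) →L[ℝ] ℝ) (v w : EuclideanSpace ℝ (Fin d)),
        l (0, v - w) = l (0, v) - l (0, w) := by
      intro l v w
      rw [← map_sub]
      simp
    simp only [hA, hW₁, hW₂, hT, hB, hV₁, hV₂, hV₃, relEntropy, hdψ, hdΨ]
    rw [clm_prod_eq _ (w p ^ 2 - _), clm_prod_eq (fderiv ℝ φ p) (w p - _),
      clm_prod_eq (fderiv ℝ U p) (w p - _), fluxExt_of_mem (hU.mem_Icc p)]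
    simp only [hlin, clm_prod_smul, hU.fderiv_time hp]
    ring
  -- integrability
  obtain ⟨C, hC⟩ := isCompact_Icc.exists_bound_of_continuousOn hFc
  obtain ⟨C', hC'⟩ := (isCompact_Icc (a := -M) (b := M)).exists_bound_of_continuousOn
    hPc.continuousOn
  have hwm := h.measurable
  have hFw := h.measurable_flux hM hFc
  have hu₀2 : Measurable fun p : ℝ × EuclideanSpace ℝ (Fin d) => U (0, p.2) := by
    have : Continuous fun p : ℝ × EuclideanSpace ℝ (Fin d) => U (0, p.2) := by fun_prop
    exact this.measurable
  have habs : ∀ p, |w p| ≤ M := fun p => abs_le.mpr (h.mem_Icc p)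
  have habs0 : ∀ p : ℝ × EuclideanSpace ℝ (Fin d), |U (0, p.2)| ≤ M :=
    fun p => abs_le.mpr (hU.mem_Icc _)
  have iA : IntegrableOn A (strip d (T₀ : EReal)) := by
    refine integrable_clm_apply (C := max (M ^ 2 + M ^ 2) (2 * M * C + 2 * C')) hDφ
      (hφc.fderiv ℝ) ?_ fun p => ?_
    · exact ((hwm.pow_const 2).sub (hu₀2.pow_const 2)).prodMk
        (((hwm.const_mul 2).smul hFw).sub ((hPc.measurable.comp hwm).const_smul (2 : ℝ)))
    · refine max_le_max ?_ ?_
      · refine (norm_sub_le _ _).trans ?_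
        rw [norm_pow, norm_pow, Real.norm_eq_abs, Real.norm_eq_abs]
        gcongr
        · exact habs p
        · exact habs0 p
      · refine (norm_sub_le _ _).trans ?_
        rw [norm_smul, norm_smul, norm_mul, Real.norm_eq_abs, Real.norm_eq_abs, abs_two]
        have := habs p
        gcongr
        · exact hC _ (h.mem_Icc p)
        · exact hC' _ (h.mem_Icc p)
  have hm2 : Measurable fun p => (w p - U (0, p.2), F (w p)) := (hwm.sub hu₀2).prodMk hFw
  have hm2b : ∀ p, ‖(w p - U (0, p.2), F (w p))‖ ≤ max (M + M) C := by
    intro p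
    refine max_le_max ((norm_sub_le _ _).trans (add_le_add (habs p) (habs0 p))) (hC _ (h.mem_Icc p))
  have iW₁ : IntegrableOn W₁ (strip d (T₀ : EReal)) :=
    integrable_clm_apply (hψ1.continuous_fderiv one_ne_zero) (hψc.fderiv ℝ) hm2 hm2b
  have iW₂ : IntegrableOn W₂ (strip d (T₀ : EReal)) :=
    integrable_clm_apply hDφ (hφc.fderiv ℝ) hm2 hm2b
  have iT : IntegrableOn T (strip d (T₀ : EReal)) :=
    (((hΨ1.continuous_fderiv one_ne_zero).clm_apply
      continuous_const).integrable_of_hasCompactSupport (hΨc.fderiv_apply ℝ _)).integrableOn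
  have hDU : Continuous (fderiv ℝ U) := hU1.continuous_fderiv one_ne_zero
  have iB : IntegrableOn B (strip d (T₀ : EReal)) := by
    refine Integrable.add ?_ ?_
    · refine integrable_clm_apply (C := max 0 (2 * C')) hDφ (hφc.fderiv ℝ) ?_ fun p => ?_
      · exact measurable_const.prodMk ((hPc.comp hUc).measurable.const_smul (2 : ℝ))
      · refine max_le_max (by simp) ?_
        rw [norm_smul, Real.norm_eq_abs, abs_two]
        gcongr
        exact hC' _ (hU.mem_Icc p)
    · refine Integrable.integrableOn (Continuous.integrable_of_hasCompactSupport ?_ hφc.mul_right)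
      exact hφ1.continuous.mul (hDU.clm_apply
        (continuous_const.prodMk ((hFe.comp hUc).const_smul (2 : ℝ))))
  have iV : ∀ (g : EuclideanSpace ℝ (Fin d) → ℝ), Continuous g →
      ∀ χ : ℝ × EuclideanSpace ℝ (Fin d) → ℝ, ContDiff ℝ 1 χ → HasCompactSupport χ →
      IntegrableOn (fun p => g p.2 * fderiv ℝ χ p (1, 0)) (strip d (T₀ : EReal)) := by
    intro g hg χ hχ hχc
    refine Integrable.integrableOn (Continuous.integrable_of_hasCompactSupport ?_ ?_)
    · exact (hg.comp continuous_snd).mul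
        ((hχ.continuous_fderiv one_ne_zero).clm_apply continuous_const)
    · exact (hχc.fderiv_apply ℝ _).mul_left
  have iV₁ := iV (fun x => U (0, x) ^ 2) (hu₀.pow 2) φ hφ1 hφc
  have iV₂ := iV (fun x => U (0, x)) hu₀ ψ hψ1 hψc
  have iV₃ := iV (fun x => U (0, x)) hu₀ φ hφ1 hφc
  -- values of the integrals
  have vA : 0 ≤ ∫ p in strip d (T₀ : EReal), A p :=
    h.quadratic hM hFc hu₀ hu₀m hφ hφc hφ0 h0 hφT
  have vW₁ : ∫ p in strip d (T₀ : EReal), W₁ p = 0 :=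
    h.weak hM hFc hu₀ hu₀m hψ hψc hψ0 hψT0 hψT
  have vW₂ : ∫ p in strip d (T₀ : EReal), W₂ p = 0 :=
    h.weak hM hFc hu₀ hu₀m hφ hφc hφ0 h0 hφT
  have vT : ∫ p in strip d (T₀ : EReal), T p = - ∫ x, Ψ (0, x) :=
    integral_strip_fderiv_time hT₀ hΨ1 hΨc fun p hp => by simp [hΨdef, h0 p hp]
  have vB : ∫ p in strip d (T₀ : EReal), B p = 0 :=
    integral_strip_div hU1 hU.mem_Icc (B := fun v => (2 : ℝ) • fluxPrim F M v)
      (B' := fun v => (2 : ℝ) • fluxExt F M v)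
      (fun v _ => ((hPd v).const_smul (2 : ℝ)).hasDerivWithinAt)
      ((hFe.const_smul (2 : ℝ)).continuousOn) hφ1 hφc
  have vV₁ : ∫ p in strip d (T₀ : EReal), V₁ p = - ∫ x, U (0, x) ^ 2 * φ (0, x) :=
    integral_strip_time hT₀ hφ1 hφc h0 (hu₀.pow 2)
  have vV₂ : ∫ p in strip d (T₀ : EReal), V₂ p = - ∫ x, U (0, x) * ψ (0, x) :=
    integral_strip_time hT₀ hψ1 hψc hψT0 hu₀
  have vV₃ : ∫ p in strip d (T₀ : EReal), V₃ p = - ∫ x, U (0, x) * φ (0, x) :=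
    integral_strip_time hT₀ hφ1 hφc h0 hu₀
  have hemb : Topology.IsClosedEmbedding
      (fun x : EuclideanSpace ℝ (Fin d) => ((0 : ℝ), x)) :=
    ⟨isEmbedding_prodMkRight 0, by
      have : range (fun x : EuclideanSpace ℝ (Fin d) => ((0 : ℝ), x)) = {0} ×ˢ univ := by
        ext p; rcases p with ⟨a, b⟩; simp [eq_comm]
      rw [this]; exact isClosed_singleton.prod isClosed_univ⟩
  have hφc0 := hφc.comp_isClosedEmbedding hemb
  have hφ00 : Continuous fun x : EuclideanSpace ℝ (Fin d) => φ (0, x) :=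
    hφ1.continuous.comp (by fun_prop)
  have vsum : ∫ x, U (0, x) * ψ (0, x) =
      (∫ x, U (0, x) ^ 2 * φ (0, x)) + M * ∫ x, U (0, x) * φ (0, x) := by
    rw [← integral_const_mul, ← integral_add]
    · congr 1
      funext x
      simp only [hψdef]
      ring
    · exact ((hu₀.pow 2).mul hφ00).integrable_of_hasCompactSupport hφc0.mul_left
    · exact ((hu₀.mul hφ00).integrable_of_hasCompactSupport hφc0.mul_left).const_mul M
  have j1 := iA.sub (iW₁.const_mul 2)
  have j2 := j1.add (iW₂.const_mul (2 * M))
  have j3 := j2.add iT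
  have j4 := j3.add iB
  have j5 := j4.add iV₁
  have j6 := j5.sub (iV₂.const_mul 2)
  have j7 := j6.add (iV₃.const_mul (2 * M))
  refine ⟨j7.congr ?_, ?_⟩
  · rw [Filter.EventuallyEq, ae_restrict_iff' (measurableSet_strip d T₀)]
    exact Eventually.of_forall fun p hp => eG p hp
  rw [← setIntegral_congr_fun (measurableSet_strip d T₀) eG]
  have s7 := integral_add j6 (iV₃.const_mul (2 * M))
  have s6 := integral_sub j5 (iV₂.const_mul 2)
  have s5 := integral_add j4 iV₁
  have s4 := integral_add j3 iB
  have s3 := integral_add j2 iT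
  have s2 := integral_add j1 (iW₂.const_mul (2 * M))
  have s1 := integral_sub iA (iW₁.const_mul 2)
  simp only [Pi.add_apply, Pi.sub_apply] at s7 s6 s5 s4 s3 s2 s1
  rw [integral_const_mul] at s7 s6 s2 s1
  have hΨx : ∫ x, Ψ (0, x) = ∫ x, U (0, x) ^ 2 * φ (0, x) := rfl
  have key : 0 = -(∫ x, U (0, x) ^ 2 * φ (0, x)) + -(∫ x, U (0, x) ^ 2 * φ (0, x))
      - 2 * (-(∫ x, U (0, x) * ψ (0, x))) + 2 * M * (-(∫ x, U (0, x) * φ (0, x))) := by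
    rw [vsum]; ring
  rw [hΨx] at vT
  rw [s7, s6, s5, s4, s3, s2, s1, vW₁, vW₂, vT, vB, vV₁, vV₂, vV₃]
  linarith

end Uniqueness

end ScalarLaw

namespace ScalarLaw

/-! ### Weak-strong uniqueness with a cone cut-off -/

section Uniqueness

variable {d : ℕ} {F : ℝ → EuclideanSpace ℝ (Fin d)} {M T₀ : ℝ}
  {U : ℝ × EuclideanSpace ℝ (Fin d) → ℝ}
  {w : ℝ × EuclideanSpace ℝ (Fin d) → ℝ}

/-- Both the source term and the flux of the relative entropy are quadratic in v-u, hence comparable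
with the relative entropy itself; this is what allows a Grönwall argument. -/
lemma exists_flux_taylor (hM : 0 < M) (hF : ContDiffOn ℝ ∞ F (Icc (-M) M)) :
    ∃ C : ℝ, 0 ≤ C ∧ ∀ u ∈ Icc (-M) M, ∀ v ∈ Icc (-M) M,
      ‖F v - F u - (v - u) • velocity F M u‖ ≤ C * (v - u) ^ 2 ∧
      ‖(2 * (v - u)) • F v - (2 : ℝ) • (fluxPrim F M v - fluxPrim F M u)‖ ≤
        2 * C * (v - u) ^ 2 := by
  obtain ⟨C, hC0, hC⟩ := exists_lipschitz_flux hM hF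
  refine ⟨C, hC0, fun u hu v hv => ?_⟩
  have hsub : uIcc u v ⊆ Icc (-M) M := uIcc_subset_Icc hu hv
  have hsq : |v - u| * |v - u| = (v - u) ^ 2 := by rw [← sq, sq_abs]
  constructor
  · have := (convex_uIcc u v).norm_image_sub_le_of_norm_hasDerivWithin_le
      (f := fun x => F x - x • velocity F M u) (C := C * |v - u|)
      (fun x hx => ((hasDerivWithinAt_flux hM hF (hsub hx)).mono hsub).sub
        ((hasDerivWithinAt_id x _).smul_const (velocity F M u)))
      (fun x hx => by
        rw [one_smul]
        refine (hC x (hsub hx) u hu).2.2.trans ?_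
        have : |x - u| ≤ |v - u| := abs_sub_left_of_mem_uIcc hx
        gcongr) left_mem_uIcc right_mem_uIcc
    rw [Real.norm_eq_abs, mul_assoc, hsq] at this
    refine le_trans (le_of_eq ?_) this
    congr 1
    module
  · have hFe := continuous_fluxExt hM hF.continuousOn
    have hi : ∀ a b : ℝ, IntervalIntegrable (fluxExt F M) volume a b := fun a b =>
      hFe.intervalIntegrable a b
    have h1 : fluxPrim F M v - fluxPrim F M u = ∫ k in u..v, fluxExt F M k :=
      intervalIntegral.integral_interval_sub_left (hi 0 v) (hi 0 u)
    have h2 : (2 * (v - u)) • F v - (2 : ℝ) • (fluxPrim F M v - fluxPrim F M u) =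
        (2 : ℝ) • ∫ k in u..v, (F v - fluxExt F M k) := by
      rw [intervalIntegral.integral_sub (by simp) (hi u v), intervalIntegral.integral_const, h1]
      module
    have h3 : ‖∫ k in u..v, (F v - fluxExt F M k)‖ ≤ C * |v - u| * |v - u| := by
      refine intervalIntegral.norm_integral_le_of_norm_le_const fun k hk => ?_
      have hk' := uIoc_subset_uIcc hk
      rw [fluxExt_of_mem (hsub hk')]
      refine (hC v hv k (hsub hk')).2.1.trans ?_
      have : |v - k| ≤ |v - u| := abs_sub_right_of_mem_uIcc hk'
      gcongr
    rw [h2, norm_smul, Real.norm_eq_abs, abs_two]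
    rw [mul_assoc, hsq] at h3
    linarith

/-- A smooth cut-off, decreasing along a backward cone. -/
noncomputable def coneTest (d : ℕ) (T₀ Λ R : ℝ) (p : ℝ × EuclideanSpace ℝ (Fin d)) : ℝ :=
  Real.smoothTransition (p.1 + 1) *
    (Real.exp (-Λ * p.1) * Real.smoothTransition (T₀ - p.1 - √(1 + ‖p.2‖ ^ 2) / R))

lemma contDiff_coneTest (d : ℕ) (T₀ Λ R : ℝ) : ContDiff ℝ ∞ (coneTest d T₀ Λ R) := by
  have h1 : ContDiff ℝ ∞ fun p : ℝ × EuclideanSpace ℝ (Fin d) => √(1 + ‖p.2‖ ^ 2) := by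
    refine ContDiff.sqrt ?_ fun p => by positivity
    exact contDiff_const.add (contDiff_snd.norm_sq ℝ)
  have h2 : ContDiff ℝ ∞ fun p : ℝ × EuclideanSpace ℝ (Fin d) =>
      Real.smoothTransition (T₀ - p.1 - √(1 + ‖p.2‖ ^ 2) / R) :=
    Real.smoothTransition.contDiff.comp ((contDiff_const.sub contDiff_fst).sub (h1.div_const R))
  have h3 : ContDiff ℝ ∞ fun p : ℝ × EuclideanSpace ℝ (Fin d) =>
      Real.smoothTransition (p.1 + 1) :=
    Real.smoothTransition.contDiff.comp (contDiff_fst.add contDiff_const)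
  have h4 : ContDiff ℝ ∞ fun p : ℝ × EuclideanSpace ℝ (Fin d) => Real.exp (-Λ * p.1) :=
    Real.contDiff_exp.comp (contDiff_const.mul contDiff_fst)
  exact h3.mul (h4.mul h2)

lemma coneTest_nonneg (d : ℕ) (T₀ Λ R : ℝ) (p : ℝ × EuclideanSpace ℝ (Fin d)) :
    0 ≤ coneTest d T₀ Λ R p :=
  mul_nonneg (Real.smoothTransition.nonneg _)
    (mul_nonneg (Real.exp_pos _).le (Real.smoothTransition.nonneg _))

/-- The first factor is 1 for positive times and only truncates the past, for compactness. Because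
√(1+|x|²) ≥ 1, the support stays at distance at least 1/R below time T₀. -/
lemma coneTest_support {T₀ Λ R : ℝ} (hR : 0 < R) {p : ℝ × EuclideanSpace ℝ (Fin d)}
    (hp : coneTest d T₀ Λ R p ≠ 0) :
    -1 ≤ p.1 ∧ p.1 ≤ T₀ - 1 / R ∧ ‖p.2‖ ≤ R * (T₀ + 1) := by
  have h1 : 0 < p.1 + 1 := by
    by_contra h
    exact hp (by rw [coneTest, Real.smoothTransition.zero_of_nonpos (not_lt.mp h), zero_mul])
  have h2 : 0 < T₀ - p.1 - √(1 + ‖p.2‖ ^ 2) / R := by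
    by_contra h
    exact hp (by rw [coneTest, Real.smoothTransition.zero_of_nonpos (not_lt.mp h), mul_zero,
      mul_zero])
  have h3 : 1 ≤ √(1 + ‖p.2‖ ^ 2) := Real.one_le_sqrt.mpr (by nlinarith [sq_nonneg ‖p.2‖])
  have h4 : ‖p.2‖ ≤ √(1 + ‖p.2‖ ^ 2) := Real.le_sqrt_of_sq_le (by linarith)
  refine ⟨by linarith, ?_, ?_⟩
  · have : 1 / R ≤ √(1 + ‖p.2‖ ^ 2) / R := by gcongr
    linarith
  · have : √(1 + ‖p.2‖ ^ 2) / R ≤ T₀ + 1 := by linarith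
    rw [div_le_iff₀ hR] at this
    linarith

lemma hasCompactSupport_coneTest {T₀ Λ R : ℝ} (hR : 0 < R) :
    HasCompactSupport (coneTest d T₀ Λ R) := by
  refine HasCompactSupport.intro (K := Icc (-1) T₀ ×ˢ
    Metric.closedBall (0 : EuclideanSpace ℝ (Fin d)) (R * (T₀ + 1)))
    (isCompact_Icc.prod (isCompact_closedBall _ _)) fun p hp => ?_
  by_contra h
  obtain ⟨h1, h2, h3⟩ := coneTest_support hR h
  have : 0 < 1 / R := by positivity
  exact hp ⟨⟨h1, by linarith⟩, by simpa using h3⟩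

lemma tsupport_coneTest {T₀ Λ R : ℝ} (hR : 0 < R) :
    tsupport (coneTest d T₀ Λ R) ⊆ {p | p.1 < T₀} := by
  have h1 : tsupport (coneTest d T₀ Λ R) ⊆ {p | p.1 ≤ T₀ - 1 / R} :=
    closure_minimal (fun p hp => (coneTest_support hR hp).2.1)
      (isClosed_le continuous_fst continuous_const)
  refine h1.trans fun p hp => ?_
  have : 0 < 1 / R := by positivity
  have hp' : p.1 ≤ T₀ - 1 / R := hp
  show p.1 < T₀
  linarith

/-- The same b ≥ 0 appears as a loss in time and, divided by R, as a bound for the spatial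
derivative: a flux of speed at most R is absorbed by the shrinking of the cone. The exponential
supplies the damping Λ. -/
lemma hasFDerivAt_coneTest {T₀ Λ R : ℝ} {p : ℝ × EuclideanSpace ℝ (Fin d)}
    (hp : 0 < p.1) : ∃ b : ℝ, 0 ≤ b ∧
      fderiv ℝ (coneTest d T₀ Λ R) p (1, 0) = -Λ * coneTest d T₀ Λ R p - b ∧
      ∀ v, 0 < R → |fderiv ℝ (coneTest d T₀ Λ R) p (0, v)| ≤ b * (‖v‖ / R) := by
  set g : ℝ × EuclideanSpace ℝ (Fin d) → ℝ := fun p => √(1 + ‖p.2‖ ^ 2) with hg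
  have hgpos : 0 < √(1 + ‖p.2‖ ^ 2) := Real.sqrt_pos.mpr (by positivity)
  have hgd : HasFDerivAt g ((1 / (2 * √(1 + ‖p.2‖ ^ 2))) • (2 • (innerSL ℝ p.2).comp
      (ContinuousLinearMap.snd ℝ ℝ (EuclideanSpace ℝ (Fin d))))) p := by
    have h1 : HasFDerivAt (fun p : ℝ × EuclideanSpace ℝ (Fin d) => 1 + ‖p.2‖ ^ 2)
        (2 • (innerSL ℝ p.2).comp (ContinuousLinearMap.snd ℝ ℝ (EuclideanSpace ℝ (Fin d)))) p :=
      (hasFDerivAt_snd.norm_sq).const_add 1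
    exact h1.sqrt (by positivity)
  set H' := deriv Real.smoothTransition (T₀ - p.1 - g p / R) with hH'
  have hH0 : 0 ≤ H' := Real.smoothTransition.monotone.deriv_nonneg
  have hHd : HasDerivAt Real.smoothTransition H' (T₀ - p.1 - g p / R) :=
    ((Real.smoothTransition.contDiff (n := 1)).differentiable one_ne_zero _).hasDerivAt
  have harg : HasFDerivAt (fun p : ℝ × EuclideanSpace ℝ (Fin d) => T₀ - p.1 - g p * R⁻¹) _ p :=
    (hasFDerivAt_fst.const_sub T₀).sub (hgd.mul_const R⁻¹)
  simp only [← div_eq_mul_inv] at harg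
  have hexp : HasFDerivAt (fun p : ℝ × EuclideanSpace ℝ (Fin d) => Real.exp (-Λ * p.1)) _ p :=
    (hasFDerivAt_fst.const_mul (-Λ)).exp
  have hprod := hexp.mul (hHd.comp_hasFDerivAt p harg)
  have hev : coneTest d T₀ Λ R =ᶠ[𝓝 p] fun p => Real.exp (-Λ * p.1) *
      (Real.smoothTransition ∘ fun p => T₀ - p.1 - g p / R) p := by
    have hopen : {q : ℝ × EuclideanSpace ℝ (Fin d) | 0 < q.1} ∈ 𝓝 p :=
      (isOpen_lt continuous_const continuous_fst).mem_nhds hp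
    filter_upwards [hopen] with q hq
    have hq' : 0 < q.1 := hq
    rw [coneTest, Real.smoothTransition.one_of_one_le (by linarith), one_mul]
    rfl
  have hfd := (hprod.congr_of_eventuallyEq hev).fderiv
  have hval : coneTest d T₀ Λ R p = Real.exp (-Λ * p.1) *
      Real.smoothTransition (T₀ - p.1 - g p / R) := hev.eq_of_nhds
  have hE := Real.exp_pos (-Λ * p.1)
  refine ⟨Real.exp (-Λ * p.1) * H', by positivity, ?_, fun v hR => ?_⟩
  · rw [hfd, hval]
    simp
    ring
  · have hval2 : fderiv ℝ (coneTest d T₀ Λ R) p (0, v) =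
        -(Real.exp (-Λ * p.1) * H' * (inner ℝ p.2 v / √(1 + ‖p.2‖ ^ 2) / R)) := by
      rw [hfd]
      simp
      field_simp
    rw [hval2, abs_neg, abs_mul, abs_of_nonneg (by positivity), abs_div, abs_of_pos hR, abs_div,
      abs_of_pos hgpos]
    gcongr
    rw [div_le_iff₀ hgpos]
    have h4 : ‖p.2‖ ≤ √(1 + ‖p.2‖ ^ 2) := Real.le_sqrt_of_sq_le (by linarith)
    calc |inner ℝ p.2 v| ≤ ‖p.2‖ * ‖v‖ := abs_real_inner_le_norm _ _
      _ ≤ √(1 + ‖p.2‖ ^ 2) * ‖v‖ := by gcongr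
      _ = _ := mul_comm _ _

/-- Weak-strong uniqueness. -/
theorem IsEntropyPair.ae_eq (hM : 0 < M) (hT₀ : 0 < T₀) (hF : ContDiffOn ℝ ∞ F (Icc (-M) M))
    (hU : IsClassicalSolution F M T₀ U) (h : IsEntropyPair F M T₀ (fun x => U (0, x)) w) :
    w =ᵐ[volume.restrict (strip d (T₀ : EReal))] U := by
  obtain ⟨C, hC0, hC⟩ := exists_flux_taylor hM hF
  obtain ⟨L, hL⟩ := hU.bound
  have hmeas := measurableSet_strip d T₀
  -- The damping compensates the source 2|L|C and leaves -1 times the weighted relative entropy. The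
  -- cone slope R ≥ 2C used below absorbs the relative flux.
  set Λ : ℝ := 2 * |L| * C + 1 with hΛ
  have key : ∀ n : ℕ, ∀ᵐ p ∂(volume.restrict (strip d (T₀ : EReal))),
      (w p - U p) ^ 2 * coneTest d T₀ Λ (2 * C + 1 + n) p = 0 := by
    intro n
    set R : ℝ := 2 * C + 1 + n with hR
    have hR0 : 0 < R := by positivity
    have hR2 : 2 * C ≤ R := by rw [hR]; linarith [n.cast_nonneg (α := ℝ)]
    set φ := coneTest d T₀ Λ R with hφ
    have hφT := tsupport_coneTest (d := d) (T₀ := T₀) (Λ := Λ) hR0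
    obtain ⟨hint, hpos⟩ := h.relative hM hT₀ hF hU (contDiff_coneTest d T₀ Λ R)
      (hasCompactSupport_coneTest hR0) (coneTest_nonneg d T₀ Λ R)
      (fun p hp => image_eq_zero_of_notMem_tsupport fun hmem =>
        absurd (hφT hmem) (not_lt.mpr hp)) hφT
    have hle : ∀ p ∈ strip d (T₀ : EReal),
        relEntropy F M U w φ p ≤ -((w p - U p) ^ 2 * φ p) := by
      intro p hp
      obtain ⟨b, hb0, hbt, hbx⟩ := hasFDerivAt_coneTest (d := d) (T₀ := T₀) (Λ := Λ) (R := R) hp.1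
      have hφ0 : 0 ≤ φ p := coneTest_nonneg d T₀ Λ R p
      obtain ⟨hC1, hC2⟩ := hC (U p) (hU.mem_Icc p) (w p) (h.mem_Icc p)
      have h1 : -(fderiv ℝ U p (0, F (w p) - F (U p) - (w p - U p) • velocity F M (U p))) ≤
          |L| * (C * (w p - U p) ^ 2) := by
        refine (neg_le_abs _).trans ?_
        refine ((fderiv ℝ U p).le_opNorm _).trans ?_
        have : ‖((0 : ℝ), F (w p) - F (U p) - (w p - U p) • velocity F M (U p))‖ =
            ‖F (w p) - F (U p) - (w p - U p) • velocity F M (U p)‖ := by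
          simp [Prod.norm_def]
        rw [this]
        gcongr
        exact (hL p hp).trans (le_abs_self _)
      have h2 : fderiv ℝ φ p (0, (2 * (w p - U p)) • F (w p) -
          (2 : ℝ) • (fluxPrim F M (w p) - fluxPrim F M (U p))) ≤ b * (w p - U p) ^ 2 := by
        refine (le_abs_self _).trans ((hbx _ hR0).trans ?_)
        gcongr
        rw [div_le_iff₀ hR0]
        refine hC2.trans ?_
        nlinarith [sq_nonneg (w p - U p)]
      rw [relEntropy, hbt]
      have h3 : -(2 * φ p * fderiv ℝ U p
          (0, F (w p) - F (U p) - (w p - U p) • velocity F M (U p))) ≤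
          2 * φ p * (|L| * (C * (w p - U p) ^ 2)) := by
        rw [← mul_neg]
        gcongr
      have h4 : (w p - U p) ^ 2 * (-Λ * φ p - b) + 2 * φ p * (|L| * (C * (w p - U p) ^ 2)) +
          b * (w p - U p) ^ 2 = -((w p - U p) ^ 2 * φ p) := by
        rw [hΛ]; ring
      linarith
    have hnn : ∀ p, 0 ≤ (w p - U p) ^ 2 * φ p := fun p =>
      mul_nonneg (sq_nonneg _) (coneTest_nonneg d T₀ Λ R p)
    have hUm : Measurable U := hU.contDiff.continuous.measurable
    have hint2 : IntegrableOn (fun p => (w p - U p) ^ 2 * φ p) (strip d (T₀ : EReal)) := by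
      refine Integrable.mono' hint.norm ?_ ?_
      · exact (((h.measurable.sub hUm).pow_const 2).mul
          (contDiff_coneTest d T₀ Λ R).continuous.measurable).aestronglyMeasurable
      · rw [ae_restrict_iff' hmeas]
        refine Eventually.of_forall fun p hp => ?_
        rw [Real.norm_of_nonneg (hnn p), Real.norm_eq_abs]
        have := hle p hp
        exact le_trans (by linarith) (neg_le_abs _)
    have hint3 : ∫ p in strip d (T₀ : EReal), (w p - U p) ^ 2 * φ p = 0 := by
      refine le_antisymm ?_ (integral_nonneg hnn)
      have := setIntegral_mono_on hint hint2.neg hmeas hle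
      simp only [Pi.neg_apply] at this
      rw [integral_neg] at this
      linarith
    exact (integral_eq_zero_iff_of_nonneg hnn hint2).mp hint3
  have hall := ae_all_iff.mpr key
  rw [Filter.EventuallyEq, ae_restrict_iff' hmeas]
  rw [ae_restrict_iff' hmeas] at hall
  filter_upwards [hall] with p hp hmem
  have hpT : p.1 < T₀ := by
    have := hmem.2
    simpa using this
  -- As n grows the cones exhaust the strip, so some cut-off is positive at p.
  obtain ⟨n, hn⟩ := exists_nat_gt (√(1 + ‖p.2‖ ^ 2) / (T₀ - p.1))
  have hz := hp hmem n
  have hφpos : 0 < coneTest d T₀ Λ (2 * C + 1 + n) p := by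
    have hp0 : 0 < p.1 := hmem.1
    rw [coneTest, Real.smoothTransition.one_of_one_le (by linarith), one_mul]
    refine mul_pos (Real.exp_pos _) (Real.smoothTransition.pos_of_pos ?_)
    have hT' : 0 < T₀ - p.1 := by linarith
    rw [sub_pos, div_lt_iff₀ (by positivity)]
    rw [div_lt_iff₀ hT'] at hn
    nlinarith
  have := (mul_eq_zero.mp hz).resolve_right hφpos.ne'
  exact sub_eq_zero.mp (pow_eq_zero_iff two_ne_zero |>.mp this)

theorem IsClassicalSolution.unique (hM : 0 < M) (hT₀ : 0 < T₀)
    (hF : ContDiffOn ℝ ∞ F (Icc (-M) M)) (hU : IsClassicalSolution F M T₀ U) {T : EReal}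
    (hT : (T₀ : EReal) ≤ T) {w : ℝ → EuclideanSpace ℝ (Fin d) → ℝ}
    (hw : IsEntropySolution F M T (fun x => U (0, x)) w) :
    ∀ᵐ p ∂(volume.restrict (strip d (T₀ : EReal))), w p.1 p.2 = U (p.1, p.2) := by
  have hUc := hU.contDiff.continuous
  obtain ⟨w₁, h1, h2⟩ := (hw.restrict hT).exists_isEntropyPair hM hT₀ hF.continuousOn
    (by fun_prop)
  filter_upwards [h2, h1.ae_eq hM hT₀ hF hU] with p hp hp'
  exact hp.trans hp'

end Uniqueness

end ScalarLaw

namespace ScalarLaw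

/-! ### Construction of the oscillating solutions -/

/-- The inverse of the characteristic map `θ ↦ θ + χ(t) G(θ)`. -/
lemma exists_inverse_characteristic {G χ : ℝ → ℝ} {C : ℝ} (hG : ContDiff ℝ ∞ G)
    (hχ : ContDiff ℝ ∞ χ) (hG0 : ∀ θ, |G θ| ≤ C) (hG1 : ∀ θ, |deriv G θ| ≤ C)
    (hχC : ∀ t, |χ t| * C ≤ 1 / 2) :
    ∃ Y : ℝ × ℝ → ℝ, ContDiff ℝ ∞ Y ∧ (∀ t θ, Y (t, θ + χ t * G θ) = θ) ∧
      (∀ p, Y p + χ p.1 * G (Y p) = p.2) ∧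
      (∀ p q, |Y p - Y q| ≤ 2 * (|p.2 - q.2| + C * |χ p.1 - χ q.1|)) ∧
      ∀ p, 1 / 2 ≤ fderiv ℝ Y p (0, 1) ∧ fderiv ℝ Y p (0, 1) ≤ 2 := by
  have hGd : Differentiable ℝ G := hG.differentiable (by simp)
  have hGlip : ∀ a b, |G a - G b| ≤ C * |a - b| := by
    intro a b
    have := (convex_univ (𝕜 := ℝ) (E := ℝ)).norm_image_sub_le_of_norm_hasDerivWithin_le (C := C)
      (fun x _ => (hGd x).hasDerivAt.hasDerivWithinAt) (fun x _ => hG1 x) (mem_univ b) (mem_univ a)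
    simpa [Real.norm_eq_abs] using this
  have hχG : ∀ t a b, |χ t * G a - χ t * G b| ≤ 1 / 2 * |a - b| := by
    intro t a b
    rw [← mul_sub, abs_mul]
    calc |χ t| * |G a - G b| ≤ |χ t| * (C * |a - b|) := by gcongr; exact hGlip a b
      _ = |χ t| * C * |a - b| := by ring
      _ ≤ _ := by gcongr; exact hχC t
  have hsurj : ∀ p : ℝ × ℝ, ∃ θ, θ + χ p.1 * G θ = p.2 := by
    intro p
    have hb : ∀ θ, |χ p.1 * G θ| ≤ 1 / 2 := fun θ => by
      rw [abs_mul]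
      exact (mul_le_mul_of_nonneg_left (hG0 θ) (abs_nonneg _)).trans (hχC _)
    have hcont : ContinuousOn (fun θ => θ + χ p.1 * G θ) (Icc (p.2 - 1) (p.2 + 1)) := by
      have := hG.continuous
      fun_prop
    have h1 := abs_le.mp (hb (p.2 - 1))
    have h2 := abs_le.mp (hb (p.2 + 1))
    obtain ⟨θ, -, hθ⟩ := intermediate_value_Icc (by linarith) hcont
      (show p.2 ∈ Icc _ _ from ⟨by linarith [h1.2], by linarith [h2.1]⟩)
    exact ⟨θ, hθ⟩
  choose Y hY using hsurj
  have hlip : ∀ p q, |Y p - Y q| ≤ 2 * (|p.2 - q.2| + C * |χ p.1 - χ q.1|) := by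
    intro p q
    have e : Y p - Y q = (p.2 - q.2) - (χ p.1 * G (Y p) - χ p.1 * G (Y q))
        - (χ p.1 - χ q.1) * G (Y q) := by
      rw [← hY p, ← hY q]; ring
    have h1 := hχG p.1 (Y p) (Y q)
    have h2 : |(χ p.1 - χ q.1) * G (Y q)| ≤ C * |χ p.1 - χ q.1| := by
      rw [abs_mul, mul_comm]
      gcongr
      exact hG0 _
    have h3 : |Y p - Y q| ≤ |p.2 - q.2| + |χ p.1 * G (Y p) - χ p.1 * G (Y q)| +
        |(χ p.1 - χ q.1) * G (Y q)| := by
      rw [e]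
      exact (abs_sub _ _).trans (add_le_add_left (abs_sub _ _) _)
    linarith
  have hleft : ∀ t θ, Y (t, θ + χ t * G θ) = θ := by
    intro t θ
    have h1 := hY (t, θ + χ t * G θ)
    simp only at h1
    have h2 := hχG t (Y (t, θ + χ t * G θ)) θ
    have h3 : Y (t, θ + χ t * G θ) - θ = -(χ t * G (Y (t, θ + χ t * G θ)) - χ t * G θ) := by
      linarith
    rw [← abs_neg, ← h3] at h2
    have h4 := abs_nonneg (Y (t, θ + χ t * G θ) - θ)
    exact sub_eq_zero.mp (abs_eq_zero.mp (by linarith))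
  have hYc : Continuous Y := by
    rw [continuous_iff_continuousAt]
    intro q
    rw [ContinuousAt, tendsto_iff_dist_tendsto_zero]
    have hlim : Tendsto (fun p : ℝ × ℝ => 2 * (|p.2 - q.2| + C * |χ p.1 - χ q.1|)) (𝓝 q) (𝓝 0) := by
      have hc : Continuous fun p : ℝ × ℝ => 2 * (|p.2 - q.2| + C * |χ p.1 - χ q.1|) := by
        have := hχ.continuous
        fun_prop
      simpa using hc.tendsto q
    exact squeeze_zero (fun _ => dist_nonneg) (fun p => by rw [Real.dist_eq]; exact hlip p q) hlim
  set f : ℝ × ℝ → ℝ × ℝ := fun p => (p.1, p.2 + χ p.1 * G p.2) with hf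
  have hfs : ContDiff ℝ ∞ f :=
    contDiff_fst.prodMk (contDiff_snd.add ((hχ.comp contDiff_fst).mul (hG.comp contDiff_snd)))
  -- The characteristic map with time carried along is a homeomorphism with invertible derivative,
  -- so its inverse, and with it Y, is smooth.
  let Φ : ℝ × ℝ ≃ₜ ℝ × ℝ :=
    { toFun := f
      invFun := fun p => (p.1, Y p)
      left_inv := fun p => Prod.ext rfl (hleft p.1 p.2)
      right_inv := fun p => Prod.ext rfl (hY p)
      continuous_toFun := hfs.continuous
      continuous_invFun := continuous_fst.prodMk hYc }
  have hpos : ∀ p : ℝ × ℝ, 1 / 2 ≤ 1 + χ p.1 * deriv G p.2 ∧ 1 + χ p.1 * deriv G p.2 ≤ 3 / 2 := by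
    intro p
    have : |χ p.1 * deriv G p.2| ≤ 1 / 2 := by
      rw [abs_mul]
      exact (mul_le_mul_of_nonneg_left (hG1 _) (abs_nonneg _)).trans (hχC _)
    constructor <;> linarith [(abs_le.mp this).1, (abs_le.mp this).2]
  let f' : ℝ × ℝ → ((ℝ × ℝ) ≃L[ℝ] (ℝ × ℝ)) := fun p =>
    ContinuousLinearEquiv.equivOfInverse
      ((ContinuousLinearMap.fst ℝ ℝ ℝ).prod
        ((1 + χ p.1 * deriv G p.2) • ContinuousLinearMap.snd ℝ ℝ ℝ +
          (deriv χ p.1 * G p.2) • ContinuousLinearMap.fst ℝ ℝ ℝ))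
      ((ContinuousLinearMap.fst ℝ ℝ ℝ).prod
        ((1 + χ p.1 * deriv G p.2)⁻¹ • (ContinuousLinearMap.snd ℝ ℝ ℝ -
          (deriv χ p.1 * G p.2) • ContinuousLinearMap.fst ℝ ℝ ℝ)))
      (fun v => by
        have : 1 + χ p.1 * deriv G p.2 ≠ 0 := by linarith [(hpos p).1]
        refine Prod.ext (by simp) ?_
        simp
        field_simp)
      (fun v => by
        have : 1 + χ p.1 * deriv G p.2 ≠ 0 := by linarith [(hpos p).1]
        refine Prod.ext (by simp) ?_
        simp
        field_simp
        ring)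
  have hff' : ∀ p, HasFDerivAt f (f' p : (ℝ × ℝ) →L[ℝ] (ℝ × ℝ)) p := by
    intro p
    have h1 : HasFDerivAt (fun p : ℝ × ℝ => χ p.1) (deriv χ p.1 • ContinuousLinearMap.fst ℝ ℝ ℝ) p :=
      (hχ.differentiable (by simp) p.1).hasDerivAt.comp_hasFDerivAt p hasFDerivAt_fst
    have h2 : HasFDerivAt (fun p : ℝ × ℝ => G p.2) (deriv G p.2 • ContinuousLinearMap.snd ℝ ℝ ℝ) p :=
      (hGd p.2).hasDerivAt.comp_hasFDerivAt p hasFDerivAt_snd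
    have h3 := (hasFDerivAt_fst (𝕜 := ℝ) (p := p)).prodMk (hasFDerivAt_snd.add (h1.mul h2))
    convert! h3 using 1
    ext <;> simp [f', ContinuousLinearEquiv.equivOfInverse]
    ring
  have hΦs : ContDiff ℝ ∞ (Φ.symm : ℝ × ℝ → ℝ × ℝ) := Φ.contDiff_symm hff' hfs
  have hYs : ContDiff ℝ ∞ Y := contDiff_snd.comp hΦs
  refine ⟨Y, hYs, hleft, hY, hlip, fun p => ?_⟩
  have hder : HasDerivAt (fun s : ℝ => Y (p.1, p.2 + s)) (fderiv ℝ Y p (0, 1)) 0 := by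
    have h1 : HasDerivAt (fun s : ℝ => (p.1, p.2 + s)) ((0 : ℝ), (1 : ℝ)) 0 :=
      (hasDerivAt_const _ _).prodMk ((hasDerivAt_id _).const_add _)
    have h2 : HasFDerivAt Y (fderiv ℝ Y p) (p.1, p.2 + 0) := by
      simpa using (hYs.differentiable (by simp) p).hasFDerivAt
    exact h2.comp_hasDerivAt 0 h1
  have hY0 : Y (p.1, p.2 + 0) = Y p := by simp
  have hGY : HasDerivAt (fun s : ℝ => G (Y (p.1, p.2 + s))) (deriv G (Y p) * fderiv ℝ Y p (0, 1)) 0 := by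
    have h1 : HasDerivAt G (deriv G (Y p)) (Y (p.1, p.2 + 0)) := by
      rw [hY0]; exact (hGd _).hasDerivAt
    exact h1.comp 0 hder
  have hsum := hder.add (hGY.const_mul (χ p.1))
  have hconst : HasDerivAt (fun s : ℝ => p.2 + s) 1 0 := (hasDerivAt_id _).const_add _
  have heq : (fun s : ℝ => Y (p.1, p.2 + s)) + (fun s : ℝ => χ p.1 * G (Y (p.1, p.2 + s))) =
      fun s : ℝ => p.2 + s := funext fun s => hY (p.1, p.2 + s)
  rw [heq] at hsum
  have huniq := hsum.unique hconst
  have hp := hpos (p.1, Y p)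
  simp only at hp
  set D := fderiv ℝ Y p (0, 1) with hD
  -- Differentiating Y + χG(Y) = y in y; the first factor lies in [1/2, 3/2], which pins D between
  -- 2/3 and 2.
  have hprod : (1 + χ p.1 * deriv G (Y p)) * D = 1 := by linarith
  have hDpos : 0 < D := by
    by_contra hcon
    nlinarith
  constructor <;> nlinarith

end ScalarLaw

namespace ScalarLaw

/-! ### Waves of small amplitude about a degenerate state -/

variable {d : ℕ} {F : ℝ → EuclideanSpace ℝ (Fin d)} {M : ℝ}

lemma abs_waveProfile_sub_le (c μ θ : ℝ) : |waveProfile c μ θ - c| ≤ |μ| := by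
  rw [waveProfile, add_sub_cancel_left, abs_mul]
  refine mul_le_of_le_one_right (abs_nonneg _) (abs_le.mpr ⟨?_, ?_⟩) <;>
    linarith [Real.neg_one_le_sin θ, Real.sin_le_one θ]

lemma abs_waveProfile_sub_waveProfile_le (c μ θ η : ℝ) :
    |waveProfile c μ θ - waveProfile c μ η| ≤ |μ| * |θ - η| := by
  have : waveProfile c μ θ - waveProfile c μ η = μ * ((Real.sin θ - Real.sin η) / 2) := by
    rw [waveProfile, waveProfile]; ring
  rw [this, abs_mul, abs_div, abs_two]
  gcongr
  linarith [abs_sin_sub_sin_le θ η, abs_nonneg (Real.sin θ - Real.sin η)]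

/-- The profile stays on one side of c, between c and c + aε. Choosing the sign of a so that it
points towards 0 keeps the wave in [-M,M] even when c = ±M. -/
lemma exists_amplitude (hM : 0 < M) {c : ℝ} (hc : c ∈ Icc (-M) M) :
    ∃ a : ℝ, 0 < |a| ∧ |a| < 1 ∧ ∀ ε ∈ Ioo (0 : ℝ) 1, ∀ θ,
      waveProfile c (a * ε) θ ∈ Icc (-M) M := by
  have hl0 : 0 < min M (1 / 2) := lt_min hM (by norm_num)
  have hlM : min M (1 / 2) ≤ M := min_le_left _ _
  have hl1 : min M (1 / 2) < 1 := (min_le_right _ _).trans_lt (by norm_num)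
  set l := min M (1 / 2)
  have key : ∀ ε ∈ Ioo (0 : ℝ) 1, ∀ θ,
      0 ≤ l * ε * ((1 + Real.sin θ) / 2) ∧ l * ε * ((1 + Real.sin θ) / 2) ≤ M := by
    intro ε hε θ
    have h0 : 0 ≤ (1 + Real.sin θ) / 2 := by linarith [Real.neg_one_le_sin θ]
    have h1 : (1 + Real.sin θ) / 2 ≤ 1 := by linarith [Real.sin_le_one θ]
    have h2 : 0 ≤ l * ε := mul_nonneg hl0.le hε.1.le
    refine ⟨mul_nonneg h2 h0, (mul_le_of_le_one_right h2 h1).trans ?_⟩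
    exact (mul_le_of_le_one_right hl0.le hε.2.le).trans hlM
  rcases le_total c 0 with h | h
  · refine ⟨l, by rwa [abs_of_pos hl0], by rwa [abs_of_pos hl0], fun ε hε θ => ?_⟩
    obtain ⟨h1, h2⟩ := key ε hε θ
    rw [waveProfile]
    exact ⟨by linarith [hc.1], by linarith⟩
  · refine ⟨-l, by rwa [abs_neg, abs_of_pos hl0], by rwa [abs_neg, abs_of_pos hl0],
      fun ε hε θ => ?_⟩
    obtain ⟨h1, h2⟩ := key ε hε θ
    rw [waveProfile, neg_mul, neg_mul]
    exact ⟨by linarith, by linarith [hc.2]⟩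

lemma contDiffOn_velocity (hM : 0 < M) (hF : ContDiffOn ℝ ∞ F (Icc (-M) M)) :
    ContDiffOn ℝ ∞ (velocity F M) (Icc (-M) M) :=
  hF.derivWithin (uniqueDiffOn_Icc (by linarith)) (by simp)

/-- The characteristic speeds of a wave of amplitude `ε` around a degenerate state, relative to
the speed of that state, are `O(ε ^ q)`. -/
lemma relative_speed_bounds (hM : 0 < M) (hF : ContDiffOn ℝ ∞ F (Icc (-M) M)) {q : ℕ}
    (hq : 1 ≤ q) {c C a ε : ℝ} {ξ : EuclideanSpace ℝ (Fin d)}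
    (hC : ∀ v ∈ Icc (-M) M, |inner ℝ (velocity F M v - velocity F M c) ξ| ≤ C * |v - c| ^ q ∧
      |inner ℝ (fluxDeriv F M 2 v) ξ| ≤ C * |v - c| ^ (q - 1))
    (hC0 : 0 ≤ C) (ha : |a| < 1) (hε : ε ∈ Ioo (0 : ℝ) 1)
    (hmem : ∀ θ, waveProfile c (a * ε) θ ∈ Icc (-M) M) {G : ℝ → ℝ}
    (hG : ∀ θ, G θ = inner ℝ (velocity F M (waveProfile c (a * ε) θ) - velocity F M c) ξ / ε ^ q) :
    ContDiff ℝ ∞ G ∧ (∀ θ, |G θ| ≤ C) ∧ ∀ θ, |deriv G θ| ≤ C := by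
  obtain rfl : G = _ := funext hG
  have hε0 := hε.1
  have hρ : 0 < ε ^ q := by positivity
  have hμ : |a * ε| ≤ ε := by
    rw [abs_mul, abs_of_pos hε0]
    exact mul_le_of_le_one_left hε0.le ha.le
  have hb : ∀ θ, |waveProfile c (a * ε) θ - c| ≤ ε := fun θ =>
    (abs_waveProfile_sub_le _ _ _).trans hμ
  refine ⟨?_, fun θ => ?_, fun θ => ?_⟩
  · have h1 : ContDiff ℝ ∞ fun θ => velocity F M (waveProfile c (a * ε) θ) :=
      (contDiffOn_velocity hM hF).comp_contDiff (contDiff_waveProfile c _) hmem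
    exact ((h1.sub contDiff_const).inner ℝ contDiff_const).div_const _
  · rw [abs_div, abs_of_pos hρ, div_le_iff₀ hρ]
    refine ((hC _ (hmem θ)).1).trans ?_
    gcongr
    exact hb θ
  · have h1 := hasDerivWithinAt_fluxDeriv hM hF 1 (hmem θ)
    rw [fluxDeriv_one] at h1
    have h2 : HasDerivAt (fun θ => velocity F M (waveProfile c (a * ε) θ))
        ((a * ε / 2 * Real.cos θ) • fluxDeriv F M 2 (waveProfile c (a * ε) θ)) θ := by
      rw [← hasDerivWithinAt_univ]
      exact h1.scomp θ (hasDerivAt_waveProfile c (a * ε) θ).hasDerivWithinAt (fun x _ => hmem x)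
    have h3 := (((h2.sub_const (velocity F M c)).inner ℝ (hasDerivAt_const θ ξ))).div_const (ε ^ q)
    rw [h3.deriv, inner_zero_right, zero_add, real_inner_smul_left, abs_div, abs_of_pos hρ,
      div_le_iff₀ hρ, abs_mul]
    have h4 : |a * ε / 2 * Real.cos θ| ≤ ε := by
      rw [abs_mul, abs_div, abs_two]
      have := Real.abs_cos_le_one θ
      nlinarith [abs_nonneg (a * ε), abs_nonneg (Real.cos θ)]
    calc _ ≤ ε * (C * ε ^ (q - 1)) := by
          gcongr
          refine ((hC _ (hmem θ)).2).trans ?_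
          gcongr
          exact hb θ
      _ = C * ε ^ q := by
          obtain ⟨k, rfl⟩ := Nat.exists_eq_add_of_le hq
          simp [pow_add]
          ring

/-- Phase functions on space-time of wave length `ρ`, advancing in the direction `ξ`. -/
structure IsSpaceTimePhase (T₀ ρ L : ℝ) (ξ : EuclideanSpace ℝ (Fin d))
    (Z : ℝ × EuclideanSpace ℝ (Fin d) → ℝ) : Prop where
  contDiff : ContDiff ℝ ∞ Z
  lipschitz : ∀ p p' : ℝ × EuclideanSpace ℝ (Fin d), p.1 ∈ Icc 0 T₀ → p'.1 ∈ Icc 0 T₀ →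
    |Z p - Z p'| ≤ L / ρ * ‖p - p'‖
  reach : ∀ p, ∀ θ ∈ Icc (Z p) (Z p + 2 * Real.pi),
    ∃ r : ℝ, |r| ≤ 10 * ρ ∧ Z (p.1, p.2 + r • ξ) = θ
  le_deriv : ∀ p, 1 / (2 * ρ) ≤ fderiv ℝ Z p (0, ξ)
  deriv_le : ∀ p, fderiv ℝ Z p (0, ξ) ≤ 2 / ρ

/-- A smooth function which agrees with the identity near `[0, T₀]`. -/
lemma exists_time_cutoff {T₀ : ℝ} (hT₀ : 0 < T₀) :
    ∃ χ : ℝ → ℝ, ContDiff ℝ ∞ χ ∧ (∀ t, |χ t| ≤ 3 * T₀) ∧ ∀ t, |t| ≤ 2 * T₀ → χ t = t := by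
  let B : ContDiffBump (0 : ℝ) := ⟨2 * T₀, 3 * T₀, by positivity, by linarith⟩
  refine ⟨fun t => t * B t, contDiff_id.mul B.contDiff, fun t => ?_, fun t ht => ?_⟩
  · rcases le_total (3 * T₀) |t| with h | h
    · have : B t = 0 := B.zero_of_le_dist (by simpa [Real.dist_eq] using h)
      simp [this]
      positivity
    · rw [abs_mul, abs_of_nonneg B.nonneg]
      exact (mul_le_of_le_one_right (abs_nonneg _) B.le_one).trans h
  · have : B t = 1 := B.one_of_mem_closedBall (by simpa [Real.dist_eq] using ht)
    simp [this]

/-- Oscillating smooth solutions around a degenerate state. -/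
theorem exists_oscillating_solution (hM : 0 < M) (hF : ContDiffOn ℝ ∞ F (Icc (-M) M)) {q : ℕ}
    (hq : 1 ≤ q) {c a : ℝ} {ξ : EuclideanSpace ℝ (Fin d)} (h : IsDegenerate F M q c ξ)
    (ha : |a| < 1)
    (hmem : ∀ ε ∈ Ioo (0 : ℝ) 1, ∀ θ, waveProfile c (a * ε) θ ∈ Icc (-M) M) :
    ∃ T₀ L : ℝ, 0 < T₀ ∧ 1 ≤ L ∧ ∀ ε ∈ Ioo (0 : ℝ) 1, ∃ Z,
      IsSpaceTimePhase T₀ (ε ^ q) L ξ Z ∧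
      IsClassicalSolution F M T₀ (fun p => waveProfile c (a * ε) (Z p)) := by
  obtain ⟨C, hC1, hC⟩ := h.exists_bound hM hF hq
  have hξ : ‖ξ‖ = 1 := h.2.1
  have hC0 : 0 < C := by linarith
  -- The time cut-off is bounded by 3T₀, so this makes |χ|C ≤ 1/2, the invertibility condition for
  -- the characteristic map, with no dependence on ε.
  set T₀ : ℝ := 1 / (6 * C) with hT
  have hT₀ : 0 < T₀ := by positivity
  obtain ⟨χ, hχ, hχb, hχid⟩ := exists_time_cutoff hT₀
  have hχC : ∀ t, |χ t| * C ≤ 1 / 2 := fun t => by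
    calc |χ t| * C ≤ 3 * T₀ * C := by gcongr; exact hχb t
      _ = 1 / 2 := by rw [hT]; field_simp; norm_num
  set σ : ℝ := inner ℝ ξ (velocity F M c) with hσ
  refine ⟨T₀, 2 * (1 + |σ| + C), hT₀, by linarith [abs_nonneg σ], fun ε hε => ?_⟩
  have hε0 := hε.1
  set ρ := ε ^ q with hρd
  have hρ : 0 < ρ := by positivity
  have hρ1 : ρ ≤ 1 := pow_le_one₀ hε0.le hε.2.le
  set b := waveProfile c (a * ε) with hb
  set G : ℝ → ℝ := fun θ => inner ℝ (velocity F M (b θ) - velocity F M c) ξ / ρ with hGd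
  obtain ⟨hG, hG0, hG1⟩ := relative_speed_bounds hM hF hq hC hC0.le ha hε (hmem ε hε)
    (G := G) (fun θ => rfl)
  obtain ⟨Y, hY, hYl, hYr, hYlip, hYd⟩ := exists_inverse_characteristic hG hχ hG0 hG1 hχC
  -- Reduction to one dimension: position along ξ in the frame moving with the speed σ of the state
  -- c, measured in wave lengths. The phase Z then solves Z + χ(t)G(Z) = (ξ·x - σt)/ρ.
  set A : ℝ × EuclideanSpace ℝ (Fin d) → ℝ × ℝ := fun p => (p.1, (inner ℝ ξ p.2 - σ * p.1) / ρ)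
    with hA
  have hAs : ContDiff ℝ ∞ A := by
    refine contDiff_fst.prodMk (((contDiff_const.inner ℝ contDiff_snd).sub
      (contDiff_const.mul contDiff_fst)).div_const _)
  set Z : ℝ × EuclideanSpace ℝ (Fin d) → ℝ := fun p => Y (A p) with hZ
  have hZs : ContDiff ℝ ∞ Z := hY.comp hAs
  have hlip : ∀ p p' : ℝ × EuclideanSpace ℝ (Fin d), p.1 ∈ Icc 0 T₀ → p'.1 ∈ Icc 0 T₀ →
      |Z p - Z p'| ≤ 2 * (1 + |σ| + C) / ρ * ‖p - p'‖ := by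
    intro p p' hp hp'
    have h1 : χ p.1 = p.1 := hχid _ (by rw [abs_of_nonneg hp.1]; linarith [hp.2])
    have h2 : χ p'.1 = p'.1 := hχid _ (by rw [abs_of_nonneg hp'.1]; linarith [hp'.2])
    have h3 : |p.1 - p'.1| ≤ ‖p - p'‖ := norm_fst_le (p - p')
    have h4 : ‖p.2 - p'.2‖ ≤ ‖p - p'‖ := norm_snd_le (p - p')
    have h5 : (A p).2 - (A p').2 = (inner ℝ ξ (p.2 - p'.2) - σ * (p.1 - p'.1)) / ρ := by
      simp only [hA, inner_sub_right]; ring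
    have h6 : |inner ℝ ξ (p.2 - p'.2)| ≤ ‖p - p'‖ := by
      refine (abs_real_inner_le_norm _ _).trans ?_
      rwa [hξ, one_mul]
    have h7 : |(A p).2 - (A p').2| ≤ (1 + |σ|) / ρ * ‖p - p'‖ := by
      rw [h5, abs_div, abs_of_pos hρ, div_mul_eq_mul_div]
      gcongr
      refine (abs_sub _ _).trans ?_
      rw [abs_mul, add_mul, one_mul]
      gcongr
    have h8 : C * |χ p.1 - χ p'.1| ≤ C / ρ * ‖p - p'‖ := by
      rw [h1, h2]
      have : C ≤ C / ρ := le_div_self hC0.le hρ hρ1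
      gcongr
    calc |Z p - Z p'| ≤ 2 * (|(A p).2 - (A p').2| + C * |χ p.1 - χ p'.1|) := hYlip _ _
      _ ≤ 2 * ((1 + |σ|) / ρ * ‖p - p'‖ + C / ρ * ‖p - p'‖) := by gcongr
      _ = _ := by ring
  have hξξ : inner ℝ ξ ξ = (1 : ℝ) := by rw [real_inner_self_eq_norm_sq, hξ, one_pow]
  have hAξ : ∀ p r, A (p.1, p.2 + r • ξ) = ((A p).1, (A p).2 + r / ρ) := by
    intro p r
    refine Prod.ext rfl ?_
    simp only [hA, inner_add_right, real_inner_smul_right, hξξ]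
    ring
  have hdir : ∀ p, fderiv ℝ Z p (0, ξ) = fderiv ℝ Y (A p) (0, 1) / ρ := by
    intro p
    have h1 : HasDerivAt (fun r : ℝ => (p.1, p.2 + r • ξ)) ((0 : ℝ), ξ) 0 := by
      refine (hasDerivAt_const _ _).prodMk ?_
      simpa using ((hasDerivAt_id (0 : ℝ)).smul_const ξ).const_add p.2
    have h2 : HasFDerivAt Z (fderiv ℝ Z p) (p.1, p.2 + (0 : ℝ) • ξ) := by
      simpa using (hZs.differentiable (by simp) p).hasFDerivAt
    have h3 : HasDerivAt (fun r : ℝ => Z (p.1, p.2 + r • ξ)) (fderiv ℝ Z p (0, ξ)) 0 :=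
      h2.comp_hasDerivAt (l := Z) 0 h1
    have h4 : HasDerivAt (fun r : ℝ => ((A p).1, (A p).2 + r / ρ)) ((0 : ℝ), 1 / ρ) 0 :=
      (hasDerivAt_const _ _).prodMk (((hasDerivAt_id (0 : ℝ)).div_const ρ).const_add _)
    have h5 : HasFDerivAt Y (fderiv ℝ Y (A p)) ((A p).1, (A p).2 + 0 / ρ) := by
      simpa using (hY.differentiable (by simp) (A p)).hasFDerivAt
    have h6 : HasDerivAt (fun r : ℝ => Y ((A p).1, (A p).2 + r / ρ))
        (fderiv ℝ Y (A p) (0, 1 / ρ)) 0 := h5.comp_hasDerivAt 0 h4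
    have h7 : (fun r : ℝ => Z (p.1, p.2 + r • ξ)) =
        fun r : ℝ => Y ((A p).1, (A p).2 + r / ρ) := funext fun r => by rw [hZ]; simp only [hAξ]
    rw [h7] at h3
    rw [h3.unique h6, show ((0 : ℝ), 1 / ρ) = ρ⁻¹ • ((0 : ℝ), (1 : ℝ)) by simp, map_smul,
      smul_eq_mul]
    ring
  have hphase : IsSpaceTimePhase T₀ ρ (2 * (1 + |σ| + C)) ξ Z := by
    refine ⟨hZs, hlip, fun p θ hθ => ?_, fun p => ?_, fun p => ?_⟩
    -- The shift that moves the characteristic coordinate onto the image of θ. It measures at most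
    -- 2π + 1 < 10 wave lengths.
    · refine ⟨ρ * (θ + χ p.1 * G θ - (A p).2), ?_, ?_⟩
      · rw [abs_mul, abs_of_pos hρ, mul_comm]
        gcongr
        rw [← hYr (A p)]
        have hb2 : ∀ η, |χ p.1 * G η| ≤ 1 / 2 := fun η => by
          rw [abs_mul]
          exact (mul_le_mul_of_nonneg_left (hG0 η) (abs_nonneg _)).trans (hχC _)
        have h1 := abs_le.mp (hb2 θ)
        have h2 := abs_le.mp (hb2 (Y (A p)))
        have h3 : Z p ≤ θ ∧ θ ≤ Z p + 2 * Real.pi := hθ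
        have h4 : (A p).1 = p.1 := rfl
        have h5 := Real.pi_lt_d2
        simp only [hZ] at h3
        rw [h4, abs_le]
        constructor <;> linarith [h1.1, h1.2, h2.1, h2.2, h3.1, h3.2]
      · simp only [hZ, hAξ]
        rw [mul_div_cancel_left₀ _ hρ.ne', add_sub_cancel]
        exact hYl _ _
    · rw [hdir, le_div_iff₀ hρ]
      refine le_trans (le_of_eq ?_) (hYd _).1
      field_simp
    · rw [hdir]
      gcongr
      exact (hYd _).2
  refine ⟨Z, hphase, (contDiff_waveProfile _ _).comp hZs, fun p => hmem ε hε _, fun p hp => ?_,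
    |a * ε| * (2 * (1 + |σ| + C) / ρ), fun p hp => ?_⟩
  · rw [strip_coe] at hp
    have hder : fderiv ℝ (fun p => b (Z p)) p = (a * ε / 2 * Real.cos (Z p)) • fderiv ℝ Z p :=
      ((hasDerivAt_waveProfile c (a * ε) (Z p)).comp_hasFDerivAt p
        (hZs.differentiable (by simp) p).hasFDerivAt).fderiv
    rw [hder, smul_apply]
    suffices fderiv ℝ Z p (1, velocity F M (b (Z p))) = 0 by rw [this, smul_zero]
    set v := velocity F M (b (Z p)) with hv
    have h1 : HasDerivAt (fun s : ℝ => (p.1 + s, p.2 + s • v)) ((1 : ℝ), v) 0 := by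
      refine ((hasDerivAt_id (0 : ℝ)).const_add p.1).prodMk ?_
      simpa using ((hasDerivAt_id (0 : ℝ)).smul_const v).const_add p.2
    have h2 : HasFDerivAt Z (fderiv ℝ Z p) (p.1 + 0, p.2 + (0 : ℝ) • v) := by
      simpa using (hZs.differentiable (by simp) p).hasFDerivAt
    have h3 : HasDerivAt (fun s : ℝ => Z (p.1 + s, p.2 + s • v)) (fderiv ℝ Z p (1, v)) 0 :=
      h2.comp_hasDerivAt (l := Z) 0 h1
    have hGZ : G (Z p) = (inner ℝ ξ v - σ) / ρ := by
      simp only [hGd, inner_sub_left, hσ]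
      rw [real_inner_comm, real_inner_comm ξ (velocity F M c)]
    -- Z is constant along the characteristic line through p with velocity a(b(Z p)). Near p the
    -- cut-off χ is the identity, so the relation Z + tG(Z) = (ξ·x - σt)/ρ is preserved along the
    -- line.
    have h4 : (fun s : ℝ => Z (p.1 + s, p.2 + s • v)) =ᶠ[𝓝 0] fun _ => Z p := by
      filter_upwards [Metric.ball_mem_nhds (0 : ℝ) hT₀] with s hs
      rw [Metric.mem_ball, Real.dist_eq, sub_zero, abs_lt] at hs
      have h5 : χ (p.1 + s) = p.1 + s := hχid _ (abs_le.mpr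
        ⟨by linarith [hp.1.1, hs.1], by linarith [hp.1.2, hs.2]⟩)
      have h6 : χ p.1 = p.1 := hχid _ (abs_le.mpr
        ⟨by linarith [hp.1.1], by linarith [hp.1.2]⟩)
      have h7 : Z p + p.1 * G (Z p) = (inner ℝ ξ p.2 - σ * p.1) / ρ := by
        have := hYr (A p)
        rwa [show (A p).1 = p.1 from rfl, h6] at this
      have h8 : A (p.1 + s, p.2 + s • v) = (p.1 + s, Z p + χ (p.1 + s) * G (Z p)) := by
        refine Prod.ext rfl ?_
        simp only [hA, inner_add_right, real_inner_smul_right]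
        rw [h5, add_mul, ← add_assoc, h7, hGZ]
        ring
      change Y (A (p.1 + s, p.2 + s • v)) = Z p
      rw [h8]
      exact hYl _ _
    exact h3.unique ((hasDerivAt_const (0 : ℝ) (Z p)).congr_of_eventuallyEq h4)
  · have hnn : 0 ≤ |a * ε| * (2 * (1 + |σ| + C) / ρ) := by positivity
    refine norm_fderiv_le_of_lip' ℝ hnn ?_
    filter_upwards [(isOpen_strip d T₀).mem_nhds hp] with p' hp'
    rw [strip_coe] at hp hp'
    refine (abs_waveProfile_sub_waveProfile_le _ _ _ _).trans ?_
    rw [mul_assoc]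
    gcongr
    exact hlip _ _ (Ioo_subset_Icc_self hp'.1) (Ioo_subset_Icc_self hp.1)

end ScalarLaw

namespace ScalarLaw

/-! ### Bounds for the oscillating solutions -/

section General

set_option linter.unusedSectionVars false

variable {E : Type} [NormedAddCommGroup E] [NormedSpace ℝ E] [MeasureSpace E] [BorelSpace E]
  [FiniteDimensional ℝ E] [(volume : Measure E).IsAddHaarMeasure]

/-- One formula a(b/a)^s for the whole range: for 0 < s < 1 it is interpolation; at s = 1 it is the
bound b on the gradient, treated separately because s = 1 involves a weak derivative and no
seminorm. -/
lemma exists_sobolevNorm_le (E : Type) [NormedAddCommGroup E] [NormedSpace ℝ E] [MeasureSpace E]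
    [BorelSpace E] [FiniteDimensional ℝ E] [(volume : Measure E).IsAddHaarMeasure] [Nontrivial E]
    {s : ℝ} (h0 : 0 ≤ s) (h1 : s ≤ 1) : ∃ K : ℝ≥0,
    ∀ (Ω : Set E) (f : E → ℝ) (m a b : ℝ), IsOpen Ω → ContDiff ℝ 1 f → 0 < a → 0 < b →
      (∀ x ∈ Ω, ‖f x‖ ≤ m) → (∀ x ∈ Ω, ∀ y ∈ Ω, ‖f x - f y‖ ≤ a) →
      (∀ x ∈ Ω, ∀ y ∈ Ω, ‖f x - f y‖ ≤ b * ‖x - y‖) →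
      sobolevNorm s Ω f ≤
        (ENNReal.ofReal m + ENNReal.ofReal (a * (b / a) ^ s) * K) * volume Ω := by
  have hL1 : ∀ (Ω : Set E) (f : E → ℝ) (m : ℝ), MeasurableSet Ω → (∀ x ∈ Ω, ‖f x‖ ≤ m) →
      ∫⁻ x in Ω, ‖f x‖ₑ ≤ ENNReal.ofReal m * volume Ω := by
    intro Ω f m hΩ hf
    rw [← setLIntegral_const]
    refine setLIntegral_mono' hΩ fun x hx => ?_
    rw [← ofReal_norm]
    exact ENNReal.ofReal_le_ofReal (hf x hx)
  rcases h1.lt_or_eq with h1 | rfl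
  · refine ⟨(gagliardoConst E s).toNNReal, fun Ω f m a b hΩ _ ha hb hm hfa hfb => ?_⟩
    rw [sobolevNorm_of_lt_one h0 h1, add_mul]
    refine add_le_add (hL1 Ω f m hΩ.measurableSet hm) ?_
    split_ifs with hs
    · rw [ENNReal.coe_toNNReal (gagliardoConst_lt_top hs h1).ne]
      exact gagliardo_le ha hb hΩ.measurableSet hfa hfb
    · exact zero_le
  · refine ⟨1, fun Ω f m a b hΩ hf ha hb hm hfa hfb => (sobolevNorm_one_le Ω hf).trans ?_⟩
    rw [add_mul, Real.rpow_one, mul_div_cancel₀ _ ha.ne', ENNReal.coe_one, mul_one]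
    refine add_le_add (hL1 Ω f m hΩ.measurableSet hm) ?_
    rw [← setLIntegral_const]
    refine setLIntegral_mono' hΩ.measurableSet fun x hx => ?_
    rw [← ofReal_norm]
    refine ENNReal.ofReal_le_ofReal (norm_fderiv_le_of_lip' ℝ hb.le ?_)
    filter_upwards [hΩ.mem_nhds hx] with y hy
    exact hfb y hy x hx

/-- Uniform upper bounds for waves of amplitude `ε` and wave length `ε ^ q`. -/
lemma exists_sobolevNorm_wave_le [Nontrivial E] {s : ℝ} {q : ℕ} (hq : 1 ≤ q) (h0 : 0 ≤ s)
    (h1 : s ≤ 1 / q) {L M : ℝ} (hL : 1 ≤ L) {Ω : Set E} (hΩ : IsOpen Ω) (hv : volume Ω ≠ ⊤) :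
    ∃ C : ℝ≥0, ∀ (ε c a : ℝ) (Z : E → ℝ), ε ∈ Ioo 0 1 → |a| < 1 → ContDiff ℝ ∞ Z →
      (∀ θ, waveProfile c (a * ε) θ ∈ Icc (-M) M) →
      (∀ x ∈ Ω, ∀ y ∈ Ω, |Z x - Z y| ≤ L / ε ^ q * ‖x - y‖) →
      sobolevNorm s Ω (fun x => waveProfile c (a * ε) (Z x)) ≤ C := by
  have hq0 : (0 : ℝ) < q := by exact_mod_cast hq
  have hs1 : s ≤ 1 := h1.trans (by rw [div_le_one hq0]; exact_mod_cast hq)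
  obtain ⟨K, hK⟩ := exists_sobolevNorm_le E h0 hs1
  have hfin : (ENNReal.ofReal M + ENNReal.ofReal (2 * L) * K) * volume Ω ≠ ⊤ :=
    ENNReal.mul_ne_top (by finiteness) hv
  refine ⟨((ENNReal.ofReal M + ENNReal.ofReal (2 * L) * K) * volume Ω).toNNReal,
    fun ε c a Z hε ha hZ hmem hlip => ?_⟩
  rw [ENNReal.coe_toNNReal hfin]
  have hε0 := hε.1
  have hμ : |a * ε| ≤ ε := by
    rw [abs_mul, abs_of_pos hε0]
    exact mul_le_of_le_one_left hε0.le ha.le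
  refine (hK Ω _ M (2 * ε) (2 * ε * (L / ε ^ q)) hΩ
    (((contDiff_waveProfile c _).comp hZ).of_le (by simp)) (by positivity) (by positivity)
    (fun x _ => abs_le.mpr (hmem _)) (fun x _ y _ => ?_) (fun x hx y hy => ?_)).trans ?_
  · have e : waveProfile c (a * ε) (Z x) - waveProfile c (a * ε) (Z y) =
      (waveProfile c (a * ε) (Z x) - c) - (waveProfile c (a * ε) (Z y) - c) := by ring
    change |waveProfile c (a * ε) (Z x) - waveProfile c (a * ε) (Z y)| ≤ 2 * ε
    rw [e]
    refine (abs_sub _ _).trans ?_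
    linarith [abs_waveProfile_sub_le c (a * ε) (Z x), abs_waveProfile_sub_le c (a * ε) (Z y)]
  · refine (abs_waveProfile_sub_waveProfile_le _ _ _ _).trans ?_
    rw [mul_assoc]
    gcongr
    · linarith
    · exact hlip x hx y hy
  -- The quantity is 2L^s ε^(1-qs), where qs ≤ 1 and ε < 1; this is the only place where s ≤ 1/q
  -- matters for the size of the norm.
  · suffices h : 2 * ε * (2 * ε * (L / ε ^ q) / (2 * ε)) ^ s ≤ 2 * L by gcongr
    rw [mul_div_cancel_left₀ _ (by positivity), Real.div_rpow (by linarith) (by positivity),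
      ← Real.rpow_natCast, ← Real.rpow_mul hε0.le, mul_assoc]
    have hLs : L ^ s ≤ L := by
      conv_rhs => rw [← Real.rpow_one L]
      exact Real.rpow_le_rpow_of_exponent_le hL hs1
    have hqs : (q : ℝ) * s ≤ 1 := by
      rw [le_div_iff₀ hq0] at h1
      linarith
    have hεs : ε ≤ ε ^ ((q : ℝ) * s) := by
      conv_lhs => rw [← Real.rpow_one ε]
      exact Real.rpow_le_rpow_of_exponent_ge hε0 hε.2.le hqs
    have hpos : 0 < ε ^ ((q : ℝ) * s) := by positivity
    gcongr
    rw [mul_div_assoc', div_le_iff₀ hpos, mul_comm]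
    gcongr

/-- Waves of amplitude `ε` and wave length `ε ^ q` are unbounded in `W^{s,1}` for `s > 1 / q`. -/
lemma exists_lt_sobolevNorm_wave {s : ℝ} {q : ℕ} (hq : 1 ≤ q) (hs : 1 / (q : ℝ) < s) {L a : ℝ}
    (hL : 1 ≤ L) (ha : 0 < |a|) {Ω : Set E} (hΩ : IsOpen Ω) (hne : Ω.Nonempty) {e : E}
    {Z : ℝ → E → ℝ} {c : ℝ}
    (hZ : ∀ ε ∈ Ioo (0 : ℝ) 1, ∀ Ω', (∀ x ∈ Ω', Metric.ball x (11 * ε ^ q) ⊆ Ω) →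
      IsPhase Ω Ω' (ε ^ q) L 11 e (Z ε)) (C : ℝ≥0) :
    ∃ ε ∈ Ioo (0 : ℝ) 1, C < sobolevNorm s Ω (fun x => waveProfile c (a * ε) (Z ε x)) := by
  obtain ⟨x₀, hx₀⟩ := hne
  obtain ⟨δ, hδ, hball⟩ := Metric.isOpen_iff.mp hΩ x₀ hx₀
  obtain ⟨k, γ, hk, hγ, hlow⟩ := exists_le_sobolevNorm_wave hΩ
    (Metric.isOpen_ball (x := x₀) (ε := δ / 2)).measurableSet
    (Metric.measure_ball_pos _ _ (by positivity)).ne' Metric.isBounded_ball.measure_lt_top.ne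
    hL (show (0 : ℝ) < 11 by norm_num) ha hq hs
  have hlim : Tendsto (fun ε : ℝ => k * ε ^ (-γ)) (𝓝[>] 0) atTop :=
    (tendsto_rpow_neg_nhdsGT_zero (neg_neg_of_pos hγ)).const_mul_atTop hk
  -- With ε^q ≤ ε this gives 11ε^q < δ/2, so balls of that radius about points of the ball of radius
  -- δ/2 stay in Ω.
  have hsmall : ∀ᶠ ε : ℝ in 𝓝[>] 0, ε < min 1 (δ / 22) :=
    nhdsWithin_le_nhds (Iio_mem_nhds (by positivity))
  obtain ⟨ε, h1, h2, h3⟩ := ((hlim.eventually_gt_atTop (C : ℝ)).and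
    (hsmall.and self_mem_nhdsWithin)).exists
  have hε0 : 0 < ε := h3
  obtain ⟨hε1, hεδ⟩ := lt_min_iff.mp h2
  refine ⟨ε, ⟨hε0, hε1⟩, ?_⟩
  have hpow : ε ^ q ≤ ε := pow_le_of_le_one hε0.le hε1.le (by omega)
  have hphase := hZ ε ⟨hε0, hε1⟩ (Metric.ball x₀ (δ / 2)) fun x hx =>
    (Metric.ball_subset_ball' (by rw [Metric.mem_ball] at hx; linarith)).trans hball
  refine lt_of_lt_of_le ?_ (hlow ε c (a * ε) e (Z ε) hε0
    (by rw [abs_mul, abs_of_pos hε0]) hphase)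
  rw [← ENNReal.ofReal_coe_nnreal]
  exact (ENNReal.ofReal_lt_ofReal_iff (by positivity)).mpr h1

/-- The time slices of a `C¹` function are continuous in `W^{s,1}_loc`, `s ≤ 1`. -/
lemma continuousSobolevLoc_of_contDiff [Nontrivial E] {U : ℝ × E → ℝ} (hU : ContDiff ℝ 1 U)
    {s : ℝ} (h0 : 0 ≤ s) (h1 : s ≤ 1) (I : Set ℝ) :
    ContinuousSobolevLoc s I (fun t x => U (t, x)) := by
  intro t₀ _ x A hA
  refine Tendsto.mono_left ?_ nhdsWithin_le_nhds
  obtain ⟨K, hK⟩ := exists_sobolevNorm_le E h0 h1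
  have hslice : ∀ t, ContDiff ℝ 1 fun y => U (t, y) := fun t =>
    hU.comp (contDiff_const.prodMk contDiff_id)
  have hder : ∀ t y, HasFDerivAt (fun y => U (t, y))
      ((fderiv ℝ U (t, y)).comp (ContinuousLinearMap.inr ℝ ℝ E)) y := fun t y =>
    (hU.differentiable one_ne_zero (t, y)).hasFDerivAt.comp y (hasFDerivAt_prodMk_right t y)
  have hcont : Continuous fun p : ℝ × E =>
      (fderiv ℝ U p).comp (ContinuousLinearMap.inr ℝ ℝ E) :=
    (hU.continuous_fderiv one_ne_zero).clm_comp continuous_const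
  -- Compactness of the closed ball makes the difference of two slices and its gradient uniformly
  -- small; the interpolation bound with a = b = η then no longer depends on s.
  have key : ∀ η : ℝ, 0 < η → ∀ᶠ t in 𝓝 t₀,
      sobolevNorm s (Metric.ball x A) ((fun y => U (t, y)) - fun y => U (t₀, y)) ≤
        ENNReal.ofReal η * ((1 + K) * volume (Metric.ball x A)) := by
    intro η hη
    have hcpt : IsCompact (Metric.closedBall x A) := isCompact_closedBall x A
    have e1 : ∀ᶠ t in 𝓝 t₀, ∀ y ∈ Metric.closedBall x A, ‖U (t, y) - U (t₀, y)‖ < η / 2 := by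
      refine hcpt.eventually_forall_of_forall_eventually fun y _ => ?_
      have hc : Continuous fun p : ℝ × E => ‖U (p.1, p.2) - U (t₀, p.2)‖ := by
        have := hU.continuous
        fun_prop
      have := hc.tendsto (t₀, y)
      simp only [sub_self, norm_zero] at this
      exact this.eventually_lt_const (by positivity)
    have e2 : ∀ᶠ t in 𝓝 t₀, ∀ y ∈ Metric.closedBall x A,
        ‖(fderiv ℝ U (t, y)).comp (ContinuousLinearMap.inr ℝ ℝ E) -
          (fderiv ℝ U (t₀, y)).comp (ContinuousLinearMap.inr ℝ ℝ E)‖ < η := by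
      refine hcpt.eventually_forall_of_forall_eventually fun y _ => ?_
      have hc : Continuous fun p : ℝ × E =>
          ‖(fderiv ℝ U (p.1, p.2)).comp (ContinuousLinearMap.inr ℝ ℝ E) -
          (fderiv ℝ U (t₀, p.2)).comp (ContinuousLinearMap.inr ℝ ℝ E)‖ :=
        ((hcont.comp (by fun_prop : Continuous fun p : ℝ × E => (p.1, p.2))).sub
          (hcont.comp (by fun_prop : Continuous fun p : ℝ × E => (t₀, p.2)))).norm
      have := hc.tendsto (t₀, y)
      simp only [sub_self, norm_zero] at this
      exact this.eventually_lt_const hη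
    filter_upwards [e1, e2] with t ht1 ht2
    have hlip : ∀ y ∈ Metric.ball x A, ∀ z ∈ Metric.ball x A,
        ‖((fun y => U (t, y)) - fun y => U (t₀, y)) y -
          ((fun y => U (t, y)) - fun y => U (t₀, y)) z‖ ≤ η * ‖y - z‖ := fun y hy z hz =>
      (convex_ball x A).norm_image_sub_le_of_norm_hasFDerivWithin_le
        (fun w _ => ((hder t w).sub (hder t₀ w)).hasFDerivWithinAt)
        (fun w hw => (ht2 w (Metric.ball_subset_closedBall hw)).le) hz hy
    have hsup : ∀ y ∈ Metric.ball x A,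
        ‖((fun y => U (t, y)) - fun y => U (t₀, y)) y‖ ≤ η / 2 := fun y hy =>
      (ht1 y (Metric.ball_subset_closedBall hy)).le
    refine (hK _ _ η η η Metric.isOpen_ball ((hslice t).sub (hslice t₀)) hη hη
      (fun y hy => (hsup y hy).trans (by linarith)) (fun y hy z hz => ?_) hlip).trans ?_
    · refine (norm_sub_le _ _).trans ?_
      exact (add_le_add (hsup y hy) (hsup z hz)).trans (add_halves η).le
    · rw [div_self hη.ne', Real.one_rpow, mul_one, ← mul_one_add, mul_assoc]
  have hv : (1 + (K : ℝ≥0∞)) * volume (Metric.ball x A) ≠ ⊤ :=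
    ENNReal.mul_ne_top (by finiteness) Metric.isBounded_ball.measure_lt_top.ne
  rw [ENNReal.tendsto_nhds_zero]
  intro δ hδ
  have hlim : Tendsto (fun η : ℝ => ENNReal.ofReal η *
      ((1 + (K : ℝ≥0∞)) * volume (Metric.ball x A))) (𝓝[>] 0) (𝓝 0) := by
    have h3 : Tendsto (fun η : ℝ => ENNReal.ofReal η) (𝓝[>] 0) (𝓝 0) := by
      have := (ENNReal.continuous_ofReal.tendsto 0).mono_left
        (nhdsWithin_le_nhds (s := Ioi (0 : ℝ)))
      simpa using this
    simpa using ENNReal.Tendsto.mul_const h3 (Or.inr hv)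
  obtain ⟨η, hη1, hη0⟩ := (((ENNReal.tendsto_nhds_zero.mp hlim) δ hδ).and
    self_mem_nhdsWithin).exists
  filter_upwards [key η hη0] with t ht
  exact ht.trans hη1

end General

/-! ### Space-time phases and their time slices -/

variable {d : ℕ} {T₀ ρ L : ℝ} {ξ : EuclideanSpace ℝ (Fin d)}
  {Z : ℝ × EuclideanSpace ℝ (Fin d) → ℝ}

lemma IsSpaceTimePhase.isPhase (h : IsSpaceTimePhase T₀ ρ L ξ Z) (hξ : ‖ξ‖ = 1)
    {Ω Ω' : Set (ℝ × EuclideanSpace ℝ (Fin d))} (hΩ : Ω ⊆ strip d (T₀ : EReal))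
    (hb : ∀ x ∈ Ω', Metric.ball x (11 * ρ) ⊆ Ω) : IsPhase Ω Ω' ρ L 11 (0, ξ) Z := by
  rw [strip_coe] at hΩ
  refine ⟨h.contDiff, fun x hx y hy => h.lipschitz x y (Ioo_subset_Icc_self (hΩ hx).1)
    (Ioo_subset_Icc_self (hΩ hy).1), hb, fun x _ θ hθ => ?_, by simp [hξ],
    fun x _ => h.le_deriv x, fun x _ => h.deriv_le x⟩
  obtain ⟨r, hr, hZ⟩ := h.reach x θ hθ
  refine ⟨_, ?_, hZ⟩
  have : (x.1, x.2 + r • ξ) - x = (0, r • ξ) := Prod.ext (by simp) (by simp)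
  rw [this]
  simp only [Prod.norm_mk, norm_zero, norm_smul, hξ, mul_one, Real.norm_eq_abs]
  rw [max_eq_right (abs_nonneg _)]
  linarith

lemma IsSpaceTimePhase.abs_slice_sub_le (h : IsSpaceTimePhase T₀ ρ L ξ Z) {t : ℝ}
    (ht : t ∈ Icc 0 T₀) (x y : EuclideanSpace ℝ (Fin d)) :
    |Z (t, x) - Z (t, y)| ≤ L / ρ * ‖x - y‖ := by
  have := h.lipschitz (t, x) (t, y) ht ht
  simpa [Prod.norm_def] using this

lemma IsSpaceTimePhase.isPhase_slice (h : IsSpaceTimePhase T₀ ρ L ξ Z) (hξ : ‖ξ‖ = 1) {t : ℝ}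
    (ht : t ∈ Icc 0 T₀) {Ω Ω' : Set (EuclideanSpace ℝ (Fin d))}
    (hb : ∀ x ∈ Ω', Metric.ball x (11 * ρ) ⊆ Ω) :
    IsPhase Ω Ω' ρ L 11 ξ (fun x => Z (t, x)) := by
  have hder : ∀ x, fderiv ℝ (fun x => Z (t, x)) x ξ = fderiv ℝ Z (t, x) (0, ξ) := by
    intro x
    have h1 : HasFDerivAt (fun x => Z (t, x)) _ x :=
      (h.contDiff.differentiable (by simp) (t, x)).hasFDerivAt.comp x
        (hasFDerivAt_prodMk_right t x)
    rw [h1.fderiv]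
    simp
  refine ⟨h.contDiff.comp (contDiff_const.prodMk contDiff_id),
    fun x _ y _ => h.abs_slice_sub_le ht x y, hb, fun x _ θ hθ => ?_, hξ,
    fun x _ => ?_, fun x _ => ?_⟩
  · obtain ⟨r, hr, hZ⟩ := h.reach (t, x) θ hθ
    refine ⟨_, ?_, hZ⟩
    rw [add_sub_cancel_left, norm_smul, hξ, mul_one, Real.norm_eq_abs]
    linarith
  · rw [hder]; exact h.le_deriv _
  · rw [hder]; exact h.deriv_le _

end ScalarLaw

/-! ### The main theorem -/

theorem mainTheorem1 (d : ℕ) (hd : 1 ≤ d) (M : ℝ) (hM : 0 < M)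
    (F : ℝ → EuclideanSpace ℝ (Fin d)) (hF : ContDiffOn ℝ ∞ F (Icc (-M) M))
    (hnl : ScalarLaw.IsNonlinearFlux F M) :
    (∃ ubar ∈ Icc (-M) M, ∃ T₀ : ℝ, 0 < T₀ ∧
      ∃ (u₀ : ℝ → EuclideanSpace ℝ (Fin d) → ℝ) (u : ℝ → ℝ → EuclideanSpace ℝ (Fin d) → ℝ),
        -- the initial data and their entropy solutions on `[0,T₀[ × ℝ^d`
        (∀ ε ∈ Ioo (0 : ℝ) 1,
          ScalarLaw.IsInitialDatum M (u₀ ε) ∧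
          eLpNorm (fun x => u₀ ε x - ubar) ⊤ volume < ENNReal.ofReal ε ∧
          ScalarLaw.IsEntropySolution F M (T₀ : EReal) (u₀ ε) (u ε) ∧
          ∀ (T : EReal) (w : ℝ → EuclideanSpace ℝ (Fin d) → ℝ), (T₀ : EReal) ≤ T →
            ScalarLaw.IsEntropySolution F M T (u₀ ε) w →
            ∀ᵐ p ∂(volume.restrict (ScalarLaw.strip d (T₀ : EReal))), w p.1 p.2 = u ε p.1 p.2) ∧
        -- uniform bounds for `s ≤ α_sup`
        (∀ s : ℝ, 0 ≤ s → s ≤ ScalarLaw.alphaSup F M →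
          ScalarLaw.BddSobolevLoc s (ScalarLaw.strip d (T₀ : EReal))
            {f | ∃ ε ∈ Ioo (0 : ℝ) 1, f = Function.uncurry (u ε)} ∧
          (∀ ε ∈ Ioo (0 : ℝ) 1, ScalarLaw.ContinuousSobolevLoc s (Icc 0 T₀) (u ε)) ∧
          ScalarLaw.BddSobolevLoc s univ
            {f | ∃ ε ∈ Ioo (0 : ℝ) 1, ∃ t ∈ Icc 0 T₀, f = u ε t}) ∧
        -- no uniform bounds for `s > α_sup`
        (∀ s : ℝ, ScalarLaw.alphaSup F M < s →
          ¬ ScalarLaw.BddSobolevLoc s (ScalarLaw.strip d (T₀ : EReal))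
            {f | ∃ ε ∈ Ioo (0 : ℝ) 1, f = Function.uncurry (u ε)} ∧
          ¬ ScalarLaw.BddSobolevLoc s univ
            {f | ∃ ε ∈ Ioo (0 : ℝ) 1, ∃ t ∈ Icc 0 T₀, f = u ε t})) ∧
    ScalarLaw.uniformSmoothingSup F M ≤ (ScalarLaw.alphaSup F M : EReal) := by

  obtain ⟨q, hq, hα, c, ξ, hdeg⟩ := ScalarLaw.exists_isDegenerate_alphaSup hd hM hF hnl
  have hc := hdeg.1
  have hξ : ‖ξ‖ = 1 := hdeg.2.1
  obtain ⟨a, ha0, ha1, hmem⟩ := ScalarLaw.exists_amplitude hM hc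
  obtain ⟨T₀, L, hT₀, hL, hex⟩ := ScalarLaw.exists_oscillating_solution hM hF hq hdeg ha1 hmem
  choose! Z hZ hsol using hex
  have : Nonempty (Fin d) := ⟨⟨0, hd⟩⟩
  have : (volume : Measure (ℝ × EuclideanSpace ℝ (Fin d))).IsAddHaarMeasure := by
    rw [Measure.volume_eq_prod]
    infer_instance
  set u : ℝ → ℝ → EuclideanSpace ℝ (Fin d) → ℝ :=
    fun ε t x => ScalarLaw.waveProfile c (a * ε) (Z ε (t, x)) with hu
  have huncurry : ∀ ε, Function.uncurry (u ε) =
      fun p => ScalarLaw.waveProfile c (a * ε) (Z ε p) := fun ε => rfl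
  have hq0 : (0 : ℝ) < q := by exact_mod_cast hq
  have hα1 : 1 / (q : ℝ) ≤ 1 := by
    rw [div_le_one hq0]
    exact_mod_cast hq
  have hcont : ∀ ε ∈ Ioo (0 : ℝ) 1, ∀ s : ℝ, 0 ≤ s → s ≤ 1 → ∀ I,
      ScalarLaw.ContinuousSobolevLoc s I (u ε) := fun ε hε s h0 h1 I =>
    ScalarLaw.continuousSobolevLoc_of_contDiff ((hsol ε hε).contDiff.of_le (by simp)) h0 h1 I
  have hslice : ∀ ε ∈ Ioo (0 : ℝ) 1, ∀ t, Continuous (u ε t) := fun ε hε t =>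
    (hsol ε hε).contDiff.continuous.comp (by fun_prop : Continuous fun x => (t, x))
  have hdatum : ∀ ε ∈ Ioo (0 : ℝ) 1, ScalarLaw.IsInitialDatum M (u ε 0) := fun ε hε =>
    ⟨(hslice ε hε 0).aestronglyMeasurable, Eventually.of_forall fun x => hmem ε hε _⟩
  have hent : ∀ ε ∈ Ioo (0 : ℝ) 1, ScalarLaw.IsEntropySolution F M (T₀ : EReal) (u ε 0) (u ε) :=
    fun ε hε => (hsol ε hε).isEntropySolution hM hT₀ hF
  have hmid : T₀ / 2 ∈ Icc 0 T₀ := ⟨by positivity, by linarith⟩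
  -- Blow-up at the single time T₀/2 serves both the unboundedness of the time slices and the bound
  -- on the smoothing exponent.
  have hunbdd : ∀ s : ℝ, 1 / (q : ℝ) < s → ∀ A : ℝ, 0 < A → ∀ C : ℝ≥0, ∃ ε ∈ Ioo (0 : ℝ) 1,
      C < ScalarLaw.sobolevNorm s
        (Metric.ball (0 : EuclideanSpace ℝ (Fin d)) A ∩ univ) (u ε (T₀ / 2)) := by
    intro s hs A hA C
    rw [inter_univ]
    exact ScalarLaw.exists_lt_sobolevNorm_wave hq hs hL ha0 Metric.isOpen_ball
      (Metric.nonempty_ball.mpr hA) (Z := fun ε x => Z ε (T₀ / 2, x)) (e := ξ)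
      (fun ε hε Ω' hΩ' => (hZ ε hε).isPhase_slice hξ hmid hΩ') C
  refine ⟨⟨c, hc, T₀, hT₀, fun ε => u ε 0, u, fun ε hε => ⟨hdatum ε hε, ?_, hent ε hε,
    fun T w hT hw => (hsol ε hε).unique hM hT₀ hF hT hw⟩, fun s h0 h1 => ?_, fun s hs => ?_⟩, ?_⟩
  · rw [eLpNorm_exponent_top]
    refine (eLpNormEssSup_le_of_ae_bound (C := |a| * ε) (Eventually.of_forall fun x => ?_)).trans_lt
      ((ENNReal.ofReal_lt_ofReal_iff hε.1).mpr (mul_lt_of_lt_one_left hε.1 ha1))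
    have := ScalarLaw.abs_waveProfile_sub_le c (a * ε) (Z ε (0, x))
    rwa [abs_mul, abs_of_pos hε.1] at this
  · rw [hα] at h1
    refine ⟨fun x _ => ⟨1, one_pos, ?_⟩, fun ε hε => hcont ε hε s h0 (h1.trans hα1) _,
      fun x _ => ⟨1, one_pos, ?_⟩⟩
    · obtain ⟨C, hC⟩ := ScalarLaw.exists_sobolevNorm_wave_le hq h0 h1 (M := M) hL
        (Metric.isOpen_ball.inter (ScalarLaw.isOpen_strip d T₀))
        (Ω := Metric.ball x 1 ∩ ScalarLaw.strip d (T₀ : EReal))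
        ((measure_mono inter_subset_left).trans_lt Metric.isBounded_ball.measure_lt_top).ne
      refine ⟨C, ?_⟩
      rintro _ ⟨ε, hε, rfl⟩
      refine hC ε c a (Z ε) hε ha1 (hZ ε hε).contDiff (hmem ε hε) fun y hy z hz => ?_
      have hy' := hy.2
      have hz' := hz.2
      rw [ScalarLaw.strip_coe] at hy' hz'
      exact (hZ ε hε).lipschitz y z (Ioo_subset_Icc_self hy'.1) (Ioo_subset_Icc_self hz'.1)
    · obtain ⟨C, hC⟩ := ScalarLaw.exists_sobolevNorm_wave_le hq h0 h1 (M := M) hL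
        (Metric.isOpen_ball.inter isOpen_univ) (Ω := Metric.ball x 1 ∩ univ)
        ((measure_mono inter_subset_left).trans_lt Metric.isBounded_ball.measure_lt_top).ne
      refine ⟨C, ?_⟩
      rintro _ ⟨ε, hε, t, ht, rfl⟩
      exact hC ε c a (fun x => Z ε (t, x)) hε ha1
        ((hZ ε hε).contDiff.comp (contDiff_const.prodMk contDiff_id)) (hmem ε hε)
        fun y _ z _ => (hZ ε hε).abs_slice_sub_le ht y z
  · rw [hα] at hs
    refine ⟨fun h => ?_, fun h => ?_⟩
    · have hx : ((T₀ / 2, 0) : ℝ × EuclideanSpace ℝ (Fin d)) ∈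
          ScalarLaw.strip d (T₀ : EReal) := by
        rw [ScalarLaw.strip_coe]
        exact ⟨⟨by positivity, by linarith⟩, mem_univ _⟩
      obtain ⟨A, hA, C, hC⟩ := h _ (subset_closure hx)
      obtain ⟨ε, hε, hlt⟩ := ScalarLaw.exists_lt_sobolevNorm_wave hq hs hL ha0
        (Metric.isOpen_ball.inter (ScalarLaw.isOpen_strip d T₀))
        ⟨_, Metric.mem_ball_self hA, hx⟩ (Z := Z) (e := (0, ξ)) (c := c)
        (fun ε hε Ω' hΩ' => (hZ ε hε).isPhase hξ inter_subset_right hΩ') C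
      exact absurd (hC _ ⟨ε, hε, rfl⟩) (not_le.mpr hlt)
    · obtain ⟨A, hA, C, hC⟩ := h 0 (by simp)
      obtain ⟨ε, hε, hlt⟩ := hunbdd s hs A hA C
      exact absurd (hC _ ⟨ε, hε, T₀ / 2, hmid, rfl⟩) (not_le.mpr hlt)
  · refine iSup₂_le fun s hs => EReal.coe_le_coe_iff.mpr ?_
    rw [hα]
    by_contra hlt
    -- The waves are admissible in `solutionsAt` at time T₀/2 as solutions on the strip up to T₀;
    -- their continuity in L¹_loc is the case s = 0 of the Sobolev continuity.
    obtain ⟨A, hA, C, hC⟩ := hs.2 (T₀ / 2) (by positivity) 0 (by simp)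
    obtain ⟨ε, hε, hlt'⟩ := hunbdd s (not_le.mp hlt) A hA C
    refine absurd (hC _ ⟨(T₀ : EReal), u ε 0, u ε, ?_, hdatum ε hε, hent ε hε, fun t₀ ht₀ =>
      ⟨(hslice ε hε t₀).aestronglyMeasurable, fun x A hA => ?_⟩, rfl⟩) (not_le.mpr hlt')
    · exact EReal.coe_lt_coe_iff.mpr (by linarith)
    · have := hcont ε hε 0 le_rfl zero_le_one _ t₀ ht₀ x A hA
      simpa [ScalarLaw.sobolevNorm_of_lt_one le_rfl zero_lt_one] using this
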